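/- **Setting.** Inputs $x,y$ and outputs $a,b$ are bits, and a behavior is a table $\mathrm P=(\mathrm p(a,b|x,y))$. Put $\langle B_{x,y}\rangle=\sum_{a,b}(-1)^b\mathrm p(a,b|x,y)$ and $\langle A_xB_y\rangle=\sum_{a,b}(-1)^{a+b}\mathrm p(a,b|x,y)$. For $p\in(2/5,1)$ let $$T_p(\mathrm P)=\langle B_{0,1}\rangle-\langle B_{0,0}\rangle+\tfrac{1-p}{p}\big(\langle B_{1,0}\rangle-\langle B_{1,1}\rangle\big)+\langle A_0B_0\rangle+\langle A_0B_1\rangle+\tfrac{1-p}{p}\big(\langle A_1B_0\rangle-\langle A_1B_1\rangle\big).$$ A *non-signaling local* behavior has the form $\sum_\lambda \mathrm p(\lambda)\mathrm p(a|x,\lambda)\mathrm p(b|y,\lambda)$. The polytope $\mathbb S_{(p,p),(1/2,1/2)}$ consists of the behaviors $$\sum_\lambda \mathrm p(\lambda)\sum_{\tilde x,\tilde y}\tfrac12\,\mathrm p(\tilde x|x)\,\mathrm p(a|x,\tilde y,\lambda)\,\mathrm p(b|\tilde x,y,\lambda),\qquad \mathrm p(\tilde x|x)=\begin{cases}p,&\tilde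 x=x,\\1-p,&\tilde x\ne x.\end{cases}$$ A *non-signaling quantum strategy* consists of Hilbert spaces $\mathcal H_A,\mathcal H_B$, POVMs $\{M_{a|x}\}_a$ on $\mathcal H_A$ and $\{N_{b|y}\}_b$ on $\mathcal H_B$, and a density operator $\rho$ on $\mathcal H_A\otimes\mathcal H_B$. Its behavior is $\mathrm p(a,b|x,y)=\mathrm{Tr}[(M_{a|x}\otimes N_{b|y})\rho]$, and its observables are $A_x=M_{0|x}-M_{1|x}$, $B_y=N_{0|y}-N_{1|y}$. It is *projective* if all $M_{a|x},N_{b|y}$ are projections. Define $\theta,\phi$ as follows. If $p=1/2$, then $\theta=\phi=-\pi/4$. If $p\neq1/2$, then $\phi=\arctan(f_2/g_2)$, while $\theta=\frac12\arctan(f_1/g_1)-\frac\pi2$ for $p>1/2$ and $\theta=\frac12\arctan(f_1/g_1)$ for $p<1/2$, where $$f_1=\tfrac{\sqrt{p(5p-2)}}{1-3p},\quad g_1=\tfrac{1-2p}{3p-1},\quad f_2=-\sqrt{\tfrac{5p-2}{6p-2}},\quad g_2=\sqrt{\tfrac{p}{6p-2}}.$$ (So $\sin2\theta=f_1$ and $\cos2\theta=g_1$.)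 **Proposition.** Let $p\in(2/5,1)$. 1. The maximum of $T_p$ over non-signaling local behaviors is $2(|2p-1|+1-p)/p$. 2. The maximum of $T_p$ over $\mathbb S_{(p,p),(1/2,1/2)}$ is $2\max\{p,|-p+2(1-p)^2/p|\}+2(1-p)$. For $p\ge1/2$ the values in 1 and 2 both equal $2$. 3. Every non-signaling quantum behavior satisfies $T_p(\mathrm P)\le\eta:=2\sqrt2\sqrt{p/(3p-1)}$. This bound has a sum-of-squares certificate. For every projective quantum strategy, with $$\mathcal B_p=\tfrac{1-2p}{p}\,\mathbb 1\otimes(B_0-B_1)+A_0\otimes(B_0+B_1)+\tfrac{1-p}{p}A_1\otimes(B_0-B_1),$$ one has $T_p(\mathrm P)=\mathrm{Tr}[\mathcal B_p\rho]$ and $$\eta\,\mathbb 1-\mathcal B_p=\tfrac{\sin\phi}{\lambda^2\sin2\theta}\big(N_0^\dagger N_0+\lambda^2N_1^\dagger N_1\big),$$ where $\lambda^2=\frac{3p-1}{1-p}>0$, $\frac{\sin\phi}{\lambda^2\sin2\theta}>0$, and $$N_0=A_1\otimes\mathbb 1-\mathbb 1\otimes\tfrac{B_0-B_1}{2\cos\phi},\qquad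 N_1=A_0\otimes\mathbb 1-\sin2\theta\;\mathbb 1\otimes\tfrac{B_0+B_1}{2\sin\phi}-\cos2\theta\;A_0\otimes\tfrac{B_0-B_1}{2\cos\phi}.$$ 4. The value $\eta$ is attained by the projective two-qubit strategy with state $|\psi_\theta\rangle=\cos\theta|00\rangle+\sin\theta|11\rangle$ and observables $A_0=\sigma_X$, $A_1=\sigma_Z$, $B_0=\cos\phi\,\sigma_Z+\sin\phi\,\sigma_X$, $B_1=-\cos\phi\,\sigma_Z+\sin\phi\,\sigma_X$; write $\bar M_{a|x},\bar N_{b|y}$ for its projections. It is unique up to local isometries. That is, for every projective quantum strategy $(M,N,\rho)$ with $T_p(\mathrm P)=\eta$ there are Hilbert spaces $\mathcal K_A,\mathcal K_B$, isometries $V_A:\mathcal H_A\to\mathbb C^2\otimes\mathcal K_A$ and $V_B:\mathcal H_B\to\mathbb C^2\otimes\mathcal K_B$, and a density operator $\sigma$ on $\mathcal K_A\otimes\mathcal K_B$ such that, with $V=V_A\otimes V_B$ and up to reordering tensor factors, for all $a,b,x,y$, $$V(M_{a|x}\otimes N_{b|y})\,\rho\, V^\dagger=(\bar M_{a|x}\otimes\bar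 N_{b|y})|\psi_\theta\rangle\langle\psi_\theta|\otimes\sigma .$$ -/

import Mathlib

open scoped TensorProduct InnerProductSpace

universe u v u' v'

noncomputable section

namespace BellTilted

/-! ### Behaviors and the Bell functional -/

/-- A (conditional) behavior of the minimal Bell scenario: `P a b x y` stands for `p(a,b|x,y)`. -/
abbrev Behavior : Type := Fin 2 → Fin 2 → Fin 2 → Fin 2 → ℝ

/-- The marginal correlator `⟨B_{x,y}⟩ = ∑_{a,b} (-1)^b p(a,b|x,y)`. -/
def margB (P : Behavior) (x y : Fin 2) : ℝ :=
  ∑ a : Fin 2, ∑ b : Fin 2, (-1 : ℝ) ^ (b : ℕ) * P a b x y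

/-- The correlator `⟨A_x B_y⟩ = ∑_{a,b} (-1)^{a+b} p(a,b|x,y)`. -/
def corr (P : Behavior) (x y : Fin 2) : ℝ :=
  ∑ a : Fin 2, ∑ b : Fin 2, (-1 : ℝ) ^ ((a : ℕ) + (b : ℕ)) * P a b x y

/-- The tilted-CHSH functional `T_p`. -/
def tiltedCHSH (p : ℝ) (P : Behavior) : ℝ :=
  (margB P 0 1 - margB P 0 0) + (1 - p) / p * (margB P 1 0 - margB P 1 1)
    + (corr P 0 0 + corr P 0 1) + (1 - p) / p * (corr P 1 0 - corr P 1 1)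

/-! ### Local behaviors, without and with signaling -/

/-- `w` is a probability distribution on the discrete type `Λ`. -/
def IsDistribution {Λ : Type} (w : Λ → ℝ) : Prop := (∀ l, 0 ≤ w l) ∧ HasSum w 1

/-- Non-signaling local behaviors: `p(a,b|x,y) = ∑_λ p(λ) p(a|x,λ) p(b|y,λ)`. -/
def localNS : Set Behavior :=
  {P | ∃ (Λ : Type) (w : Λ → ℝ) (RA RB : Fin 2 → Λ → Fin 2 → ℝ),
    IsDistribution w ∧ (∀ x l, IsDistribution (RA x l)) ∧ (∀ y l, IsDistribution (RB y l)) ∧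
    ∀ a b x y, HasSum (fun l => w l * RA x l a * RB y l b) (P a b x y)}

/-- The binary channel transmitting `0` with fidelity `f₀` and `1` with fidelity `f₁`:
`binaryChannel f₀ f₁ out inp` is the probability of receiving `out` when `inp` is sent. -/
def binaryChannel (f₀ f₁ : ℝ) (out inp : Fin 2) : ℝ :=
  if out = inp then (if inp = 0 then f₀ else f₁) else 1 - (if inp = 0 then f₀ else f₁)

/-- The signaling local polytope `𝕊_{(p,q),(r,s)}`: besides the shared variable `λ` and their own
inputs, Bob gets a copy `x'` of Alice's input through the channel with fidelities `(p,q)` and Alice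
gets a copy `y'` of Bob's input through the channel with fidelities `(r,s)`. -/
def localSignaling (p q r s : ℝ) : Set Behavior :=
  {P | ∃ (Λ : Type) (w : Λ → ℝ) (RA RB : Fin 2 → Fin 2 → Λ → Fin 2 → ℝ),
    IsDistribution w ∧ (∀ x y' l, IsDistribution (RA x y' l)) ∧
    (∀ x' y l, IsDistribution (RB x' y l)) ∧
    ∀ a b x y, HasSum (fun l => w l * ∑ y' : Fin 2, ∑ x' : Fin 2,
      binaryChannel r s y' y * binaryChannel p q x' x * RA x y' l a * RB x' y l b) (P a b x y)}

/-! ### Hilbert space tensor products, traces and density operators -/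

section Hilbert

variable {H : Type u} [NormedAddCommGroup H] [InnerProductSpace ℂ H]
variable {K : Type v} [NormedAddCommGroup K] [InnerProductSpace ℂ K]
variable {H' : Type u'} [NormedAddCommGroup H'] [InnerProductSpace ℂ H']
variable {K' : Type v'} [NormedAddCommGroup K'] [InnerProductSpace ℂ K']

/-- The Hilbert space tensor product: completion of the algebraic tensor product for the inner
product `⟪a ⊗ b, c ⊗ d⟫ = ⟪a, c⟫ ⟪b, d⟫`. -/
abbrev HTensor (H : Type u) [NormedAddCommGroup H] [InnerProductSpace ℂ H]
    (K : Type v) [NormedAddCommGroup K] [InnerProductSpace ℂ K] : Type (max u v) :=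
  UniformSpace.Completion (H ⊗[ℂ] K)

/-- The elementary tensor `x ⊗ y`. -/
def htmul (x : H) (y : K) : HTensor H K := ((x ⊗ₜ[ℂ] y : H ⊗[ℂ] K) : HTensor H K)

/-- The tensor product `f ⊗ g` of two bounded operators. -/
def opTensor (f : H →L[ℂ] H') (g : K →L[ℂ] K') : HTensor H K →L[ℂ] HTensor H' K' :=
  ((UniformSpace.Completion.toComplL : (H' ⊗[ℂ] K') →L[ℂ] HTensor H' K') ∘L
      TensorProduct.mapL f g).extend
    (UniformSpace.Completion.toComplL : (H ⊗[ℂ] K) →L[ℂ] HTensor H K)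

/-- `f ⊗ g` acts on elementary tensors as it should (which determines it, by density). -/
theorem opTensor_htmul (f : H →L[ℂ] H') (g : K →L[ℂ] K') (x : H) (y : K) :
    opTensor f g (htmul x y) = htmul (f x) (g y) := by
  have h := ContinuousLinearMap.extend_eq
    ((UniformSpace.Completion.toComplL : (H' ⊗[ℂ] K') →L[ℂ] HTensor H' K') ∘L
      TensorProduct.mapL f g)
    (e := (UniformSpace.Completion.toComplL : (H ⊗[ℂ] K) →L[ℂ] HTensor H K))
    UniformSpace.Completion.denseRange_coe
    (UniformSpace.Completion.isUniformInducing_coe _) (x ⊗ₜ[ℂ] y)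
  simpa [opTensor, htmul] using h

/-- The operator `ξ ↦ w ⊗ ξ`. -/
def tmulLeft (w : H) : K →L[ℂ] HTensor H K :=
  (UniformSpace.Completion.toComplL : (H ⊗[ℂ] K) →L[ℂ] HTensor H K) ∘L
    TensorProduct.mkL ℂ H K w

/-- A Hilbert basis of `H`, with respect to which traces are computed. -/
def traceBasis (H : Type u) [NormedAddCommGroup H] [InnerProductSpace ℂ H] [CompleteSpace H] :
    HilbertBasis (exists_hilbertBasis ℂ H).choose ℂ H :=
  (exists_hilbertBasis ℂ H).choose_spec.choose

/-- The trace `∑_i ⟪e_i, T e_i⟫`. It is only used for `T` trace class (a bounded operator times a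
density operator), where the series converges and does not depend on the basis. -/
def trace [CompleteSpace H] (T : H →L[ℂ] H) : ℂ :=
  ∑' i, ⟪traceBasis H i, T (traceBasis H i)⟫_ℂ

/-- Density operators: positive operators of trace one. -/
def IsDensity [CompleteSpace H] (ρ : H →L[ℂ] H) : Prop :=
  ρ.IsPositive ∧ HasSum (fun i => ⟪traceBasis H i, ρ (traceBasis H i)⟫_ℂ) 1

end Hilbert

/-! ### Quantum strategies -/

/-- The data of a strategy in the minimal Bell scenario on `HA ⊗ HB`: `M x a` is the effect of
Alice's outcome `a` on input `x`, `N y b` that of Bob's outcome `b` on input `y`, and `ρ` is the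
shared state. The conditions on them are in `Strategy.IsQuantum`. -/
structure Strategy (HA : Type u) [NormedAddCommGroup HA] [InnerProductSpace ℂ HA]
    (HB : Type v) [NormedAddCommGroup HB] [InnerProductSpace ℂ HB] where
  M : Fin 2 → Fin 2 → HA →L[ℂ] HA
  N : Fin 2 → Fin 2 → HB →L[ℂ] HB
  ρ : HTensor HA HB →L[ℂ] HTensor HA HB

section Strategy

variable {HA : Type u} [NormedAddCommGroup HA] [InnerProductSpace ℂ HA]
variable {HB : Type v} [NormedAddCommGroup HB] [InnerProductSpace ℂ HB]

/-- The measurements are POVMs and the state is a density operator. -/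
def Strategy.IsQuantum (S : Strategy HA HB) : Prop :=
  (∀ x, (∀ a, (S.M x a).IsPositive) ∧ ∑ a, S.M x a = 1) ∧
  (∀ y, (∀ b, (S.N y b).IsPositive) ∧ ∑ b, S.N y b = 1) ∧
  IsDensity S.ρ

/-- All effects are projections. -/
def Strategy.IsProjective (S : Strategy HA HB) : Prop :=
  (∀ x a, IsIdempotentElem (S.M x a)) ∧ (∀ y b, IsIdempotentElem (S.N y b))

/-- The behavior `p(a,b|x,y) = Tr[(M_{a|x} ⊗ N_{b|y}) ρ]` of a strategy. -/
def Strategy.behavior (S : Strategy HA HB) : Behavior :=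
  fun a b x y => (trace (opTensor (S.M x a) (S.N y b) ∘L S.ρ)).re

/-- Alice's observables `A_x = ∑_a (-1)^a M_{a|x}`. -/
def Strategy.obsA (S : Strategy HA HB) (x : Fin 2) : HA →L[ℂ] HA := S.M x 0 - S.M x 1

/-- Bob's observables `B_y = ∑_b (-1)^b N_{b|y}`. -/
def Strategy.obsB (S : Strategy HA HB) (y : Fin 2) : HB →L[ℂ] HB := S.N y 0 - S.N y 1

end Strategy

/-! ### The reference two-qubit strategy -/

/-- The qubit space `ℂ²`. -/
abbrev Qubit : Type := EuclideanSpace ℂ (Fin 2)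

/-- The computational basis vector `|i⟩`. -/
def ket (i : Fin 2) : Qubit := EuclideanSpace.single i 1

/-- The Pauli operator `σ_X`. -/
def pauliX : Qubit →L[ℂ] Qubit := Matrix.toEuclideanCLM (𝕜 := ℂ) !![0, 1; 1, 0]

/-- The Pauli operator `σ_Z`. -/
def pauliZ : Qubit →L[ℂ] Qubit := Matrix.toEuclideanCLM (𝕜 := ℂ) !![1, 0; 0, -1]

/-- The effects `(1 + (-1)^a A) / 2` of a `±1`-valued observable `A`. -/
def effect (A : Qubit →L[ℂ] Qubit) (a : Fin 2) : Qubit →L[ℂ] Qubit :=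
  (1 / 2 : ℂ) • (1 + ((-1 : ℂ) ^ (a : ℕ)) • A)

def f₁ (p : ℝ) : ℝ := √(p * (-2 + 5 * p)) / (1 - 3 * p)
def g₁ (p : ℝ) : ℝ := (1 - 2 * p) / (-1 + 3 * p)
def f₂ (p : ℝ) : ℝ := -√((-2 + 5 * p) / (-2 + 6 * p))
def g₂ (p : ℝ) : ℝ := √(p / (-2 + 6 * p))

/-- The state angle; the branch is the one with `cos (2θ) = g₁ p` and `sin (2θ) = f₁ p`. -/
def theta (p : ℝ) : ℝ :=
  if p = 1 / 2 then -Real.pi / 4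
  else if p < 1 / 2 then Real.arctan (f₁ p / g₁ p) / 2
  else Real.arctan (f₁ p / g₁ p) / 2 - Real.pi / 2

/-- The measurement angle. -/
def phi (p : ℝ) : ℝ :=
  if p = 1 / 2 then -Real.pi / 4 else Real.arctan (f₂ p / g₂ p)

/-- `|ψ_θ⟩ = cos θ |00⟩ + sin θ |11⟩`. -/
def psi (θ : ℝ) : HTensor Qubit Qubit :=
  (Real.cos θ : ℂ) • htmul (ket 0) (ket 0) + (Real.sin θ : ℂ) • htmul (ket 1) (ket 1)

/-- Alice's reference observables `A_0 = σ_X`, `A_1 = σ_Z`. -/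
def refA (x : Fin 2) : Qubit →L[ℂ] Qubit := if x = 0 then pauliX else pauliZ

/-- Bob's reference observables `B_y = (-1)^y cos φ σ_Z + sin φ σ_X`. -/
def refB (φ : ℝ) (y : Fin 2) : Qubit →L[ℂ] Qubit :=
  if y = 0 then (Real.cos φ : ℂ) • pauliZ + (Real.sin φ : ℂ) • pauliX
  else -((Real.cos φ : ℂ) • pauliZ) + (Real.sin φ : ℂ) • pauliX

/-- The reference strategy, with state `|ψ_θ⟩⟨ψ_θ|`. -/
def refStrategy (p : ℝ) : Strategy Qubit Qubit where
  M x a := effect (refA x) a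
  N y b := effect (refB (phi p) y) b
  ρ := InnerProductSpace.rankOne ℂ (psi (theta p)) (psi (theta p))

/-! ### Self-testing -/

/-- For a two-qubit vector `w`, the operator `ξ ↦ w ⊗ ξ` from `KA ⊗ KB` to
`(ℂ² ⊗ ℂ²) ⊗ (KA ⊗ KB)`, the latter reordered as `(ℂ² ⊗ KA) ⊗ (ℂ² ⊗ KB)`. -/
def attach {KA : Type u} [NormedAddCommGroup KA] [InnerProductSpace ℂ KA]
    {KB : Type v} [NormedAddCommGroup KB] [InnerProductSpace ℂ KB] (w : HTensor Qubit Qubit) :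
    HTensor KA KB →L[ℂ] HTensor (HTensor Qubit KA) (HTensor Qubit KB) :=
  ∑ i : Fin 2, ∑ j : Fin 2,
    ⟪htmul (ket i) (ket j), w⟫_ℂ • opTensor (tmulLeft (ket i)) (tmulLeft (ket j))

/-- `S` is, up to local isometries, the two-qubit strategy with pure state `|w⟩⟨w|` and effects
`M₀`, `N₀`: there are local isometries `VA`, `VB` and an auxiliary state `σ` such that, with
`V = VA ⊗ VB`, for all `a`, `b`, `x`, `y`,
`V (M_{a|x} ⊗ N_{b|y}) ρ V† = (M₀_{a|x} ⊗ N₀_{b|y}) |w⟩⟨w| ⊗ σ`.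
(Summing over `a`, `b` gives `V ρ V† = |w⟩⟨w| ⊗ σ`.) -/
def EquivUpToLocalIsometries {HA : Type u} [NormedAddCommGroup HA] [InnerProductSpace ℂ HA]
    {HB : Type v} [NormedAddCommGroup HB] [InnerProductSpace ℂ HB]
    (S : Strategy HA HB) (M₀ N₀ : Fin 2 → Fin 2 → Qubit →L[ℂ] Qubit)
    (w : HTensor Qubit Qubit) : Prop :=
  ∃ (KA : Type u) (_ : NormedAddCommGroup KA) (_ : InnerProductSpace ℂ KA) (_ : CompleteSpace KA)
    (KB : Type v) (_ : NormedAddCommGroup KB) (_ : InnerProductSpace ℂ KB) (_ : CompleteSpace KB)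
    (VA : HA →ₗᵢ[ℂ] HTensor Qubit KA) (VB : HB →ₗᵢ[ℂ] HTensor Qubit KB)
    (σ : HTensor KA KB →L[ℂ] HTensor KA KB),
    IsDensity σ ∧ ∀ a b x y,
      opTensor VA.toContinuousLinearMap VB.toContinuousLinearMap ∘L
          opTensor (S.M x a) (S.N y b) ∘L S.ρ ∘L
          (opTensor VA.toContinuousLinearMap VB.toContinuousLinearMap).adjoint =
        attach (opTensor (M₀ x a) (N₀ y b) w) ∘L σ ∘L (attach w).adjoint

/-! ### The Bell operator and its sum-of-squares decomposition -/

section SOS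

variable {HA : Type u} [NormedAddCommGroup HA] [InnerProductSpace ℂ HA]
variable {HB : Type v} [NormedAddCommGroup HB] [InnerProductSpace ℂ HB]

/-- The Bell operator of `T_p` for the observables of `S`. -/
def bellOperator (p : ℝ) (S : Strategy HA HB) : HTensor HA HB →L[ℂ] HTensor HA HB :=
  (((1 - 2 * p) / p : ℝ) : ℂ) • opTensor 1 (S.obsB 0 - S.obsB 1)
    + opTensor (S.obsA 0) (S.obsB 0 + S.obsB 1)
    + (((1 - p) / p : ℝ) : ℂ) • opTensor (S.obsA 1) (S.obsB 0 - S.obsB 1)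

/-- `N₀ = A_1 ⊗ 1 - 1 ⊗ (B_0 - B_1) / (2 cos φ)`. -/
def sosN₀ (p : ℝ) (S : Strategy HA HB) : HTensor HA HB →L[ℂ] HTensor HA HB :=
  opTensor (S.obsA 1) 1
    - ((1 / (2 * Real.cos (phi p)) : ℝ) : ℂ) • opTensor 1 (S.obsB 0 - S.obsB 1)

/-- `N₁ = A_0 ⊗ 1 - sin 2θ (1 ⊗ (B_0 + B_1) / (2 sin φ)) - cos 2θ (A_0 ⊗ (B_0 - B_1) / (2 cos φ))`.
-/
def sosN₁ (p : ℝ) (S : Strategy HA HB) : HTensor HA HB →L[ℂ] HTensor HA HB :=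
  opTensor (S.obsA 0) 1
    - ((Real.sin (2 * theta p) / (2 * Real.sin (phi p)) : ℝ) : ℂ) •
        opTensor 1 (S.obsB 0 + S.obsB 1)
    - ((Real.cos (2 * theta p) / (2 * Real.cos (phi p)) : ℝ) : ℂ) •
        opTensor (S.obsA 0) (S.obsB 0 - S.obsB 1)

/-- The weight `λ²` of the second square. -/
def sosWeight (p : ℝ) : ℝ := (3 * p - 1) / (1 - p)

/-- The overall factor `sin φ / (λ² sin 2θ)`. -/
def sosFactor (p : ℝ) : ℝ := Real.sin (phi p) / (sosWeight p * Real.sin (2 * theta p))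

end SOS

/-! ### The three bounds -/

/-- The non-signaling local bound. -/
def localBound (p : ℝ) : ℝ := 2 * (|2 * p - 1| + 1 - p) / p

/-- The one-way signaling local bound. -/
def signalingBound (p : ℝ) : ℝ :=
  2 * max p |-p + 2 * ((1 - p) ^ 2 / p)| + 2 * (1 - p)

/-- The non-signaling quantum bound. -/
def quantumBound (p : ℝ) : ℝ := 2 * √2 * √(p / (3 * p - 1))

end BellTilted

end

noncomputable section

namespace BellTilted

/-! ### The angles and the coefficients of the sum of squares -/

/-! Local bounds. Alice's copy of Bob's input is pure noise, so for each hidden variable her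
response averages to a number depending on her own input only. The weight (1-p)/p is tuned so that,
in the marginal terms, Bob's answers to the received copy 1 cancel. What remains is estimated with
|s+t| + |s-t| ≤ 2 (`deterministic_value_le`). The resulting bound is already attained by a
deterministic non-signaling behavior, so both maxima coincide.

Quantum bound. For commuting families A, B, the operator η - B_p is a combination of two squares and
of defect terms containing 1 - A_x² or 1 - B_y² (`sos_identity`, `quantumBound_sub_bellOperator`).
The defects are positive for POVMs, which gives the bound in general. They vanish for projective
measurements, which leaves exactly the stated certificate.

Self-testing. At the value η the operators N₀ and N₁ annihilate R = √ρ. Put Z = (B₀-B₁)/(2 cos φ)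
and X = (B₀+B₁)/(2 sin φ), which anticommute because B₀² = B₁² = 1. The relations A₁R = ZR and A₀R =
sin 2θ XR + cos 2θ A₀ZR force A₀ and A₁ to anticommute on the support of ρ
(`anticommute_on_support`). Z and X need not be involutions, but they agree with self-adjoint
involutions on ker(Z² - 1), which is all that ρ sees (`exists_regularization`). The swap maps built
from these involutions are isometries, and they satisfy VR = |ψ_θ⟩ ⊗ G
(`opTensor_swapMap_comp_eq_attach`). Since VTρV† = (VTR)(VR)†, the statement follows with σ = GG†;
arguing with R instead of a state vector covers mixed states directly. -/

theorem cos_sin_arctan_div {f g : ℝ} (hg : 0 < g) (h : f ^ 2 + g ^ 2 = 1) :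
    Real.cos (Real.arctan (f / g)) = g ∧ Real.sin (Real.arctan (f / g)) = f := by
  have h1 : 1 + (f / g) ^ 2 = (1 / g) ^ 2 := by
    field_simp
    linarith
  rw [Real.cos_arctan, Real.sin_arctan, h1, Real.sqrt_sq (by positivity)]
  constructor <;> field_simp

section Parameters

variable {p : ℝ} (hp : p ∈ Set.Ioo (2 / 5 : ℝ) 1)
include hp

theorem cos_phi_sin_phi : Real.cos (phi p) = g₂ p ∧ Real.sin (phi p) = f₂ p := by
  obtain ⟨h1, h2⟩ := hp
  have h3 : 0 < -2 + 6 * p := by linarith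
  have h4 : 0 < p / (-2 + 6 * p) := div_pos (by linarith) h3
  have h5 : 0 < (-2 + 5 * p) / (-2 + 6 * p) := div_pos (by linarith) h3
  have hg : 0 < g₂ p := Real.sqrt_pos.2 h4
  have hfg : f₂ p ^ 2 + g₂ p ^ 2 = 1 := by
    rw [f₂, g₂, neg_sq, Real.sq_sqrt h5.le, Real.sq_sqrt h4.le, ← add_div, div_eq_one_iff_eq h3.ne']
    ring
  by_cases hh : p = 1 / 2
  · have e : √(1 / 2 : ℝ) = √2 / 2 := by
      rw [Real.sqrt_eq_iff_mul_self_eq (by norm_num) (by positivity)]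
      ring_nf
      norm_num
    rw [phi, if_pos hh, hh, g₂, f₂, neg_div, Real.cos_neg, Real.sin_neg, Real.cos_pi_div_four,
      Real.sin_pi_div_four, ← e]
    norm_num
  · rw [phi, if_neg hh]
    exact cos_sin_arctan_div hg hfg

/-- The arctangent recovers the angle only in the half plane where the cosine `g₁ p` is positive,
that is for p < 1/2. For p > 1/2 the shift by π/2 in `theta` becomes a shift by π after doubling and
flips both signs. At p = 1/2 the quotient degenerates, since `g₁` vanishes. -/
theorem cos_two_theta_sin_two_theta :
    Real.cos (2 * theta p) = g₁ p ∧ Real.sin (2 * theta p) = f₁ p := by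
  obtain ⟨h1, h2⟩ := hp
  have h3 : 0 < -1 + 3 * p := by linarith
  have h4 : 0 ≤ p * (-2 + 5 * p) := mul_nonneg (by linarith) (by linarith)
  have hfg : f₁ p ^ 2 + g₁ p ^ 2 = 1 := by
    have h5 : 1 - 3 * p ≠ 0 := by linarith
    rw [f₁, g₁, div_pow, div_pow, Real.sq_sqrt h4, div_add_div _ _ (by positivity) (by positivity),
      div_eq_one_iff_eq (by positivity)]
    ring
  rcases lt_trichotomy p (1 / 2) with hh | hh | hh
  · rw [theta, if_neg hh.ne, if_pos hh, mul_div_cancel₀ _ two_ne_zero]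
    exact cos_sin_arctan_div (div_pos (by linarith) h3) hfg
  · have e : 2 * (-Real.pi / 4) = -(Real.pi / 2) := by ring
    have e' : √(1 / 4 : ℝ) = 1 / 2 := by
      rw [Real.sqrt_eq_iff_mul_self_eq (by norm_num) (by positivity)]
      norm_num
    rw [theta, if_pos hh, e, Real.cos_neg, Real.sin_neg, Real.cos_pi_div_two, Real.sin_pi_div_two,
      hh, f₁, g₁, show (1 / 2 * (-2 + 5 * (1 / 2)) : ℝ) = 1 / 4 by norm_num, e']
    norm_num
  · have hg : 0 < -g₁ p := by
      rw [g₁, ← neg_div]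
      exact div_pos (by linarith) h3
    have h6 := cos_sin_arctan_div (f := -f₁ p) hg (by rw [neg_sq, neg_sq, hfg])
    rw [neg_div_neg_eq] at h6
    rw [theta, if_neg hh.ne', if_neg hh.not_gt, mul_sub, mul_div_cancel₀ _ two_ne_zero,
      mul_div_cancel₀ _ two_ne_zero, Real.cos_sub_pi, Real.sin_sub_pi, h6.1, h6.2]
    simp

theorem cos_phi_pos : 0 < Real.cos (phi p) := by
  rw [(cos_phi_sin_phi hp).1]
  exact Real.sqrt_pos.2 (div_pos (by linarith [hp.1]) (by linarith [hp.1]))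

theorem sin_phi_neg : Real.sin (phi p) < 0 := by
  rw [(cos_phi_sin_phi hp).2]
  exact neg_neg_of_pos <| Real.sqrt_pos.2 (div_pos (by linarith [hp.1]) (by linarith [hp.1]))

theorem cos_phi_sq : Real.cos (phi p) ^ 2 = p / (2 * (3 * p - 1)) := by
  rw [(cos_phi_sin_phi hp).1, g₂,
    Real.sq_sqrt (div_pos (by linarith [hp.1]) (by linarith [hp.1])).le]
  ring_nf

theorem cos_two_theta : Real.cos (2 * theta p) = (1 - 2 * p) / (3 * p - 1) := by
  rw [(cos_two_theta_sin_two_theta hp).1, g₁]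
  ring_nf

/-- This relation between the two angles lets sin φ cancel: `sosFactor` and the coefficient of B₀ +
B₁ in N₁ become expressions in cos φ alone. -/
theorem sin_two_theta :
    Real.sin (2 * theta p) = 2 * Real.cos (phi p) * Real.sin (phi p) := by
  obtain ⟨h1, h2⟩ := hp
  have h3 : 0 < -2 + 6 * p := by linarith
  rw [(cos_two_theta_sin_two_theta ⟨h1, h2⟩).2, (cos_phi_sin_phi ⟨h1, h2⟩).1,
    (cos_phi_sin_phi ⟨h1, h2⟩).2, f₁, f₂, g₂, Real.sqrt_div (by linarith), Real.sqrt_div (by linarith),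
    Real.sqrt_mul (by linarith)]
  have e : √(-2 + 6 * p) * √(-2 + 6 * p) = -2 + 6 * p := Real.mul_self_sqrt h3.le
  rw [mul_assoc, mul_neg, div_mul_div_comm, e,
    show -2 + 6 * p = -(2 * (1 - 3 * p)) by ring, div_neg, neg_neg, mul_div_assoc',
    mul_div_mul_left _ _ two_ne_zero]

theorem sin_two_theta_neg : Real.sin (2 * theta p) < 0 := by
  rw [sin_two_theta hp]
  have := mul_pos (cos_phi_pos hp) (neg_pos.2 (sin_phi_neg hp))
  linarith

theorem quantumBound_eq : quantumBound p = 4 * Real.cos (phi p) := by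
  obtain ⟨h1, h2⟩ := hp
  have e : p / (3 * p - 1) = 2 * Real.cos (phi p) ^ 2 := by
    rw [cos_phi_sq ⟨h1, h2⟩]
    have : 3 * p - 1 ≠ 0 := by linarith
    field_simp
  have e2 : √2 * √2 = (2 : ℝ) := Real.mul_self_sqrt (by norm_num)
  rw [quantumBound, e, Real.sqrt_mul (by norm_num), Real.sqrt_sq (cos_phi_pos ⟨h1, h2⟩).le]
  linear_combination 2 * Real.cos (phi p) * e2

theorem sosWeight_pos : 0 < sosWeight p :=
  div_pos (by linarith [hp.1]) (by linarith [hp.2])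

theorem sosFactor_eq : sosFactor p = 1 / (2 * sosWeight p * Real.cos (phi p)) := by
  have h1 := (cos_phi_pos hp).ne'
  have h2 := (sin_phi_neg hp).ne
  have h3 := (sosWeight_pos hp).ne'
  rw [sosFactor, sin_two_theta hp]
  field_simp

theorem sosFactor_pos : 0 < sosFactor p := by
  rw [sosFactor_eq hp]
  have h1 := cos_phi_pos hp
  have h3 := sosWeight_pos hp
  positivity

theorem sin_two_theta_div : Real.sin (2 * theta p) / (2 * Real.sin (phi p)) = Real.cos (phi p) := by
  have h2 := (sin_phi_neg hp).ne
  rw [sin_two_theta hp]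
  field_simp

/-- This and the following `sos_coeff_` lemmas are the hypotheses of `sos_identity` for u = cos φ, v
= cos 2θ / (2 cos φ), w = 1 / (2 cos φ), l = λ² and f = `sosFactor p`. Each compares one coefficient
of η - B_p, apart from `sos_coeff_D_sq`, which balances the terms in (B₀-B₁)². -/
theorem sos_coeff_A₁D : 2 * sosFactor p * (1 / (2 * Real.cos (phi p))) = (1 - p) / p := by
  have h1 := cos_phi_pos hp
  have h3 := sosWeight_pos hp
  have e := cos_phi_sq hp
  have : 3 * p - 1 ≠ 0 := by linarith [hp.1]
  have : 1 - p ≠ 0 := by linarith [hp.2]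
  have : p ≠ 0 := by linarith [hp.1]
  rw [sosFactor_eq hp, show 2 * (1 / (2 * sosWeight p * Real.cos (phi p))) *
    (1 / (2 * Real.cos (phi p))) = 1 / (2 * sosWeight p * Real.cos (phi p) ^ 2) by field_simp,
    e, sosWeight]
  field_simp

theorem sos_coeff_A₀S : 2 * sosFactor p * sosWeight p * Real.cos (phi p) = 1 := by
  have h1 := cos_phi_pos hp
  have h3 := sosWeight_pos hp
  rw [sosFactor_eq hp]
  field_simp

theorem sos_coeff_D : 2 * sosFactor p * sosWeight p *
    (Real.cos (2 * theta p) / (2 * Real.cos (phi p))) = (1 - 2 * p) / p := by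
  have h1 := cos_phi_pos hp
  have h3 := sosWeight_pos hp
  have e := cos_phi_sq hp
  have h3p : 3 * p - 1 ≠ 0 := by linarith [hp.1]
  rw [sosFactor_eq hp, show 2 * (1 / (2 * sosWeight p * Real.cos (phi p))) * sosWeight p *
    (Real.cos (2 * theta p) / (2 * Real.cos (phi p))) =
      Real.cos (2 * theta p) / (2 * Real.cos (phi p) ^ 2) by field_simp,
    e, cos_two_theta hp, mul_div_assoc', mul_div_mul_left _ _ two_ne_zero,
    div_div_div_cancel_right₀ h3p]

theorem sos_coeff_D_sq : (1 / (2 * Real.cos (phi p))) ^ 2 +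
    sosWeight p * (Real.cos (2 * theta p) / (2 * Real.cos (phi p))) ^ 2 =
      sosWeight p * Real.cos (phi p) ^ 2 := by
  have e := cos_phi_sq hp
  have : 3 * p - 1 ≠ 0 := by linarith [hp.1]
  have : 1 - p ≠ 0 := by linarith [hp.2]
  have : p ≠ 0 := by linarith [hp.1]
  rw [div_pow, div_pow, mul_pow, e, cos_two_theta hp, sosWeight]
  field_simp
  ring

theorem sos_coeff_one :
    sosFactor p * (1 + sosWeight p + 4 * (sosWeight p * Real.cos (phi p) ^ 2)) =
      quantumBound p := by
  have h1 := cos_phi_pos hp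
  have h3 := sosWeight_pos hp
  have e : 1 + sosWeight p = 4 * sosWeight p * Real.cos (phi p) ^ 2 := by
    have : 3 * p - 1 ≠ 0 := by linarith [hp.1]
    have : 1 - p ≠ 0 := by linarith [hp.2]
    rw [cos_phi_sq hp, sosWeight]
    field_simp
    ring
  rw [e, quantumBound_eq hp, sosFactor_eq hp]
  field_simp
  ring

/-- After multiplication by 2 cos φ this is |1-2p| ≤ p, true for 1/3 ≤ p ≤ 1. It makes the factors
λ²(cos²φ ± cos φ · v · A₀) of the defects of Bob's observables positive, where v is the quotient
bounded here. -/
theorem abs_sos_coeff_le :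
    |Real.cos (2 * theta p) / (2 * Real.cos (phi p))| ≤ Real.cos (phi p) := by
  have h1 := cos_phi_pos hp
  have e := cos_phi_sq hp
  have h3 : 0 < 3 * p - 1 := by linarith [hp.1]
  rw [abs_div, abs_of_pos (show 0 < 2 * Real.cos (phi p) by positivity), div_le_iff₀ (by positivity),
    show Real.cos (phi p) * (2 * Real.cos (phi p)) = 2 * Real.cos (phi p) ^ 2 by ring, e,
    cos_two_theta hp, abs_div, abs_of_pos h3, show 2 * (p / (2 * (3 * p - 1))) = p / (3 * p - 1) by
      field_simp]
  gcongr
  rw [abs_le]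
  constructor <;> linarith [hp.1, hp.2]

theorem cos_theta_ne_zero : Real.cos (theta p) ≠ 0 := by
  intro h0
  have h := sin_two_theta_neg hp
  rw [Real.sin_two_mul, h0] at h
  simp at h

end Parameters

/-! ### The local bounds -/

theorem isDistribution_fin_two {r : Fin 2 → ℝ} :
    IsDistribution r ↔ 0 ≤ r 0 ∧ 0 ≤ r 1 ∧ r 0 + r 1 = 1 := by
  have : HasSum r 1 ↔ r 0 + r 1 = 1 := by
    have h := hasSum_fintype r
    rw [Fin.sum_univ_two] at h
    exact ⟨fun h' => h.unique h', fun h' => h' ▸ h⟩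
  simp [IsDistribution, this, Fin.forall_fin_two, and_assoc]

theorem binaryChannel_self (p : ℝ) (a b : Fin 2) :
    binaryChannel p p a b = if a = b then p else 1 - p := by
  simp only [binaryChannel, ite_self]

/-- Both parties may ignore the received copies; the channel probabilities then sum to 1. -/
theorem localNS_subset_localSignaling (p q r s : ℝ) : localNS ⊆ localSignaling p q r s := by
  rintro P ⟨Λ, w, RA, RB, hw, hA, hB, hP⟩
  refine ⟨Λ, w, fun x _ => RA x, fun _ y => RB y, hw, fun x _ => hA x, fun _ y => hB y,
    fun a b x y => ?_⟩
  convert hP a b x y using 2 with l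
  have hc : ∀ (f g : ℝ) (i : Fin 2), binaryChannel f g 0 i + binaryChannel f g 1 i = 1 := by
    intro f g i
    fin_cases i <;> simp [binaryChannel]
  simp only [Fin.sum_univ_two]
  linear_combination w l * RA x l a * RB y l b * (binaryChannel p q 0 x + binaryChannel p q 1 x) *
    hc r s y + w l * RA x l a * RB y l b * hc p q x

/-- A deterministic behavior. -/
theorem deterministic_mem_localNS (α β : Fin 2 → Fin 2) :
    (fun a b x y => (if a = α x then 1 else 0) * (if b = β y then 1 else 0) : Behavior)
      ∈ localNS := by
  refine ⟨Unit, fun _ => 1, fun x _ a => if a = α x then 1 else 0,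
    fun y _ b => if b = β y then 1 else 0, ⟨fun _ => zero_le_one, ?_⟩, fun x _ => ?_,
    fun y _ => ?_, fun a b x y => ?_⟩
  · simp
  · refine ⟨fun a => by positivity, ?_⟩
    convert hasSum_fintype (fun a => if a = α x then (1 : ℝ) else 0)
    simp
  · refine ⟨fun a => by positivity, ?_⟩
    convert hasSum_fintype (fun a => if a = β y then (1 : ℝ) else 0)
    simp
  · simp

theorem localBound_eq_two {p : ℝ} (h : 1 / 2 ≤ p) : localBound p = 2 := by
  have hp0 : p ≠ 0 := by linarith
  rw [localBound, abs_of_nonneg (by linarith)]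
  field_simp
  ring

section

variable {p : ℝ} (hp : p ∈ Set.Ioo (2 / 5 : ℝ) 1)
include hp

theorem localBound_mem : localBound p ∈ tiltedCHSH p '' localNS := by
  have hp0 : p ≠ 0 := by linarith [hp.1]
  rcases le_total p (1 / 2) with h | h
  -- With Alice always answering 0, the value is (2-3p)/p (B₀-B₁) + (B₀+B₁). The first coefficient
  -- is at least 1 exactly when p ≤ 1/2, so there Bob should answer b = y; otherwise he answers 0
  -- constantly.
  · refine ⟨_, deterministic_mem_localNS 0 ![0, 1], ?_⟩
    rw [localBound, abs_of_nonpos (by linarith)]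
    simp [tiltedCHSH, margB, corr]
    field_simp
    ring
  · refine ⟨_, deterministic_mem_localNS 0 0, ?_⟩
    rw [localBound, abs_of_nonneg (by linarith)]
    simp [tiltedCHSH, margB, corr]
    field_simp
    ring

/-- The maximum in `signalingBound` switches branch at p = 1/2, where |2p-1| changes sign: (p² - 4p
+ 2)/p ≥ p amounts to p ≤ 1/2. -/
theorem localBound_eq_signalingBound : localBound p = signalingBound p := by
  obtain ⟨h1, h2⟩ := hp
  have hp0 : 0 < p := by linarith
  have e : -p + 2 * ((1 - p) ^ 2 / p) = (p ^ 2 - 4 * p + 2) / p := by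
    field_simp
    ring
  rw [localBound, signalingBound, e]
  rcases le_total p (1 / 2) with h | h
  · rw [max_eq_right, abs_of_nonpos (by linarith), abs_of_nonneg]
    · field_simp
      ring
    · apply div_nonneg _ hp0.le
      nlinarith
    · refine le_trans ?_ (le_abs_self _)
      rw [le_div_iff₀ hp0]
      nlinarith
  · rw [max_eq_left, abs_of_nonneg (by linarith)]
    · field_simp
      ring
    · rw [abs_le, le_div_iff₀ hp0, div_le_iff₀ hp0]
      constructor <;> nlinarith

/-- The left side is `tiltedCHSH` at a fixed hidden variable: a₀, a₁ are Alice's mean answers and b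
with indices x', y is Bob's mean answer to copy x' and input y. Taking absolute values removes a₀
and a₁, and the pairs (b₀₀, b₀₁) and (b₁₀, b₁₁) can then be bounded separately. -/
theorem deterministic_value_le {a₀ a₁ b₀₀ b₀₁ b₁₀ b₁₁ : ℝ} (ha₀ : |a₀| ≤ 1) (ha₁ : |a₁| ≤ 1)
    (h₀₀ : |b₀₀| ≤ 1) (h₀₁ : |b₀₁| ≤ 1) (h₁₀ : |b₁₀| ≤ 1) (h₁₁ : |b₁₁| ≤ 1) :
    (2 * p - 1) / p * (b₀₁ - b₀₀) + a₀ * (p * (b₀₀ + b₀₁) + (1 - p) * (b₁₀ + b₁₁))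
      + (1 - p) / p * (a₁ * (p * (b₁₀ - b₁₁) + (1 - p) * (b₀₀ - b₀₁))) ≤ localBound p := by
  have hp0 : 0 < p := by linarith [hp.1]
  have hp1 : 0 < 1 - p := by linarith [hp.2]
  have hsd : ∀ {s t : ℝ}, |s| ≤ 1 → |t| ≤ 1 → |s + t| + |s - t| ≤ 2 := by
    intro s t hs ht
    rw [abs_le] at hs ht
    rcases abs_cases (s + t) with h | h <;> rcases abs_cases (s - t) with h' | h' <;> linarith
  have hmul : ∀ {a z : ℝ}, |a| ≤ 1 → a * z ≤ |z| := by
    intro a z ha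
    calc a * z ≤ |a * z| := le_abs_self _
      _ = |a| * |z| := abs_mul _ _
      _ ≤ 1 * |z| := by gcongr
      _ = |z| := one_mul _
  have i1 : (2 * p - 1) / p * (b₀₁ - b₀₀) ≤ |2 * p - 1| / p * |b₀₀ - b₀₁| := by
    calc _ ≤ |(2 * p - 1) / p * (b₀₁ - b₀₀)| := le_abs_self _
      _ = _ := by rw [abs_mul, abs_div, abs_of_pos hp0, abs_sub_comm b₀₁]
  have i2 : a₀ * (p * (b₀₀ + b₀₁) + (1 - p) * (b₁₀ + b₁₁)) ≤
      p * |b₀₀ + b₀₁| + (1 - p) * |b₁₀ + b₁₁| := by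
    refine (hmul ha₀).trans ((abs_add_le _ _).trans_eq ?_)
    rw [abs_mul, abs_mul, abs_of_pos hp0, abs_of_pos hp1]
  have i3 : (1 - p) / p * (a₁ * (p * (b₁₀ - b₁₁) + (1 - p) * (b₀₀ - b₀₁))) ≤
      (1 - p) / p * (p * |b₁₀ - b₁₁| + (1 - p) * |b₀₀ - b₀₁|) := by
    gcongr
    refine (hmul ha₁).trans ((abs_add_le _ _).trans_eq ?_)
    rw [abs_mul, abs_mul, abs_of_pos hp0, abs_of_pos hp1]
  have e3 : (1 - p) / p * (p * |b₁₀ - b₁₁| + (1 - p) * |b₀₀ - b₀₁|) =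
      (1 - p) * |b₁₀ - b₁₁| + (1 - p) ^ 2 / p * |b₀₀ - b₀₁| := by
    field_simp
  have i4 := mul_le_mul_of_nonneg_left (hsd h₁₀ h₁₁) hp1.le
  -- K collects both coefficients of |b₀₀ - b₀₁|. Since 2p - 1 + (1-p)² = p², it is at least p, so
  -- p|b₀₀ + b₀₁| can be enlarged to K|b₀₀ + b₀₁| and the pair contributes at most 2K.
  set K := (|2 * p - 1| + (1 - p) ^ 2) / p with hK
  have eK : |2 * p - 1| / p * |b₀₀ - b₀₁| + (1 - p) ^ 2 / p * |b₀₀ - b₀₁| =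
    K * |b₀₀ - b₀₁| := by rw [hK]; ring
  have hpK : p ≤ K := by
    rw [hK, le_div_iff₀ hp0]
    have := le_abs_self (2 * p - 1)
    nlinarith
  have i5 := mul_le_mul_of_nonneg_left (hsd h₀₀ h₀₁) (hp0.le.trans hpK)
  have i6 := mul_le_mul_of_nonneg_right hpK (abs_nonneg (b₀₀ + b₀₁))
  have eL : localBound p = 2 * (1 - p) + 2 * K := by
    rw [localBound, hK]
    field_simp
    ring
  rw [eL]
  linarith

/-- The functional is linear, so its value is the average over the hidden variable and it suffices
to bound it for each one. -/
theorem tiltedCHSH_le_of_mem_localSignaling {P : Behavior}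
    (hP : P ∈ localSignaling p p (1 / 2) (1 / 2)) : tiltedCHSH p P ≤ localBound p := by
  obtain ⟨Λ, w, RA, RB, hw, hA, hB, hP⟩ := hP
  have hp0 : p ≠ 0 := by linarith [hp.1]
  set Q : Λ → Behavior := fun l a b x y => ∑ y' : Fin 2, ∑ x' : Fin 2,
      binaryChannel (1 / 2) (1 / 2) y' y * binaryChannel p p x' x * RA x y' l a * RB x' y l b
    with hQ
  replace hP : ∀ a b x y, HasSum (fun l => w l * Q l a b x y) (P a b x y) := hP
  have hmarg : ∀ x y, HasSum (fun l => w l * margB (Q l) x y) (margB P x y) := by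
    intro x y
    simp only [margB, Finset.mul_sum, mul_left_comm (w _)]
    exact hasSum_sum fun a _ => hasSum_sum fun b _ => (hP a b x y).mul_left _
  have hcorr : ∀ x y, HasSum (fun l => w l * corr (Q l) x y) (corr P x y) := by
    intro x y
    simp only [corr, Finset.mul_sum, mul_left_comm (w _)]
    exact hasSum_sum fun a _ => hasSum_sum fun b _ => (hP a b x y).mul_left _
  have hT : HasSum (fun l => w l * tiltedCHSH p (Q l)) (tiltedCHSH p P) := by
    have := ((((hmarg 0 1).sub (hmarg 0 0)).add
      (((hmarg 1 0).sub (hmarg 1 1)).mul_left ((1 - p) / p))).add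
      ((hcorr 0 0).add (hcorr 0 1))).add (((hcorr 1 0).sub (hcorr 1 1)).mul_left ((1 - p) / p))
    refine (congrArg (HasSum · _) (funext fun l => ?_)).mpr this
    simp only [tiltedCHSH]
    ring
  have hle : ∀ l, tiltedCHSH p (Q l) ≤ localBound p := by
    intro l
    -- The fidelity-1/2 channel delivers a uniform bit whatever Bob's input is, hence the plain
    -- average over it.
    set α : Fin 2 → ℝ := fun x => (RA x 0 l 0 - RA x 0 l 1 + (RA x 1 l 0 - RA x 1 l 1)) / 2 with hα
    set β : Fin 2 → Fin 2 → ℝ := fun x' y => RB x' y l 0 - RB x' y l 1 with hβ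
    have hα1 : ∀ x, |α x| ≤ 1 := by
      intro x
      have h0 := isDistribution_fin_two.1 (hA x 0 l)
      have h1 := isDistribution_fin_two.1 (hA x 1 l)
      rw [abs_le, hα]
      constructor <;> dsimp only <;> linarith
    have hβ1 : ∀ x' y, |β x' y| ≤ 1 := by
      intro x' y
      have h0 := isDistribution_fin_two.1 (hB x' y l)
      rw [abs_le, hβ]
      constructor <;> dsimp only <;> linarith
    have sA : ∀ x y, RA x y l 0 = 1 - RA x y l 1 := fun x y => by
      linarith [(isDistribution_fin_two.1 (hA x y l)).2.2]
    -- In the marginal part β 1 0 and β 1 1 cancel, and the coefficient of β 0 1 - β 0 0 is p -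
    -- (1-p)²/p = (2p-1)/p.
    have key : tiltedCHSH p (Q l) = (2 * p - 1) / p * (β 0 1 - β 0 0)
        + α 0 * (p * (β 0 0 + β 0 1) + (1 - p) * (β 1 0 + β 1 1))
        + (1 - p) / p * (α 1 * (p * (β 1 0 - β 1 1) + (1 - p) * (β 0 0 - β 0 1))) := by
      simp only [tiltedCHSH, margB, corr, hQ, hα, hβ, Fin.sum_univ_two, binaryChannel_self, sA]
      simp
      field_simp
      ring
    rw [key]
    exact deterministic_value_le hp (hα1 0) (hα1 1) (hβ1 _ _) (hβ1 _ _) (hβ1 _ _) (hβ1 _ _)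
  have h1 : HasSum (fun l => w l * localBound p) (1 * localBound p) := hw.2.mul_right _
  rw [one_mul] at h1
  exact hasSum_le (fun l => mul_le_mul_of_nonneg_left (hle l) (hw.1 l)) hT h1

theorem isGreatest_localNS : IsGreatest (tiltedCHSH p '' localNS) (localBound p) := by
  refine ⟨localBound_mem hp, ?_⟩
  rintro _ ⟨P, hP, rfl⟩
  exact tiltedCHSH_le_of_mem_localSignaling hp (localNS_subset_localSignaling _ _ _ _ hP)

theorem isGreatest_localSignaling :
    IsGreatest (tiltedCHSH p '' localSignaling p p (1 / 2) (1 / 2)) (signalingBound p) := by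
  rw [← localBound_eq_signalingBound hp]
  refine ⟨Set.image_mono (localNS_subset_localSignaling _ _ _ _) (localBound_mem hp), ?_⟩
  rintro _ ⟨P, hP, rfl⟩
  exact tiltedCHSH_le_of_mem_localSignaling hp hP

end

/-! ### Hilbert space tensor products -/

section Tensor

variable {H : Type*} [NormedAddCommGroup H] [InnerProductSpace ℂ H]
variable {K : Type*} [NormedAddCommGroup K] [InnerProductSpace ℂ K]
variable {H' : Type*} [NormedAddCommGroup H'] [InnerProductSpace ℂ H']
variable {K' : Type*} [NormedAddCommGroup K'] [InnerProductSpace ℂ K']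
variable {H'' : Type*} [NormedAddCommGroup H''] [InnerProductSpace ℂ H'']
variable {K'' : Type*} [NormedAddCommGroup K''] [InnerProductSpace ℂ K'']
variable {E : Type*} [NormedAddCommGroup E] [InnerProductSpace ℂ E]

theorem HTensor.ext {f g : HTensor H K →L[ℂ] E} (h : ∀ x y, f (htmul x y) = g (htmul x y)) :
    f = g := by
  have h1 : ∀ t : H ⊗[ℂ] K, f (t : HTensor H K) = g (t : HTensor H K) := by
    intro t
    induction t using TensorProduct.induction_on with
    | zero => rw [UniformSpace.Completion.coe_zero, map_zero, map_zero]
    | tmul x y => exact h x y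
    | add a b ha hb => rw [UniformSpace.Completion.coe_add, map_add, map_add, ha, hb]
  ext t
  exact congrFun (UniformSpace.Completion.denseRange_coe.equalizer f.continuous g.continuous
    (funext h1)) t

theorem htmul_add_left (x x' : H) (y : K) : htmul (x + x') y = htmul x y + htmul x' y := by
  simp [htmul, TensorProduct.add_tmul, UniformSpace.Completion.coe_add]

theorem htmul_add_right (x : H) (y y' : K) : htmul x (y + y') = htmul x y + htmul x y' := by
  simp [htmul, TensorProduct.tmul_add, UniformSpace.Completion.coe_add]

theorem htmul_smul_left (c : ℂ) (x : H) (y : K) : htmul (c • x) y = c • htmul x y := by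
  rw [htmul, ← TensorProduct.smul_tmul', UniformSpace.Completion.coe_smul, htmul]

theorem htmul_smul_right (c : ℂ) (x : H) (y : K) : htmul x (c • y) = c • htmul x y := by
  simp [htmul, UniformSpace.Completion.coe_smul]

theorem htmul_neg_left (x : H) (y : K) : htmul (-x) y = -htmul x y := by
  rw [← neg_one_smul ℂ x, htmul_smul_left, neg_one_smul]

theorem htmul_neg_right (x : H) (y : K) : htmul x (-y) = -htmul x y := by
  rw [← neg_one_smul ℂ y, htmul_smul_right, neg_one_smul]

theorem inner_htmul (x x' : H) (y y' : K) :
    ⟪htmul x y, htmul x' y'⟫_ℂ = ⟪x, x'⟫_ℂ * ⟪y, y'⟫_ℂ := by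
  simp [htmul, UniformSpace.Completion.inner_coe]

theorem HTensor.ext_inner {ζ ζ' : HTensor H K}
    (h : ∀ x y, ⟪ζ, htmul x y⟫_ℂ = ⟪ζ', htmul x y⟫_ℂ) : ζ = ζ' := by
  have h1 : innerSL ℂ ζ = innerSL ℂ ζ' := HTensor.ext fun x y => by simpa using h x y
  exact ext_inner_right ℂ fun w => by simpa using congrArg (fun f => f w) h1

theorem opTensor_comp (f : H' →L[ℂ] H'') (g : K' →L[ℂ] K'') (f' : H →L[ℂ] H') (g' : K →L[ℂ] K') :
    opTensor f g ∘L opTensor f' g' = opTensor (f ∘L f') (g ∘L g') :=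
  HTensor.ext fun x y => by simp [opTensor_htmul]

theorem opTensor_mul (f f' : H →L[ℂ] H) (g g' : K →L[ℂ] K) :
    opTensor f g * opTensor f' g' = opTensor (f * f') (g * g') :=
  opTensor_comp f g f' g'

theorem opTensor_one : opTensor (1 : H →L[ℂ] H) (1 : K →L[ℂ] K) = 1 :=
  HTensor.ext fun x y => by simp [opTensor_htmul]

theorem opTensor_add_left (f f' : H →L[ℂ] H') (g : K →L[ℂ] K') :
    opTensor (f + f') g = opTensor f g + opTensor f' g :=
  HTensor.ext fun x y => by simp [opTensor_htmul, htmul_add_left]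

theorem opTensor_add_right (f : H →L[ℂ] H') (g g' : K →L[ℂ] K') :
    opTensor f (g + g') = opTensor f g + opTensor f g' :=
  HTensor.ext fun x y => by simp [opTensor_htmul, htmul_add_right]

theorem opTensor_smul_left (c : ℂ) (f : H →L[ℂ] H') (g : K →L[ℂ] K') :
    opTensor (c • f) g = c • opTensor f g :=
  HTensor.ext fun x y => by simp [opTensor_htmul, htmul_smul_left]

theorem opTensor_smul_right (c : ℂ) (f : H →L[ℂ] H') (g : K →L[ℂ] K') :
    opTensor f (c • g) = c • opTensor f g :=
  HTensor.ext fun x y => by simp [opTensor_htmul, htmul_smul_right]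

theorem opTensor_neg_left (f : H →L[ℂ] H') (g : K →L[ℂ] K') :
    opTensor (-f) g = -opTensor f g :=
  HTensor.ext fun x y => by simp [opTensor_htmul, htmul_neg_left]

theorem opTensor_neg_right (f : H →L[ℂ] H') (g : K →L[ℂ] K') :
    opTensor f (-g) = -opTensor f g :=
  HTensor.ext fun x y => by simp [opTensor_htmul, htmul_neg_right]

theorem opTensor_sub_left (f f' : H →L[ℂ] H') (g : K →L[ℂ] K') :
    opTensor (f - f') g = opTensor f g - opTensor f' g := by
  rw [sub_eq_add_neg, opTensor_add_left, opTensor_neg_left, ← sub_eq_add_neg]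

theorem opTensor_sub_right (f : H →L[ℂ] H') (g g' : K →L[ℂ] K') :
    opTensor f (g - g') = opTensor f g - opTensor f g' := by
  rw [sub_eq_add_neg, opTensor_add_right, opTensor_neg_right, ← sub_eq_add_neg]

theorem tmulLeft_apply (w : H) (y : K) : tmulLeft w y = htmul w y := rfl

theorem opTensor_one_comp_tmulLeft (g : K →L[ℂ] K') (w : H) :
    opTensor 1 g ∘L tmulLeft w = tmulLeft w ∘L g := by
  ext y
  simp [tmulLeft_apply, opTensor_htmul]

theorem opTensor_comp_tmulLeft_one (f : H →L[ℂ] H') (w : H) :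
    opTensor f (1 : K →L[ℂ] K) ∘L tmulLeft w = tmulLeft (f w) := by
  ext y
  simp [tmulLeft_apply, opTensor_htmul]

section Complete

variable [CompleteSpace H] [CompleteSpace K] [CompleteSpace H'] [CompleteSpace K']

theorem adjoint_opTensor (f : H →L[ℂ] H') (g : K →L[ℂ] K') :
    (opTensor f g).adjoint = opTensor f.adjoint g.adjoint :=
  HTensor.ext fun x y => (HTensor.ext_inner fun x' y' => by
    rw [ContinuousLinearMap.adjoint_inner_left, opTensor_htmul, opTensor_htmul, inner_htmul,
      inner_htmul, ContinuousLinearMap.adjoint_inner_left,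
      ContinuousLinearMap.adjoint_inner_left] : _)

theorem isSelfAdjoint_opTensor {f : H →L[ℂ] H} {g : K →L[ℂ] K} (hf : IsSelfAdjoint f)
    (hg : IsSelfAdjoint g) : IsSelfAdjoint (opTensor f g) := by
  rw [ContinuousLinearMap.isSelfAdjoint_iff'] at *
  rw [adjoint_opTensor, hf, hg]

theorem exists_sqrt_of_isPositive {f : H →L[ℂ] H} (hf : f.IsPositive) :
    ∃ r : H →L[ℂ] H, IsSelfAdjoint r ∧ r * r = f := by
  rw [← ContinuousLinearMap.nonneg_iff_isPositive] at hf
  exact ⟨CFC.sqrt f, (CFC.sqrt_nonneg f).isSelfAdjoint, CFC.sqrt_mul_sqrt_self f hf⟩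

theorem isPositive_mul_self {f : H →L[ℂ] H} (hf : IsSelfAdjoint f) : (f * f).IsPositive := by
  have := ContinuousLinearMap.isPositive_adjoint_comp_self f
  rwa [ContinuousLinearMap.isSelfAdjoint_iff'.1 hf] at this

/-- With f = r² and g = s² for self-adjoint square roots, f ⊗ g is the square of the self-adjoint
operator r ⊗ s. -/
theorem isPositive_opTensor {f : H →L[ℂ] H} {g : K →L[ℂ] K} (hf : f.IsPositive)
    (hg : g.IsPositive) : (opTensor f g).IsPositive := by
  obtain ⟨r, hr, rfl⟩ := exists_sqrt_of_isPositive hf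
  obtain ⟨s, hs, rfl⟩ := exists_sqrt_of_isPositive hg
  rw [← opTensor_mul]
  exact isPositive_mul_self (isSelfAdjoint_opTensor hr hs)

/-- The adjoint of `tmulLeft w` is the partial contraction with ⟨w| on the first factor. It lets a
property of vectors of K be tested slice by slice on the tensor product. -/
theorem adjoint_tmulLeft_opTensor_one (g : K →L[ℂ] K') (w : H) (ζ : HTensor H K) :
    (tmulLeft w).adjoint (opTensor 1 g ζ) = g ((tmulLeft w).adjoint ζ) := by
  have h := congrArg ContinuousLinearMap.adjoint (opTensor_one_comp_tmulLeft g.adjoint w)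
  rw [ContinuousLinearMap.adjoint_comp, ContinuousLinearMap.adjoint_comp, adjoint_opTensor,
    ContinuousLinearMap.adjoint_adjoint, ContinuousLinearMap.isSelfAdjoint_iff'.1 (.one _)] at h
  exact congrArg (fun f => f ζ) h

/-- If `ker g ⊆ ker g'` then `ker (1 ⊗ g) ⊆ ker (1 ⊗ g')`. -/
theorem opTensor_one_apply_eq_zero {g : K →L[ℂ] K'} {g' : K →L[ℂ] K} (h : ∀ y, g y = 0 → g' y = 0)
    {ζ : HTensor H K} (hζ : opTensor (1 : H →L[ℂ] H) g ζ = 0) :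
    opTensor (1 : H →L[ℂ] H) g' ζ = 0 := by
  refine HTensor.ext_inner fun x y => ?_
  rw [← tmulLeft_apply, ← ContinuousLinearMap.adjoint_inner_left, adjoint_tmulLeft_opTensor_one,
    h _ (by rw [← adjoint_tmulLeft_opTensor_one, hζ, map_zero]), inner_zero_left, inner_zero_left]

end Complete

end Tensor

/-! ### Traces against density operators -/

section Trace

variable {H : Type*} [NormedAddCommGroup H] [InnerProductSpace ℂ H] [CompleteSpace H]

omit [CompleteSpace H] in
theorem HilbertBasis_hasSum_norm_sq {ι : Type*} (e : HilbertBasis ι ℂ H) (x : H) :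
    HasSum (fun j => ‖⟪e j, x⟫_ℂ‖ ^ 2) (‖x‖ ^ 2) := by
  have h := (e.hasSum_inner_mul_inner x x).mapL Complex.reCLM
  refine (congrArg₂ HasSum (funext fun j => ?_) ?_).mp h
  · change (⟪x, e j⟫_ℂ * ⟪e j, x⟫_ℂ).re = _
    rw [← inner_conj_symm x (e j), Complex.conj_mul', ← Complex.ofReal_pow, Complex.ofReal_re]
  · simp [inner_self_eq_norm_sq_to_K, ← Complex.ofReal_pow]

omit [CompleteSpace H] in
theorem summable_inner_prod {ι : Type*} (e : HilbertBasis ι ℂ H) {A : H →L[ℂ] H}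
    (hA : Summable fun i => ‖A (e i)‖ ^ 2) :
    Summable fun ij : ι × ι => ‖⟪e ij.2, A (e ij.1)⟫_ℂ‖ ^ 2 := by
  refine (summable_prod_of_nonneg fun _ => by positivity).2
    ⟨fun i => (HilbertBasis_hasSum_norm_sq e (A (e i))).summable, ?_⟩
  simpa only [(HilbertBasis_hasSum_norm_sq e _).tsum_eq] using hA

/-- Cyclicity of the trace for Hilbert–Schmidt operators: `∑ ⟪B e, A e⟫ = ∑ ⟪A† e, B† e⟫`. -/
theorem hasSum_inner_adjoint {ι : Type*} (e : HilbertBasis ι ℂ H) {A B : H →L[ℂ] H}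
    (hA : Summable fun i => ‖A (e i)‖ ^ 2) (hB : Summable fun i => ‖B (e i)‖ ^ 2) :
    ∃ s, HasSum (fun i => ⟪B (e i), A (e i)⟫_ℂ) s ∧
      HasSum (fun j => ⟪A.adjoint (e j), B.adjoint (e j)⟫_ℂ) s := by
  have hF : Summable fun ij : ι × ι => ⟪B (e ij.1), e ij.2⟫_ℂ * ⟪e ij.2, A (e ij.1)⟫_ℂ := by
    -- The double series converges absolutely because ab ≤ a² + b² and both Hilbert–Schmidt norms
    -- are finite; its two iterated sums are the two traces.
    refine Summable.of_norm_bounded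
      ((summable_inner_prod e hA).add (summable_inner_prod e hB)) fun ij => ?_
    rw [norm_mul, norm_inner_symm]
    generalize ‖⟪e ij.2, A (e ij.1)⟫_ℂ‖ = a
    generalize ‖⟪e ij.2, B (e ij.1)⟫_ℂ‖ = b
    nlinarith [sq_nonneg (a - b), sq_nonneg (a + b)]
  obtain ⟨s, hs⟩ := hF
  have hs' : HasSum (fun ji : ι × ι => ⟪B (e ji.2), e ji.1⟫_ℂ * ⟪e ji.1, A (e ji.2)⟫_ℂ) s :=
    (Equiv.prodComm ι ι).hasSum_iff.2 hs
  have h1 : ∀ i, HasSum (fun j => ⟪B (e i), e j⟫_ℂ * ⟪e j, A (e i)⟫_ℂ) ⟪B (e i), A (e i)⟫_ℂ :=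
    fun i => e.hasSum_inner_mul_inner (B (e i)) (A (e i))
  have h2 : ∀ j, HasSum (fun i => ⟪B (e i), e j⟫_ℂ * ⟪e j, A (e i)⟫_ℂ)
      ⟪A.adjoint (e j), B.adjoint (e j)⟫_ℂ := by
    intro j
    have h := e.hasSum_inner_mul_inner (A.adjoint (e j)) (B.adjoint (e j))
    have e1 : ∀ i, ⟪A.adjoint (e j), e i⟫_ℂ * ⟪e i, B.adjoint (e j)⟫_ℂ =
        ⟪B (e i), e j⟫_ℂ * ⟪e j, A (e i)⟫_ℂ := fun i => by
      rw [ContinuousLinearMap.adjoint_inner_left, ContinuousLinearMap.adjoint_inner_right, mul_comm]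
    simpa only [e1] using h
  exact ⟨s, HasSum.prod_fiberwise (g := fun i => ⟪B (e i), A (e i)⟫_ℂ) hs h1,
    HasSum.prod_fiberwise (g := fun j => ⟪A.adjoint (e j), B.adjoint (e j)⟫_ℂ) hs' h2⟩

omit [CompleteSpace H] in
theorem summable_norm_sq_comp {ι : Type*} (e : ι → H) {R : H →L[ℂ] H}
    (hR : Summable fun i => ‖R (e i)‖ ^ 2) (T : H →L[ℂ] H) :
    Summable fun i => ‖(T ∘L R) (e i)‖ ^ 2 := by
  refine Summable.of_nonneg_of_le (fun _ => by positivity) (fun i => ?_) (hR.mul_left (‖T‖ ^ 2))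
  rw [← mul_pow]
  gcongr
  exact T.le_opNorm _

/-- A square root of a density operator is a Hilbert–Schmidt operator of norm one. -/
theorem IsDensity.exists_sqrt {ρ : H →L[ℂ] H} (hρ : IsDensity ρ) :
    ∃ R : H →L[ℂ] H, IsSelfAdjoint R ∧ R ∘L R = ρ ∧
      HasSum (fun i => ‖R (traceBasis H i)‖ ^ 2) 1 := by
  obtain ⟨R, hR, rfl⟩ := exists_sqrt_of_isPositive hρ.1
  refine ⟨R, hR, rfl, (congrArg₂ HasSum (funext fun j => ?_) ?_).mp (hρ.2.mapL Complex.reCLM)⟩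
  · rw [mul_apply_eq_comp, ← ContinuousLinearMap.adjoint_inner_left,
      ContinuousLinearMap.isSelfAdjoint_iff'.1 hR]
    simp [inner_self_eq_norm_sq_to_K, ← Complex.ofReal_pow]
  · simp

/-- This is Tr[RTR] = Tr[TR²], from cyclicity for the Hilbert–Schmidt operators TR and R. The first
form shows the sign of Tr[Tρ] for positive T. -/
theorem hasSum_trace_comp_sq {R : H →L[ℂ] H} (hR : IsSelfAdjoint R)
    (hs : Summable fun i => ‖R (traceBasis H i)‖ ^ 2) (T : H →L[ℂ] H) :
    ∃ s, HasSum (fun i => ⟪R (traceBasis H i), T (R (traceBasis H i))⟫_ℂ) s ∧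
      HasSum (fun i => ⟪traceBasis H i, (T ∘L R ∘L R) (traceBasis H i)⟫_ℂ) s := by
  obtain ⟨s, h1, h2⟩ := hasSum_inner_adjoint (traceBasis H) (summable_norm_sq_comp _ hs T) hs
  refine ⟨s, h1, (congrArg (HasSum · _) (funext fun i => ?_)).mp h2⟩
  rw [ContinuousLinearMap.adjoint_inner_left, ContinuousLinearMap.isSelfAdjoint_iff'.1 hR]
  rfl

theorem IsDensity.hasSum_trace {ρ : H →L[ℂ] H} (hρ : IsDensity ρ) (T : H →L[ℂ] H) :
    HasSum (fun i => ⟪traceBasis H i, (T ∘L ρ) (traceBasis H i)⟫_ℂ) (trace (T ∘L ρ)) := by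
  obtain ⟨R, hR, rfl, hs⟩ := hρ.exists_sqrt
  obtain ⟨s, -, h⟩ := hasSum_trace_comp_sq hR hs.summable T
  exact h.summable.hasSum

theorem IsDensity.trace_add {ρ : H →L[ℂ] H} (hρ : IsDensity ρ) (S T : H →L[ℂ] H) :
    trace ((S + T) ∘L ρ) = trace (S ∘L ρ) + trace (T ∘L ρ) := by
  refine (hρ.hasSum_trace _).unique ?_
  simpa [inner_add_right] using (hρ.hasSum_trace S).add (hρ.hasSum_trace T)

theorem IsDensity.trace_smul {ρ : H →L[ℂ] H} (hρ : IsDensity ρ) (c : ℂ) (T : H →L[ℂ] H) :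
    trace ((c • T) ∘L ρ) = c * trace (T ∘L ρ) := by
  refine (hρ.hasSum_trace _).unique ?_
  simpa [inner_smul_right] using (hρ.hasSum_trace T).mul_left c

/-- The functional `T ↦ Tr[T ρ]`. -/
def IsDensity.traceFunctional {ρ : H →L[ℂ] H} (hρ : IsDensity ρ) : (H →L[ℂ] H) →ₗ[ℂ] ℂ where
  toFun T := trace (T ∘L ρ)
  map_add' := hρ.trace_add
  map_smul' := hρ.trace_smul

theorem IsDensity.traceFunctional_one {ρ : H →L[ℂ] H} (hρ : IsDensity ρ) :
    hρ.traceFunctional 1 = 1 :=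
  (hρ.hasSum_trace 1).unique hρ.2

theorem IsDensity.hasSum_re_traceFunctional {R : H →L[ℂ] H} (hR : IsSelfAdjoint R)
    (hρ : IsDensity (R ∘L R)) (T : H →L[ℂ] H) :
    HasSum (fun i => (⟪R (traceBasis H i), T (R (traceBasis H i))⟫_ℂ).re)
      (hρ.traceFunctional T).re := by
  have hs : Summable fun i => ‖R (traceBasis H i)‖ ^ 2 := by
    refine (hρ.2.mapL Complex.reCLM).summable.congr fun j => ?_
    rw [ContinuousLinearMap.comp_apply, ← ContinuousLinearMap.adjoint_inner_left,
      ContinuousLinearMap.isSelfAdjoint_iff'.1 hR]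
    simp [inner_self_eq_norm_sq_to_K, ← Complex.ofReal_pow]
  obtain ⟨s, h1, h2⟩ := hasSum_trace_comp_sq hR hs T
  have e : hρ.traceFunctional T = s := (hρ.hasSum_trace T).unique h2
  rw [e]
  exact h1.mapL Complex.reCLM

theorem IsDensity.re_traceFunctional_nonneg {ρ : H →L[ℂ] H} (hρ : IsDensity ρ) {T : H →L[ℂ] H}
    (hT : T.IsPositive) : 0 ≤ (hρ.traceFunctional T).re := by
  obtain ⟨R, hR, rfl, -⟩ := hρ.exists_sqrt
  exact (hρ.hasSum_re_traceFunctional hR T).nonneg fun i => hT.re_inner_nonneg_right _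

/-- If `Tr[X† X ρ] = 0` then `X` annihilates the square root of `ρ`. -/
theorem IsDensity.comp_sqrt_eq_zero {R : H →L[ℂ] H} (hR : IsSelfAdjoint R)
    (hρ : IsDensity (R ∘L R)) {X : H →L[ℂ] H}
    (h : (hρ.traceFunctional (X.adjoint ∘L X)).re = 0) : X ∘L R = 0 := by
  have h1 := hρ.hasSum_re_traceFunctional hR (X.adjoint ∘L X)
  have e : ∀ i, (⟪R (traceBasis H i), (X.adjoint ∘L X) (R (traceBasis H i))⟫_ℂ).re =
      ‖X (R (traceBasis H i))‖ ^ 2 := by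
    intro i
    rw [ContinuousLinearMap.comp_apply, ContinuousLinearMap.adjoint_inner_right]
    simp [inner_self_eq_norm_sq_to_K, ← Complex.ofReal_pow]
  simp only [e, h] at h1
  -- A vanishing sum of the nonnegative terms ‖X R eᵢ‖² kills every term, so XR vanishes on a basis.
  have h2 := (hasSum_zero_iff_of_nonneg fun i => by positivity).1 h1
  refine ContinuousLinearMap.ext_on
    (Submodule.dense_iff_topologicalClosure_eq_top.2 (traceBasis H).dense_span) ?_
  rintro _ ⟨i, rfl⟩
  simpa using congrFun h2 i

theorem isDensity_rankOne {ψ : H} (hψ : ‖ψ‖ = 1) : IsDensity (InnerProductSpace.rankOne ℂ ψ ψ) := by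
  refine ⟨InnerProductSpace.isPositive_rankOne_self ψ, ?_⟩
  have h := (traceBasis H).hasSum_inner_mul_inner ψ ψ
  rw [inner_self_eq_norm_sq_to_K, hψ] at h
  simpa [inner_smul_right] using h

theorem trace_comp_rankOne (ψ : H) (T : H →L[ℂ] H) :
    trace (T ∘L InnerProductSpace.rankOne ℂ ψ ψ) = ⟪ψ, T ψ⟫_ℂ := by
  have h := (traceBasis H).hasSum_inner_mul_inner ψ (T ψ)
  simpa [trace, inner_smul_right] using h.tsum_eq

end Trace

/-! ### The sum of squares -/

/-- With S = b₀ + b₁ and D = b₀ - b₁ one has S² + D² = 2(b₀² + b₁²) and SD + DS = 2(b₀² - b₁²).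
Hypothesis `hD` gives S² and D² the common weight l u², so the b_y² terms are absorbed by the
defects 1 - b_y². The cross term u v a₀(SD + DS) is absorbed by the a₀ parts of these defects. The
mixed terms a₁D, a₀S and D reproduce the Bell operator. -/
theorem sos_identity {R : Type*} [Ring R] [Algebra ℂ R] {a₀ a₁ b₀ b₁ : R}
    (h₀₀ : b₀ * a₀ = a₀ * b₀) (h₀₁ : b₁ * a₀ = a₀ * b₁) (h₁₀ : b₀ * a₁ = a₁ * b₀)
    (h₁₁ : b₁ * a₁ = a₁ * b₁) {u v w l f c₁ c₂ η : ℂ} (hc₁ : 2 * f * w = c₁)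
    (hu : 2 * f * l * u = 1) (hc₂ : 2 * f * l * v = c₂) (hD : w ^ 2 + l * v ^ 2 = l * u ^ 2)
    (hη : f * (1 + l + 4 * (l * u ^ 2)) = η) :
    η • (1 : R) - (c₂ • (b₀ - b₁) + a₀ * (b₀ + b₁) + c₁ • (a₁ * (b₀ - b₁))) =
      f • ((a₁ - w • (b₀ - b₁)) * (a₁ - w • (b₀ - b₁)) +
        l • ((1 - u • (a₀ * (b₀ + b₁)) - v • (b₀ - b₁)) *
          (1 - u • (a₀ * (b₀ + b₁)) - v • (b₀ - b₁))) +
        (1 - a₁ * a₁) +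
        (l * u ^ 2) • ((1 - a₀ * a₀) * ((b₀ + b₁) * (b₀ + b₁))) +
        (2 : ℂ) • (((l * u ^ 2) • (1 : R) + (l * u * v) • a₀) * (1 - b₀ * b₀)) +
        (2 : ℂ) • (((l * u ^ 2) • (1 : R) - (l * u * v) • a₀) * (1 - b₁ * b₁))) := by
  have h₀₀' : ∀ x, b₀ * (a₀ * x) = a₀ * (b₀ * x) := fun x => by
    rw [← mul_assoc, h₀₀, mul_assoc]
  have h₀₁' : ∀ x, b₁ * (a₀ * x) = a₀ * (b₁ * x) := fun x => by
    rw [← mul_assoc, h₀₁, mul_assoc]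
  subst hc₁ hc₂ hη
  simp only [mul_add, add_mul, mul_sub, sub_mul, smul_mul_assoc, mul_smul_comm, mul_one, one_mul,
    mul_assoc, h₁₀, h₁₁, h₀₀', h₀₁']
  match_scalars <;> first
    | ring1 | linear_combination hu | linear_combination -hu
    | linear_combination f * hD | linear_combination -f * hD

section Operators

variable {H : Type*} [NormedAddCommGroup H] [InnerProductSpace ℂ H]

open scoped ComplexOrder in
theorem isPositive_ofReal_smul {r : ℝ} (hr : 0 ≤ r) {T : H →L[ℂ] H} (hT : T.IsPositive) :
    ((r : ℂ) • T).IsPositive :=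
  hT.smul_of_nonneg (Complex.zero_le_real.2 hr)

theorem isSelfAdjoint_ofReal_smul [CompleteSpace H] {X : H →L[ℂ] H} (hX : IsSelfAdjoint X)
    (r : ℝ) : IsSelfAdjoint ((r : ℂ) • X) :=
  IsSelfAdjoint.smul (Complex.conj_ofReal r) hX

theorem isSelfAdjoint_sub_ofReal_smul [CompleteSpace H] {X Y : H →L[ℂ] H} (hX : IsSelfAdjoint X)
    (hY : IsSelfAdjoint Y) (r : ℝ) : IsSelfAdjoint (X - (r : ℂ) • Y) :=
  hX.sub (isSelfAdjoint_ofReal_smul hY r)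

theorem sos_identity_clm {a₀ a₁ b₀ b₁ : H →L[ℂ] H}
    (h₀₀ : b₀ * a₀ = a₀ * b₀) (h₀₁ : b₁ * a₀ = a₀ * b₁) (h₁₀ : b₀ * a₁ = a₁ * b₀)
    (h₁₁ : b₁ * a₁ = a₁ * b₁) {u v w l f c₁ c₂ η : ℝ} (hc₁ : 2 * f * w = c₁)
    (hu : 2 * f * l * u = 1) (hc₂ : 2 * f * l * v = c₂) (hD : w ^ 2 + l * v ^ 2 = l * u ^ 2)
    (hη : f * (1 + l + 4 * (l * u ^ 2)) = η) :
    (η : ℂ) • (1 : H →L[ℂ] H) -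
        ((c₂ : ℂ) • (b₀ - b₁) + a₀ * (b₀ + b₁) + (c₁ : ℂ) • (a₁ * (b₀ - b₁))) =
      (f : ℂ) • ((a₁ - (w : ℂ) • (b₀ - b₁)) * (a₁ - (w : ℂ) • (b₀ - b₁)) +
        (l : ℂ) • ((1 - (u : ℂ) • (a₀ * (b₀ + b₁)) - (v : ℂ) • (b₀ - b₁)) *
          (1 - (u : ℂ) • (a₀ * (b₀ + b₁)) - (v : ℂ) • (b₀ - b₁))) +
        (1 - a₁ * a₁) +
        ((l * u ^ 2 : ℝ) : ℂ) • ((1 - a₀ * a₀) * ((b₀ + b₁) * (b₀ + b₁))) +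
        ((2 : ℝ) : ℂ) • ((((l * u ^ 2 : ℝ) : ℂ) • (1 : H →L[ℂ] H) + ((l * u * v : ℝ) : ℂ) • a₀) *
          (1 - b₀ * b₀)) +
        ((2 : ℝ) : ℂ) • ((((l * u ^ 2 : ℝ) : ℂ) • (1 : H →L[ℂ] H) - ((l * u * v : ℝ) : ℂ) • a₀) *
          (1 - b₁ * b₁))) := by
  have h := sos_identity h₀₀ h₀₁ h₁₀ h₁₁ (u := u) (v := v) (w := w) (l := l) (f := f) (c₁ := c₁)
    (c₂ := c₂) (η := η) (by exact_mod_cast hc₁) (by exact_mod_cast hu) (by exact_mod_cast hc₂)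
    (by exact_mod_cast hD) (by exact_mod_cast hη)
  exact_mod_cast h

end Operators

section Strategy

variable {HA : Type u} [NormedAddCommGroup HA] [InnerProductSpace ℂ HA]
variable {HB : Type v} [NormedAddCommGroup HB] [InnerProductSpace ℂ HB]

theorem bellOperator_eq (p : ℝ) (S : Strategy HA HB) : bellOperator p S =
    (((1 - 2 * p) / p : ℝ) : ℂ) • (opTensor 1 (S.obsB 0) - opTensor 1 (S.obsB 1))
    + opTensor (S.obsA 0) 1 * (opTensor 1 (S.obsB 0) + opTensor 1 (S.obsB 1))
    + (((1 - p) / p : ℝ) : ℂ) •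
      (opTensor (S.obsA 1) 1 * (opTensor 1 (S.obsB 0) - opTensor 1 (S.obsB 1))) := by
  rw [← opTensor_sub_right, ← opTensor_add_right, opTensor_mul, opTensor_mul]
  simp only [mul_one, one_mul, bellOperator]

theorem opTensor_one_mul_opTensor_one (A : HA →L[ℂ] HA) (B : HB →L[ℂ] HB) :
    opTensor 1 B * opTensor A 1 = opTensor A 1 * opTensor 1 B := by
  simp [opTensor_mul]

theorem opTensor_eq_mul (A : HA →L[ℂ] HA) (B : HB →L[ℂ] HB) :
    opTensor A B = opTensor A 1 * opTensor 1 B := by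
  simp [opTensor_mul]

/-- The operator whose square is `N₁† N₁` in the projective case. -/
def sosCore (p : ℝ) (S : Strategy HA HB) : HTensor HA HB →L[ℂ] HTensor HA HB :=
  1 - (Real.cos (phi p) : ℂ) • opTensor (S.obsA 0) (S.obsB 0 + S.obsB 1) -
    ((Real.cos (2 * theta p) / (2 * Real.cos (phi p)) : ℝ) : ℂ) •
      opTensor 1 (S.obsB 0 - S.obsB 1)

/-- The form of `sos_identity` suited to positivity: each defect is an elementary tensor of an
operator of Alice and one of Bob, whose signs can be checked separately. -/
theorem quantumBound_sub_bellOperator {p : ℝ} (hp : p ∈ Set.Ioo (2 / 5 : ℝ) 1)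
    (S : Strategy HA HB) :
    (quantumBound p : ℂ) • (1 : HTensor HA HB →L[ℂ] HTensor HA HB) - bellOperator p S =
      (sosFactor p : ℂ) • (sosN₀ p S * sosN₀ p S + (sosWeight p : ℂ) • (sosCore p S * sosCore p S) +
        opTensor (1 - S.obsA 1 * S.obsA 1) (1 : HB →L[ℂ] HB) +
        ((sosWeight p * Real.cos (phi p) ^ 2 : ℝ) : ℂ) • opTensor (1 - S.obsA 0 * S.obsA 0)
          ((S.obsB 0 + S.obsB 1) * (S.obsB 0 + S.obsB 1)) +
        ((2 : ℝ) : ℂ) • opTensor (((sosWeight p * Real.cos (phi p) ^ 2 : ℝ) : ℂ) • (1 : HA →L[ℂ] HA) +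
          ((sosWeight p * Real.cos (phi p) *
            (Real.cos (2 * theta p) / (2 * Real.cos (phi p))) : ℝ) : ℂ) • S.obsA 0 : HA →L[ℂ] HA)
          (1 - S.obsB 0 * S.obsB 0 : HB →L[ℂ] HB) +
        ((2 : ℝ) : ℂ) • opTensor (((sosWeight p * Real.cos (phi p) ^ 2 : ℝ) : ℂ) • (1 : HA →L[ℂ] HA) -
          ((sosWeight p * Real.cos (phi p) *
            (Real.cos (2 * theta p) / (2 * Real.cos (phi p))) : ℝ) : ℂ) • S.obsA 0 : HA →L[ℂ] HA)
          (1 - S.obsB 1 * S.obsB 1 : HB →L[ℂ] HB)) := by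
  have key := sos_identity_clm (H := HTensor HA HB)
    (opTensor_one_mul_opTensor_one (S.obsA 0) (S.obsB 0))
    (opTensor_one_mul_opTensor_one (S.obsA 0) (S.obsB 1))
    (opTensor_one_mul_opTensor_one (S.obsA 1) (S.obsB 0))
    (opTensor_one_mul_opTensor_one (S.obsA 1) (S.obsB 1))
    (sos_coeff_A₁D hp) (sos_coeff_A₀S hp) (sos_coeff_D hp) (sos_coeff_D_sq hp) (sos_coeff_one hp)
  rw [← bellOperator_eq] at key
  have eD : opTensor (1 : HA →L[ℂ] HA) (S.obsB 0 - S.obsB 1) =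
      opTensor 1 (S.obsB 0) - opTensor 1 (S.obsB 1) := opTensor_sub_right _ _ _
  have eS : opTensor (1 : HA →L[ℂ] HA) (S.obsB 0 + S.obsB 1) =
      opTensor 1 (S.obsB 0) + opTensor 1 (S.obsB 1) := opTensor_add_right _ _ _
  have eB : ∀ y, opTensor (1 : HA →L[ℂ] HA) (1 - S.obsB y * S.obsB y) =
      1 - opTensor 1 (S.obsB y) * opTensor 1 (S.obsB y) := fun y => by
    rw [opTensor_sub_right, opTensor_mul, opTensor_one, one_mul]
  have eA : ∀ x, opTensor (1 - S.obsA x * S.obsA x) (1 : HB →L[ℂ] HB) =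
      1 - opTensor (S.obsA x) 1 * opTensor (S.obsA x) 1 := fun x => by
    rw [opTensor_sub_left, opTensor_mul, opTensor_one, one_mul]
  have eSS : opTensor (1 : HA →L[ℂ] HA) ((S.obsB 0 + S.obsB 1) * (S.obsB 0 + S.obsB 1)) =
      (opTensor 1 (S.obsB 0) + opTensor 1 (S.obsB 1)) *
        (opTensor 1 (S.obsB 0) + opTensor 1 (S.obsB 1)) := by
    rw [← eS, opTensor_mul, one_mul]
  have eadd : ∀ κ μ : ℂ, opTensor (κ • (1 : HA →L[ℂ] HA) + μ • S.obsA 0) (1 : HB →L[ℂ] HB) =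
      κ • 1 + μ • opTensor (S.obsA 0) 1 := fun κ μ => by
    rw [opTensor_add_left, opTensor_smul_left, opTensor_smul_left, opTensor_one]
  have esub : ∀ κ μ : ℂ, opTensor (κ • (1 : HA →L[ℂ] HA) - μ • S.obsA 0) (1 : HB →L[ℂ] HB) =
      κ • 1 - μ • opTensor (S.obsA 0) 1 := fun κ μ => by
    rw [opTensor_sub_left, opTensor_smul_left, opTensor_smul_left, opTensor_one]
  have e0 := opTensor_eq_mul (S.obsA 0) (S.obsB 0 + S.obsB 1)
  have e4 := opTensor_eq_mul (1 - S.obsA 0 * S.obsA 0)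
    ((S.obsB 0 + S.obsB 1) * (S.obsB 0 + S.obsB 1))
  have e5 := fun (X : HA →L[ℂ] HA) y => opTensor_eq_mul X (1 - S.obsB y * S.obsB y)
  rw [eA, eSS] at e4
  simp only [eB] at e5
  rw [eS] at e0
  rw [key, sosN₀, sosCore, eA, e4, e5, e5, eadd, esub, e0, eD]

/-- With M₁ = 1 - M₀ the operator is 4M₀M₁. Since M₀ and M₁ commute and sum to 1, it equals 4(M₀M₁M₀
+ M₁M₀M₁), a sum of conjugates of positive operators. -/
theorem isPositive_one_sub_mul_self [CompleteSpace HA] {M₀ M₁ : HA →L[ℂ] HA} (h₀ : M₀.IsPositive)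
    (h₁ : M₁.IsPositive) (h : M₀ + M₁ = 1) :
    (1 - (M₀ - M₁) * (M₀ - M₁)).IsPositive := by
  obtain rfl : M₁ = 1 - M₀ := eq_sub_of_add_eq' h
  have e : 1 - (M₀ - (1 - M₀)) * (M₀ - (1 - M₀)) =
      ((4 : ℝ) : ℂ) • (M₀ * ((1 - M₀) * M₀) + (1 - M₀) * (M₀ * (1 - M₀))) := by
    push_cast
    simp only [mul_sub, sub_mul, mul_one, one_mul]
    module
  rw [e]
  refine isPositive_ofReal_smul zero_le_four (.add ?_ ?_)
  · have := h₁.conj_adjoint M₀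
    rwa [ContinuousLinearMap.isSelfAdjoint_iff'.1 h₀.isSelfAdjoint] at this
  · have := h₀.conj_adjoint (1 - M₀)
    rwa [ContinuousLinearMap.isSelfAdjoint_iff'.1 h₁.isSelfAdjoint] at this

/-- Substituting 1 = M₀ + M₁ gives (κ+μ)M₀ + (κ-μ)M₁, with nonnegative coefficients. -/
theorem isPositive_smul_one_add [CompleteSpace HA] {M₀ M₁ : HA →L[ℂ] HA} (h₀ : M₀.IsPositive)
    (h₁ : M₁.IsPositive) (h : M₀ + M₁ = 1) {κ μ : ℝ} (hκ : |μ| ≤ κ) :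
    ((κ : ℂ) • 1 + (μ : ℂ) • (M₀ - M₁)).IsPositive := by
  have e : (κ : ℂ) • 1 + (μ : ℂ) • (M₀ - M₁) =
      ((κ + μ : ℝ) : ℂ) • M₀ + ((κ - μ : ℝ) : ℂ) • M₁ := by
    rw [← h]
    push_cast
    module
  rw [abs_le] at hκ
  rw [e]
  exact .add (isPositive_ofReal_smul (by linarith) h₀) (isPositive_ofReal_smul (by linarith) h₁)

variable [CompleteSpace HA] [CompleteSpace HB] {S : Strategy HA HB}

/-! ### The quantum bound, the certificate and the Bell value of a quantum strategy. -/

namespace Strategy.IsQuantum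

variable (hS : S.IsQuantum)
include hS

omit [CompleteSpace HA] [CompleteSpace HB] in
theorem sum_M (x : Fin 2) : S.M x 0 + S.M x 1 = 1 := by
  rw [← (hS.1 x).2, Fin.sum_univ_two]

omit [CompleteSpace HA] [CompleteSpace HB] in
theorem sum_N (y : Fin 2) : S.N y 0 + S.N y 1 = 1 := by
  rw [← (hS.2.1 y).2, Fin.sum_univ_two]

omit [CompleteSpace HB] in
theorem isSelfAdjoint_obsA (x : Fin 2) : IsSelfAdjoint (S.obsA x) :=
  ((hS.1 x).1 0).isSelfAdjoint.sub ((hS.1 x).1 1).isSelfAdjoint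

omit [CompleteSpace HA] in
theorem isSelfAdjoint_obsB (y : Fin 2) : IsSelfAdjoint (S.obsB y) :=
  ((hS.2.1 y).1 0).isSelfAdjoint.sub ((hS.2.1 y).1 1).isSelfAdjoint

omit [CompleteSpace HA] [CompleteSpace HB] in
theorem M_eq (x a : Fin 2) : S.M x a = (1 / 2 : ℂ) • (1 + ((-1 : ℂ) ^ (a : ℕ)) • S.obsA x) := by
  rw [← hS.sum_M x, obsA]
  fin_cases a <;> simp <;> module

omit [CompleteSpace HA] [CompleteSpace HB] in
theorem N_eq (y b : Fin 2) : S.N y b = (1 / 2 : ℂ) • (1 + ((-1 : ℂ) ^ (b : ℕ)) • S.obsB y) := by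
  rw [← hS.sum_N y, obsB]
  fin_cases b <;> simp <;> module

omit [CompleteSpace HA] [CompleteSpace HB] in
theorem obsA_mul_self (hP : S.IsProjective) (x : Fin 2) : S.obsA x * S.obsA x = 1 := by
  have h := hP.1 x 0
  rw [IsIdempotentElem] at h
  rw [obsA, eq_sub_of_add_eq' (hS.sum_M x)]
  simp only [mul_sub, sub_mul, mul_one, one_mul, h]
  abel

omit [CompleteSpace HA] [CompleteSpace HB] in
theorem obsB_mul_self (hP : S.IsProjective) (y : Fin 2) : S.obsB y * S.obsB y = 1 := by
  have h := hP.2 y 0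
  rw [IsIdempotentElem] at h
  rw [obsB, eq_sub_of_add_eq' (hS.sum_N y)]
  simp only [mul_sub, sub_mul, mul_one, one_mul, h]
  abel

theorem isSelfAdjoint_sosN₀ (p : ℝ) : IsSelfAdjoint (sosN₀ p S) :=
  isSelfAdjoint_sub_ofReal_smul
    (isSelfAdjoint_opTensor (hS.isSelfAdjoint_obsA 1) (IsSelfAdjoint.one (HB →L[ℂ] HB)))
    (isSelfAdjoint_opTensor (IsSelfAdjoint.one (HA →L[ℂ] HA))
      ((hS.isSelfAdjoint_obsB 0).sub (hS.isSelfAdjoint_obsB 1))) _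

theorem isSelfAdjoint_sosCore (p : ℝ) : IsSelfAdjoint (sosCore p S) :=
  isSelfAdjoint_sub_ofReal_smul (isSelfAdjoint_sub_ofReal_smul
    (IsSelfAdjoint.one (HTensor HA HB →L[ℂ] HTensor HA HB))
    (isSelfAdjoint_opTensor (hS.isSelfAdjoint_obsA 0)
      ((hS.isSelfAdjoint_obsB 0).add (hS.isSelfAdjoint_obsB 1))) _)
    (isSelfAdjoint_opTensor (IsSelfAdjoint.one (HA →L[ℂ] HA))
      ((hS.isSelfAdjoint_obsB 0).sub (hS.isSelfAdjoint_obsB 1))) _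

/-- The Bell operator is bounded by the quantum bound, for arbitrary POVMs. -/
theorem isPositive_quantumBound_sub {p : ℝ} (hp : p ∈ Set.Ioo (2 / 5 : ℝ) 1) :
    ((quantumBound p : ℂ) • (1 : HTensor HA HB →L[ℂ] HTensor HA HB) -
      bellOperator p S).IsPositive := by
  have hL := sosWeight_pos hp
  have hf := sosFactor_pos hp
  have hC := cos_phi_pos hp
  have hκ : |sosWeight p * Real.cos (phi p) * (Real.cos (2 * theta p) / (2 * Real.cos (phi p)))| ≤
      sosWeight p * Real.cos (phi p) ^ 2 := by
    rw [abs_mul, abs_of_pos (by positivity), sq, ← mul_assoc]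
    gcongr
    exact abs_sos_coeff_le hp
  have hB : ∀ y, (1 - S.obsB y * S.obsB y).IsPositive := fun y =>
    isPositive_one_sub_mul_self ((hS.2.1 y).1 0) ((hS.2.1 y).1 1) (hS.sum_N y)
  have hA : ∀ x, (1 - S.obsA x * S.obsA x).IsPositive := fun x =>
    isPositive_one_sub_mul_self ((hS.1 x).1 0) ((hS.1 x).1 1) (hS.sum_M x)
  have hadd := isPositive_smul_one_add ((hS.1 0).1 0) ((hS.1 0).1 1) (hS.sum_M 0) hκ
  have hsub := isPositive_smul_one_add ((hS.1 0).1 0) ((hS.1 0).1 1) (hS.sum_M 0)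
    ((abs_neg _).trans_le hκ)
  rw [Complex.ofReal_neg, neg_smul, ← sub_eq_add_neg] at hsub
  rw [quantumBound_sub_bellOperator hp]
  refine isPositive_ofReal_smul hf.le (.add (.add (.add (.add (.add ?_ ?_) ?_) ?_) ?_) ?_)
  · exact isPositive_mul_self (hS.isSelfAdjoint_sosN₀ p)
  · exact isPositive_ofReal_smul hL.le (isPositive_mul_self (hS.isSelfAdjoint_sosCore p))
  · exact isPositive_opTensor (hA 1) ContinuousLinearMap.isPositive_one
  · exact isPositive_ofReal_smul (by positivity) (isPositive_opTensor (hA 0)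
      (isPositive_mul_self ((hS.isSelfAdjoint_obsB 0).add (hS.isSelfAdjoint_obsB 1))))
  · exact isPositive_ofReal_smul zero_le_two (isPositive_opTensor hadd (hB 0))
  · exact isPositive_ofReal_smul zero_le_two (isPositive_opTensor hsub (hB 1))

omit [CompleteSpace HA] [CompleteSpace HB] in
-- The unitary factor A₀ ⊗ 1 cancels in N₁†N₁. Passing to `sosCore`, which is self-adjoint, is what
-- makes the POVM version of the decomposition possible.
theorem sosN₁_eq {p : ℝ} (hp : p ∈ Set.Ioo (2 / 5 : ℝ) 1) (hP : S.IsProjective) :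
    sosN₁ p S = opTensor (S.obsA 0) 1 * sosCore p S := by
  rw [sosN₁, sosCore, sin_two_theta_div hp, mul_sub, mul_sub, mul_smul_comm, mul_smul_comm,
    opTensor_mul, opTensor_mul, hS.obsA_mul_self hP]
  simp only [mul_one, one_mul]

theorem sos_decomposition {p : ℝ} (hp : p ∈ Set.Ioo (2 / 5 : ℝ) 1) (hP : S.IsProjective) :
    (quantumBound p : ℂ) • (1 : HTensor HA HB →L[ℂ] HTensor HA HB) - bellOperator p S =
      (sosFactor p : ℂ) • ((sosN₀ p S).adjoint ∘L sosN₀ p S +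
        (sosWeight p : ℂ) • ((sosN₁ p S).adjoint ∘L sosN₁ p S)) := by
  have e1 : (sosN₁ p S).adjoint ∘L sosN₁ p S = sosCore p S * sosCore p S := by
    have h : opTensor (S.obsA 0) (1 : HB →L[ℂ] HB) * opTensor (S.obsA 0) 1 = 1 := by
      rw [opTensor_mul, hS.obsA_mul_self hP, one_mul, opTensor_one]
    rw [hS.sosN₁_eq hp hP, ← ContinuousLinearMap.mul_def, ← ContinuousLinearMap.star_eq_adjoint,
      star_mul, (isSelfAdjoint_opTensor (hS.isSelfAdjoint_obsA 0) (.one _)).star_eq,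
      (hS.isSelfAdjoint_sosCore p).star_eq, mul_assoc, ← mul_assoc _ _ (sosCore p S), h, one_mul]
  have z1 : ∀ T : HA →L[ℂ] HA, opTensor T (0 : HB →L[ℂ] HB) = 0 := fun T => by
    simpa using opTensor_smul_right (0 : ℂ) T (0 : HB →L[ℂ] HB)
  have z2 : ∀ T : HB →L[ℂ] HB, opTensor (0 : HA →L[ℂ] HA) T = 0 := fun T => by
    simpa using opTensor_smul_left (0 : ℂ) (0 : HA →L[ℂ] HA) T
  rw [e1, ContinuousLinearMap.isSelfAdjoint_iff'.1 (hS.isSelfAdjoint_sosN₀ p),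
    quantumBound_sub_bellOperator hp]
  simp only [hS.obsA_mul_self hP, hS.obsB_mul_self hP, sub_self, z1, z2, smul_zero, add_zero]
  rfl

omit [CompleteSpace HA] [CompleteSpace HB] in
-- Summing over Alice's outcome replaces her effects by the identity, so Bob's marginal does not
-- depend on x.
theorem margB_behavior (x y : Fin 2) :
    margB S.behavior x y = (hS.2.2.traceFunctional (opTensor 1 (S.obsB y))).re := by
  have e : opTensor 1 (S.obsB y) = ∑ a, ∑ b : Fin 2,
      ((-1 : ℝ) ^ (b : ℕ) : ℂ) • opTensor (S.M x a) (S.N y b) := by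
    rw [← hS.sum_M x, obsB]
    simp [Fin.sum_univ_two, opTensor_add_left, opTensor_sub_right]
    abel
  rw [e, map_sum, Complex.re_sum]
  simp_rw [map_sum, Complex.re_sum, map_smul, ← Complex.ofReal_pow, smul_eq_mul,
    Complex.re_ofReal_mul]
  rfl

omit [CompleteSpace HA] [CompleteSpace HB] in
theorem corr_behavior (x y : Fin 2) :
    corr S.behavior x y = (hS.2.2.traceFunctional (opTensor (S.obsA x) (S.obsB y))).re := by
  have e : opTensor (S.obsA x) (S.obsB y) = ∑ a : Fin 2, ∑ b : Fin 2,
      ((-1 : ℝ) ^ ((a : ℕ) + (b : ℕ)) : ℂ) • opTensor (S.M x a) (S.N y b) := by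
    rw [obsA, obsB]
    simp [Fin.sum_univ_two, opTensor_sub_left, opTensor_sub_right]
    abel
  rw [e, map_sum, Complex.re_sum]
  simp_rw [map_sum, Complex.re_sum, map_smul, ← Complex.ofReal_pow, smul_eq_mul,
    Complex.re_ofReal_mul]
  rfl

omit [CompleteSpace HA] [CompleteSpace HB] in
-- By no-signaling the two marginal differences merge, with coefficient (1-p)/p - 1 = (1-2p)/p.
theorem tiltedCHSH_behavior {p : ℝ} (hp : p ≠ 0) :
    tiltedCHSH p S.behavior = (hS.2.2.traceFunctional (bellOperator p S)).re := by
  simp only [tiltedCHSH, hS.margB_behavior, hS.corr_behavior, bellOperator, map_add, map_smul,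
    Complex.add_re, smul_eq_mul, Complex.re_ofReal_mul, opTensor_sub_right, opTensor_add_right,
    map_sub, Complex.sub_re]
  field_simp
  ring

theorem tiltedCHSH_le {p : ℝ} (hp : p ∈ Set.Ioo (2 / 5 : ℝ) 1) :
    tiltedCHSH p S.behavior ≤ quantumBound p := by
  have h := hS.2.2.re_traceFunctional_nonneg (hS.isPositive_quantumBound_sub hp)
  rw [map_sub, map_smul, IsDensity.traceFunctional_one, Complex.sub_re, smul_eq_mul, mul_one,
    Complex.ofReal_re, ← hS.tiltedCHSH_behavior (by linarith [hp.1])] at h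
  linarith

end Strategy.IsQuantum

end Strategy

/-! ### The reference strategy -/

section Reference

theorem inner_ket (i j : Fin 2) : ⟪ket i, ket j⟫_ℂ = if i = j then 1 else 0 := by
  simp [ket, EuclideanSpace.inner_single_left]

theorem pauliX_ket_zero : pauliX (ket 0) = ket 1 := by
  ext i
  fin_cases i <;> simp [pauliX, ket, Matrix.ofLp_toEuclideanCLM]

theorem pauliX_ket_one : pauliX (ket 1) = ket 0 := by
  ext i
  fin_cases i <;> simp [pauliX, ket, Matrix.ofLp_toEuclideanCLM]

theorem pauliZ_ket_zero : pauliZ (ket 0) = ket 0 := by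
  ext i
  fin_cases i <;> simp [pauliZ, ket, Matrix.ofLp_toEuclideanCLM]

theorem pauliZ_ket_one : pauliZ (ket 1) = -ket 1 := by
  ext i
  fin_cases i <;> simp [pauliZ, ket, Matrix.ofLp_toEuclideanCLM]

theorem isSelfAdjoint_pauliX : IsSelfAdjoint pauliX := by
  refine IsSelfAdjoint.map ?_ (Matrix.toEuclideanCLM (n := Fin 2) (𝕜 := ℂ))
  rw [IsSelfAdjoint, Matrix.star_eq_conjTranspose]
  ext i j
  fin_cases i <;> fin_cases j <;> simp

theorem isSelfAdjoint_pauliZ : IsSelfAdjoint pauliZ := by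
  refine IsSelfAdjoint.map ?_ (Matrix.toEuclideanCLM (n := Fin 2) (𝕜 := ℂ))
  rw [IsSelfAdjoint, Matrix.star_eq_conjTranspose]
  ext i j
  fin_cases i <;> fin_cases j <;> simp

theorem pauliX_mul_self : pauliX * pauliX = 1 := by
  rw [pauliX, ← map_mul, ← map_one (Matrix.toEuclideanCLM (n := Fin 2) (𝕜 := ℂ))]
  simp [Matrix.one_fin_two]

theorem pauliZ_mul_self : pauliZ * pauliZ = 1 := by
  rw [pauliZ, ← map_mul, ← map_one (Matrix.toEuclideanCLM (n := Fin 2) (𝕜 := ℂ))]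
  simp [Matrix.one_fin_two]

theorem pauliX_mul_pauliZ : pauliX * pauliZ = -(pauliZ * pauliX) := by
  have h : (!![0, 1; 1, 0] : Matrix (Fin 2) (Fin 2) ℂ) * !![1, 0; 0, -1] =
      -(!![1, 0; 0, -1] * !![0, 1; 1, 0]) := by
    ext i j
    fin_cases i <;> fin_cases j <;> simp
  have h' := congrArg (Matrix.toEuclideanCLM (n := Fin 2) (𝕜 := ℂ)) h
  rwa [map_neg, map_mul, map_mul] at h'

theorem isSelfAdjoint_refA (x : Fin 2) : IsSelfAdjoint (refA x) := by
  rw [refA]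
  split_ifs
  exacts [isSelfAdjoint_pauliX, isSelfAdjoint_pauliZ]

theorem refA_mul_self (x : Fin 2) : refA x * refA x = 1 := by
  rw [refA]
  split_ifs
  exacts [pauliX_mul_self, pauliZ_mul_self]

theorem refB_eq (φ : ℝ) (y : Fin 2) :
    refB φ y = (((-1) ^ (y : ℕ) * Real.cos φ : ℝ) : ℂ) • pauliZ + (Real.sin φ : ℂ) • pauliX := by
  fin_cases y
  · simp [refB]
  · simp [refB]
    module

theorem isSelfAdjoint_refB (φ : ℝ) (y : Fin 2) : IsSelfAdjoint (refB φ y) := by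
  rw [refB_eq]
  exact (isSelfAdjoint_ofReal_smul isSelfAdjoint_pauliZ _).add
    (isSelfAdjoint_ofReal_smul isSelfAdjoint_pauliX _)

theorem refB_mul_self (φ : ℝ) (y : Fin 2) : refB φ y * refB φ y = 1 := by
  have h : (((-1) ^ (y : ℕ) * Real.cos φ : ℝ)) ^ 2 + Real.sin φ ^ 2 = 1 := by
    rw [mul_pow, ← pow_mul, mul_comm (y : ℕ), pow_mul, neg_one_sq, one_pow, one_mul,
      Real.cos_sq_add_sin_sq]
  rw [refB_eq]
  generalize (-1) ^ (y : ℕ) * Real.cos φ = c at *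
  generalize Real.sin φ = s at *
  replace h : (c : ℂ) ^ 2 + (s : ℂ) ^ 2 = 1 := by exact_mod_cast h
  simp only [mul_add, add_mul, smul_mul_assoc, mul_smul_comm, pauliX_mul_self, pauliZ_mul_self,
    pauliX_mul_pauliZ]
  match_scalars
  · linear_combination h
  · ring

theorem effect_isIdempotentElem {A : Qubit →L[ℂ] Qubit} (hA : A * A = 1) (a : Fin 2) :
    IsIdempotentElem (effect A a) := by
  rw [IsIdempotentElem, effect]
  have h : ((-1 : ℂ) ^ (a : ℕ)) ^ 2 = 1 := by
    rw [← pow_mul, mul_comm, pow_mul, neg_one_sq, one_pow]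
  generalize (-1 : ℂ) ^ (a : ℕ) = c at *
  simp only [mul_add, add_mul, smul_mul_assoc, mul_smul_comm, mul_one, one_mul, hA]
  match_scalars
  · linear_combination (1 / 4 : ℂ) * h
  · ring

theorem isSelfAdjoint_effect {A : Qubit →L[ℂ] Qubit} (hA : IsSelfAdjoint A) (a : Fin 2) :
    IsSelfAdjoint (effect A a) := by
  have e : effect A a = ((1 / 2 : ℝ) : ℂ) • (1 + (((-1) ^ (a : ℕ) : ℝ) : ℂ) • A) := by
    rw [effect]
    push_cast
    rfl
  rw [e]
  exact isSelfAdjoint_ofReal_smul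
    ((IsSelfAdjoint.one (Qubit →L[ℂ] Qubit)).add (isSelfAdjoint_ofReal_smul hA _)) _

theorem isPositive_effect {A : Qubit →L[ℂ] Qubit} (hA : IsSelfAdjoint A) (hA' : A * A = 1)
    (a : Fin 2) : (effect A a).IsPositive := by
  rw [← (effect_isIdempotentElem hA' a).eq]
  exact isPositive_mul_self (isSelfAdjoint_effect hA a)

theorem sum_effect (A : Qubit →L[ℂ] Qubit) : ∑ a, effect A a = 1 := by
  simp [effect]
  module

theorem effect_sub_effect (A : Qubit →L[ℂ] Qubit) : effect A 0 - effect A 1 = A := by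
  simp [effect]
  module

theorem norm_psi (θ : ℝ) : ‖psi θ‖ = 1 := by
  have h : ⟪psi θ, psi θ⟫_ℂ = 1 := by
    simp only [psi, inner_add_left, inner_add_right, inner_smul_left, inner_smul_right,
      inner_htmul, inner_ket, Complex.conj_ofReal]
    simp only [if_true, Fin.zero_eq_one_iff, Nat.succ_ne_self, if_false, one_ne_zero]
    have := Real.cos_sq_add_sin_sq θ
    simp only [mul_one, mul_zero, add_zero, zero_add]
    exact_mod_cast (by nlinarith : Real.cos θ * Real.cos θ + Real.sin θ * Real.sin θ = 1)
  rw [inner_self_eq_norm_sq_to_K] at h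
  have h2 : ‖psi θ‖ ^ 2 = 1 := Complex.ofReal_injective (by push_cast; exact h)
  exact (pow_eq_one_iff_of_nonneg (norm_nonneg _) two_ne_zero).1 h2

variable (p : ℝ)

theorem refStrategy_isQuantum : (refStrategy p).IsQuantum :=
  ⟨fun x => ⟨isPositive_effect (isSelfAdjoint_refA x) (refA_mul_self x), sum_effect _⟩,
    fun y => ⟨isPositive_effect (isSelfAdjoint_refB _ y) (refB_mul_self _ y), sum_effect _⟩,
    isDensity_rankOne (norm_psi _)⟩

theorem refStrategy_isProjective : (refStrategy p).IsProjective :=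
  ⟨fun x => effect_isIdempotentElem (refA_mul_self x),
    fun y => effect_isIdempotentElem (refB_mul_self _ y)⟩

theorem refStrategy_obsA (x : Fin 2) : (refStrategy p).obsA x = refA x := effect_sub_effect _

theorem refStrategy_obsB (y : Fin 2) : (refStrategy p).obsB y = refB (phi p) y :=
  effect_sub_effect _

theorem refB_zero_sub_refB_one (φ : ℝ) :
    refB φ 0 - refB φ 1 = ((2 * Real.cos φ : ℝ) : ℂ) • pauliZ := by
  simp [refB]
  module

theorem refB_zero_add_refB_one (φ : ℝ) :
    refB φ 0 + refB φ 1 = ((2 * Real.sin φ : ℝ) : ℂ) • pauliX := by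
  simp [refB]
  module

variable {p} (hp : p ∈ Set.Ioo (2 / 5 : ℝ) 1)
include hp

theorem sosN₀_refStrategy_psi : sosN₀ p (refStrategy p) (psi (theta p)) = 0 := by
  have hC : (Real.cos (phi p) : ℂ) ≠ 0 := by exact_mod_cast (cos_phi_pos hp).ne'
  rw [sosN₀, refStrategy_obsA, refStrategy_obsB, refStrategy_obsB, refB_zero_sub_refB_one,
    opTensor_smul_right, smul_smul, ← Complex.ofReal_mul,
    one_div_mul_cancel (by linarith [cos_phi_pos hp]), Complex.ofReal_one, one_smul]
  simp [refA, psi, opTensor_htmul, pauliZ_ket_zero, pauliZ_ket_one, htmul_neg_left,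
    htmul_neg_right]

theorem sosN₁_refStrategy_psi : sosN₁ p (refStrategy p) (psi (theta p)) = 0 := by
  have hC := (cos_phi_pos hp).ne'
  have hS := (sin_phi_neg hp).ne
  rw [sosN₁, refStrategy_obsA, refStrategy_obsB, refStrategy_obsB, refB_zero_sub_refB_one,
    refB_zero_add_refB_one, opTensor_smul_right, opTensor_smul_right, smul_smul, smul_smul,
    ← Complex.ofReal_mul, ← Complex.ofReal_mul, div_mul_cancel₀ _ (by simpa using hS),
    div_mul_cancel₀ _ (by simpa using hC)]
  have h := Real.cos_sq_add_sin_sq (theta p)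
  have h1 : (Real.cos (theta p) : ℂ) ^ 2 + (Real.sin (theta p) : ℂ) ^ 2 = 1 := by exact_mod_cast h
  simp only [refA, psi, if_true, map_add, map_smul, sub_apply,
    smul_apply, opTensor_htmul, pauliZ_ket_zero, pauliZ_ket_one,
    pauliX_ket_zero, pauliX_ket_one, htmul_neg_right, one_apply_eq_self,
    Real.sin_two_mul, Real.cos_two_mul, Complex.ofReal_mul, Complex.ofReal_sub, Complex.ofReal_pow,
    Complex.ofReal_ofNat, Complex.ofReal_one]
  generalize Real.cos (theta p) = c at *
  generalize Real.sin (theta p) = s at *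
  match_scalars
  · linear_combination (-2 * (c : ℂ)) * h1
  · linear_combination (0 : ℂ) * h1

/-- N₀ and N₁ annihilate |ψ_θ⟩, so the certificate gives ⟨ψ_θ, (η - B_p) ψ_θ⟩ = 0 without evaluating
the behavior. -/
theorem tiltedCHSH_refStrategy : tiltedCHSH p (refStrategy p).behavior = quantumBound p := by
  have hQ := refStrategy_isQuantum p
  have h := hQ.sos_decomposition hp (refStrategy_isProjective p)
  have h0 : hQ.2.2.traceFunctional ((quantumBound p : ℂ) •
      (1 : HTensor Qubit Qubit →L[ℂ] HTensor Qubit Qubit) - bellOperator p (refStrategy p)) = 0 := by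
    rw [h]
    refine (trace_comp_rankOne _ _).trans ?_
    simp only [smul_apply, add_apply, ContinuousLinearMap.comp_apply,
      sosN₀_refStrategy_psi hp, sosN₁_refStrategy_psi hp, map_zero, smul_zero, add_zero,
      inner_zero_right]
  rw [map_sub, map_smul, IsDensity.traceFunctional_one, smul_eq_mul, mul_one] at h0
  rw [hQ.tiltedCHSH_behavior (by linarith [hp.1]), ← sub_eq_zero.1 h0, Complex.ofReal_re]

end Reference

/-! ### Self-testing: the algebraic relations on the support of the state -/

section Algebra

variable {R : Type*} [Ring R] [Algebra ℂ R] {a₀ a₁ x z r : R} {s c : ℂ}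

/-- Alice's observables anticommute on the support of the state. -/
theorem anticommute_on_support (ha₁ : a₁ * a₁ = 1)
    (hx₁ : x * a₁ = a₁ * x) (hz₁ : z * a₁ = a₁ * z) (hz₀ : z * a₀ = a₀ * z) (hxz : x * z = -(z * x))
    (hc : 1 - c ^ 2 ≠ 0) (h₁ : a₁ * r = z * r) (h₀ : a₀ * r = s • (x * r) + c • (a₀ * (z * r))) :
    (a₀ * a₁ + a₁ * a₀) * r = 0 := by
  have e1 : a₁ * (a₀ * r) = s • (x * (z * r)) + c • (a₁ * (a₀ * (a₁ * r))) := by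
    conv_lhs => rw [h₀]
    rw [mul_add, mul_smul_comm, mul_smul_comm, ← mul_assoc a₁ x, ← hx₁, mul_assoc, h₁]
  have hzz : z * (z * r) = r := by
    rw [← h₁, ← mul_assoc, hz₁, mul_assoc, ← h₁, ← mul_assoc, ha₁, one_mul]
  have e2 : a₀ * (a₁ * r) = s • (z * (x * r)) + c • (a₀ * r) := by
    rw [h₁, ← mul_assoc, ← hz₀, mul_assoc]
    conv_lhs => rw [h₀]
    rw [mul_add, mul_smul_comm, mul_smul_comm, ← mul_assoc z a₀, hz₀, mul_assoc, hzz]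
  -- Adding `e1` and `e2` cancels the s terms because x and z anticommute. The remaining c terms
  -- reassemble into c a₁ times the same anticommutator.
  have hq : (a₀ * a₁ + a₁ * a₀) * r = c • (a₁ * ((a₀ * a₁ + a₁ * a₀) * r)) := by
    have e3 : x * (z * r) = -(z * (x * r)) := by rw [← mul_assoc, hxz, neg_mul, mul_assoc]
    have e4 : a₁ * (a₁ * (a₀ * r)) = a₀ * r := by rw [← mul_assoc, ha₁, one_mul]
    simp only [add_mul, mul_add, mul_assoc]
    generalize a₁ * (a₀ * (a₁ * r)) = w at e1 ⊢
    rw [e4, e2, e1, e3]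
    module
  generalize (a₀ * a₁ + a₁ * a₀) * r = q at hq ⊢
  -- Iterating q = c a₁ q and using a₁² = 1 gives q = c² q, which forces q = 0 as c² ≠ 1.
  have hq2 : q = c ^ 2 • q := by
    conv_lhs => rw [hq, hq]
    rw [mul_smul_comm, ← mul_assoc, ha₁, one_mul, smul_smul, sq]
  have : (1 - c ^ 2) • q = 0 := by rw [sub_smul, one_smul, ← hq2, sub_self]
  exact (smul_eq_zero_iff_right hc).1 this

/-- The components of the local isometries on the support of the state. -/
theorem isometry_components (ha₀ : a₀ * a₀ = 1) (ha₁ : a₁ * a₁ = 1)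
    (hx₀ : x * a₀ = a₀ * x) (hx₁ : x * a₁ = a₁ * x)
    (h₁ : a₁ * r = z * r) (h₀ : a₀ * r = s • (x * r) + c • (a₀ * (z * r)))
    (ha : (a₀ * a₁ + a₁ * a₀) * r = 0) :
    ((1 / 2 : ℂ) • (1 + a₁)) * (((1 / 2 : ℂ) • (1 + z)) * r) = ((1 / 2 : ℂ) • (1 + a₁)) * r ∧
    ((1 / 2 : ℂ) • (1 + a₁)) * ((x * ((1 / 2 : ℂ) • (1 - z))) * r) = 0 ∧
    (a₀ * ((1 / 2 : ℂ) • (1 - a₁))) * (((1 / 2 : ℂ) • (1 + z)) * r) = 0 ∧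
    s • ((a₀ * ((1 / 2 : ℂ) • (1 - a₁))) * ((x * ((1 / 2 : ℂ) • (1 - z))) * r)) =
      (1 - c) • (((1 / 2 : ℂ) • (1 + a₁)) * r) := by
  have ha₁' : ∀ y, a₁ * (a₁ * y) = y := fun y => by rw [← mul_assoc, ha₁, one_mul]
  have ha₀' : ∀ y, a₀ * (a₀ * y) = y := fun y => by rw [← mul_assoc, ha₀, one_mul]
  have hx₀' : ∀ y, x * (a₀ * y) = a₀ * (x * y) := fun y => by rw [← mul_assoc, hx₀, mul_assoc]
  have hx₁' : ∀ y, x * (a₁ * y) = a₁ * (x * y) := fun y => by rw [← mul_assoc, hx₁, mul_assoc]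
  -- This is `h₀` multiplied by a₀, with z r replaced by a₁ r.
  have e1 : s • (a₀ * (x * r)) = r - c • (a₁ * r) := by
    have h := congrArg (a₀ * ·) h₀
    simp only [mul_add, mul_smul_comm, ha₀', ← h₁] at h
    exact eq_sub_of_add_eq h.symm
  have e2 : a₀ * (a₁ * r) = -(a₁ * (a₀ * r)) := by
    rw [add_mul, mul_assoc, mul_assoc] at ha
    exact eq_neg_of_add_eq_zero_left ha
  -- Moving x to the left exposes a₀ a₁ r, where the anticommutation on the support applies; `e1`
  -- then finishes.
  have e3 : s • (a₀ * (a₁ * (x * r))) = c • r - a₁ * r := by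
    calc s • (a₀ * (a₁ * (x * r))) = s • (x * (a₀ * (a₁ * r))) := by rw [hx₀', hx₁']
      _ = -(a₁ * (s • (a₀ * (x * r)))) := by
        rw [e2, mul_neg, hx₁', hx₀', smul_neg, mul_smul_comm]
      _ = c • r - a₁ * r := by rw [e1, mul_sub, mul_smul_comm, ha₁', neg_sub]
  simp only [add_mul, sub_mul, mul_add, mul_sub, one_mul, mul_one, smul_mul_assoc, mul_smul_comm,
    mul_assoc, ← h₁, ha₁', hx₁']
  refine ⟨by module, by module, by module, ?_⟩
  calc _ = (1 / 2 : ℂ) • (s • (a₀ * (x * r)) - s • (a₀ * (a₁ * (x * r)))) := by module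
    _ = _ := by
      rw [e1, e3]
      module

end Algebra

/-! ### Bob's regularized observables -/

section Regularization

variable {K : Type*} [NormedAddCommGroup K] [InnerProductSpace ℂ K] [CompleteSpace K]

/-- The orthogonal projection onto an invariant closed subspace commutes with a self-adjoint
operator. -/
theorem commute_starProjection {T : K →L[ℂ] K} (hT : IsSelfAdjoint T) (U : Submodule ℂ K)
    [U.HasOrthogonalProjection] (hU : ∀ y ∈ U, T y ∈ U) :
    U.starProjection * T = T * U.starProjection := by
  have hP : IsSelfAdjoint U.starProjection := isSelfAdjoint_starProjection U
  have h1 : U.starProjection * (T * U.starProjection) = T * U.starProjection := by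
    ext y
    exact Submodule.starProjection_eq_self_iff.2 (hU _ (U.starProjection_apply_mem y))
  -- Invariance says PTP = TP; its adjoint is PTP = PT.
  have h2 := congrArg star h1
  rw [star_mul, star_mul, hP.star_eq, hT.star_eq, mul_assoc] at h2
  rw [← h2, h1]

/-- Anticommuting self-adjoint operators `z`, `x` with `z² cos² + x² sin² = 1` agree with
anticommuting self-adjoint involutions on the kernel of `z² - 1`. -/
theorem exists_regularization {z x : K →L[ℂ] K} (hz : IsSelfAdjoint z) (hx : IsSelfAdjoint x)
    (hxz : x * z = -(z * x)) {α β : ℂ} (hβ : β ≠ 0) (hαβ : α + β = 1)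
    (hsum : α • (z * z) + β • (x * x) = 1) :
    ∃ q z' x' : K →L[ℂ] K, (∀ y, (z * z - 1) y = 0 → q y = 0) ∧
      IsSelfAdjoint z' ∧ IsSelfAdjoint x' ∧ z' * z' = 1 ∧ x' * x' = 1 ∧
      z' = z + (1 - z) * q ∧ x' = x + (1 - x) * q ∧ x' * z' + z' * x' = (2 : ℂ) • q := by
  set Y : K →L[ℂ] K := z * z - 1 with hY
  set U : Submodule ℂ K := LinearMap.ker (Y : K →ₗ[ℂ] K) with hU
  have hUc : IsClosed (U : Set K) := Y.isClosed_ker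
  have : CompleteSpace U := hUc.completeSpace_coe
  have hmem : ∀ y, y ∈ U ↔ Y y = 0 := fun y => LinearMap.mem_ker
  have hinv : ∀ T : K →L[ℂ] K, Y * T = T * Y → ∀ y ∈ U, T y ∈ U := by
    intro T hT y hy
    rw [hmem] at hy ⊢
    have := congrArg (fun f => f y) hT
    simp only [mul_apply_eq_comp, hy, map_zero] at this
    exact this
  have hzY : Y * z = z * Y := by rw [hY, sub_mul, mul_sub, mul_assoc, one_mul, mul_one]
  have hxY : Y * x = x * Y := by
    have e : z * (z * x) = x * (z * z) := by
      rw [← mul_assoc x, hxz, neg_mul, mul_assoc, hxz, mul_neg, neg_neg]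
    rw [hY, sub_mul, mul_sub, mul_assoc, one_mul, mul_one, e]
  set Q := U.starProjection with hQ
  have hQs : IsSelfAdjoint Q := isSelfAdjoint_starProjection U
  have hQQ : Q * Q = Q := U.isIdempotentElem_starProjection
  have hQz : Q * z = z * Q := commute_starProjection hz U (hinv z hzY)
  have hQx : Q * x = x * Q := commute_starProjection hx U (hinv x hxY)
  have hzzQ : z * (z * Q) = Q := by
    have : Y * Q = 0 := by
      ext y
      exact (hmem _).1 (U.starProjection_apply_mem y)
    rw [hY, sub_mul, one_mul, sub_eq_zero, mul_assoc] at this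
    exact this
  -- On U one has z² = 1, so α z² + β x² = 1 with α + β = 1 leaves βx² = β, and β ≠ 0.
  have hxxQ : x * (x * Q) = Q := by
    have h := congrArg (· * Q) hsum
    simp only [add_mul, smul_mul_assoc, mul_assoc, hzzQ, one_mul] at h
    have h2 : β • (x * (x * Q)) = β • Q := by
      have hβ' : (1 - α) • Q = β • Q := by rw [← hαβ, add_sub_cancel_left]
      rw [eq_sub_of_add_eq' h, ← hβ', sub_smul, one_smul]
    exact smul_right_injective _ hβ h2
  -- The regularized operator is T on U and the identity on its orthogonal complement, a
  -- self-adjoint involution. Here q is 1 - Q, the projection onto that complement.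
  have hz' : ∀ T : K →L[ℂ] K, T + (1 - T) * (1 - Q) = T * Q + (1 - Q) := fun T => by
    simp only [mul_sub, sub_mul, mul_one, one_mul]
    abel
  have hsq : ∀ T : K →L[ℂ] K, Q * T = T * Q → T * (T * Q) = Q →
      (T * Q + (1 - Q)) * (T * Q + (1 - Q)) = 1 := fun T h1 h2 => by
    have e1 : T * Q * (T * Q) = Q := by
      rw [← mul_assoc, mul_assoc T, h1, ← mul_assoc, mul_assoc, hQQ, mul_assoc, h2]
    have e2 : T * Q * Q = T * Q := by rw [mul_assoc, hQQ]
    have e3 : Q * (T * Q) = T * Q := by rw [← mul_assoc, h1, e2]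
    simp only [mul_add, add_mul, mul_sub, sub_mul, mul_one, one_mul, e1, e2, e3, hQQ]
    abel
  have hsa : ∀ T : K →L[ℂ] K, IsSelfAdjoint T → Q * T = T * Q →
      IsSelfAdjoint (T * Q + (1 - Q)) := fun T hT h1 => by
    rw [IsSelfAdjoint, star_add, star_mul, star_sub, star_one, hT.star_eq, hQs.star_eq, h1]
  refine ⟨1 - Q, z + (1 - z) * (1 - Q), x + (1 - x) * (1 - Q), fun y hy => ?_, ?_, ?_, ?_, ?_, rfl,
    rfl, ?_⟩
  · have : Q y = y := Submodule.starProjection_eq_self_iff.2 ((hmem y).2 hy)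
    rw [sub_apply, this, one_apply_eq_self, sub_self]
  · rw [hz']
    exact hsa z hz hQz
  · rw [hz']
    exact hsa x hx hQx
  · rw [hz']
    exact hsq z hQz hzzQ
  · rw [hz']
    exact hsq x hQx hxxQ
  · rw [hz', hz']
    have e1 : x * Q * (z * Q) = -(z * (x * Q)) := by
      rw [← mul_assoc, mul_assoc x, hQz, ← mul_assoc, mul_assoc, hQQ, hxz, neg_mul, mul_assoc]
    have e2 : z * Q * (x * Q) = z * (x * Q) := by
      rw [← mul_assoc, mul_assoc z, hQx, ← mul_assoc, mul_assoc, hQQ, mul_assoc]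
    have e3 : Q * (x * Q) = x * Q := by rw [← mul_assoc, hQx, mul_assoc, hQQ]
    have e4 : Q * (z * Q) = z * Q := by rw [← mul_assoc, hQz, mul_assoc, hQQ]
    simp only [mul_add, add_mul, mul_sub, sub_mul, mul_one, one_mul, e1, e2, e3, e4, hQQ,
      mul_assoc x Q Q, mul_assoc z Q Q]
    module

end Regularization

/-! ### The local isometries -/

section Isometry

variable {H : Type*} [NormedAddCommGroup H] [InnerProductSpace ℂ H]

/-- The map `ψ ↦ |0⟩ ⊗ (1 + Z)/2 ψ + |1⟩ ⊗ X (1 - Z)/2 ψ`. -/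
def swapMap (X Z : H →L[ℂ] H) : H →L[ℂ] HTensor Qubit H :=
  tmulLeft (ket 0) ∘L ((1 / 2 : ℂ) • (1 + Z)) + tmulLeft (ket 1) ∘L (X * ((1 / 2 : ℂ) • (1 - Z)))

theorem opTensor_pauliZ_comp_swapMap (X : H →L[ℂ] H) {Z : H →L[ℂ] H} (hZ : Z * Z = 1) :
    swapMap X Z ∘L Z = opTensor pauliZ (1 : H →L[ℂ] H) ∘L swapMap X Z := by
  have hZ' : ∀ y, Z (Z y) = y := fun y => congrArg (fun f => f y) hZ
  ext y
  simp only [swapMap, ContinuousLinearMap.comp_apply, add_apply, smul_apply, sub_apply, map_add,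
    mul_apply_eq_comp, one_apply_eq_self, hZ', map_sub, map_smul, tmulLeft_apply, opTensor_htmul,
    pauliZ_ket_zero, pauliZ_ket_one, htmul_neg_left]
  module

/-- X is intertwined with σ_X only up to the anticommutator of X and Z. Keeping it as an explicit
right factor suffices, since it vanishes on the support of the state. -/
theorem exists_swapMap_comp_sub {X Z : H →L[ℂ] H} (hX : X * X = 1) :
    ∃ L : H →L[ℂ] HTensor Qubit H, swapMap X Z ∘L X =
      opTensor pauliX (1 : H →L[ℂ] H) ∘L swapMap X Z + L ∘L (X * Z + Z * X) := by
  have hX' : ∀ y, X (X y) = y := fun y => congrArg (fun f => f y) hX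
  refine ⟨(1 / 2 : ℂ) • (tmulLeft (ket 0) - tmulLeft (ket 1) ∘L X), ?_⟩
  ext y
  simp only [swapMap, ContinuousLinearMap.comp_apply, add_apply, smul_apply, sub_apply, map_add,
    mul_apply_eq_comp, one_apply_eq_self, hX', map_sub, map_smul, tmulLeft_apply, opTensor_htmul,
    pauliX_ket_zero, pauliX_ket_one]
  module

variable [CompleteSpace H]

theorem adjoint_tmulLeft_comp_tmulLeft (v w : Qubit) :
    (tmulLeft v : H →L[ℂ] HTensor Qubit H).adjoint ∘L tmulLeft w = ⟪v, w⟫_ℂ • 1 := by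
  ext y
  refine ext_inner_left ℂ fun y' => ?_
  rw [ContinuousLinearMap.comp_apply, ContinuousLinearMap.adjoint_inner_right, tmulLeft_apply,
    tmulLeft_apply, inner_htmul, smul_apply, one_apply_eq_self, inner_smul_right]

/-- The components (1 ± Z)/2 are complementary orthogonal projections, X preserves norms, and the
two kets are orthonormal. No relation between X and Z is needed. -/
theorem norm_swapMap {X Z : H →L[ℂ] H} (hX : IsSelfAdjoint X) (hZ : IsSelfAdjoint Z)
    (hX2 : X * X = 1) (hZ2 : Z * Z = 1) (y : H) : ‖swapMap X Z y‖ = ‖y‖ := by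
  have hX' : ∀ y y', ⟪X y, X y'⟫_ℂ = ⟪y, y'⟫_ℂ := fun y y' => by
    have h : X (X y') = y' := congrArg (fun f => f y') hX2
    rw [← ContinuousLinearMap.adjoint_inner_right, ContinuousLinearMap.isSelfAdjoint_iff'.1 hX, h]
  have hZ' : ⟪Z y, Z y⟫_ℂ = ⟪y, y⟫_ℂ := by
    have h : Z (Z y) = y := congrArg (fun f => f y) hZ2
    rw [← ContinuousLinearMap.adjoint_inner_right, ContinuousLinearMap.isSelfAdjoint_iff'.1 hZ, h]
  have e : ⟪swapMap X Z y, swapMap X Z y⟫_ℂ = ⟪y, y⟫_ℂ := by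
    simp only [swapMap, add_apply, ContinuousLinearMap.comp_apply, tmulLeft_apply, inner_add_left,
      inner_add_right, inner_htmul, inner_ket, mul_apply_eq_comp, hX', smul_apply, sub_apply,
      one_apply_eq_self, inner_smul_left, inner_smul_right, inner_sub_left, inner_sub_right, hZ']
    norm_num [Complex.conj_ofNat]
    ring
  rw [inner_self_eq_norm_sq_to_K, inner_self_eq_norm_sq_to_K] at e
  have e2 : ‖swapMap X Z y‖ ^ 2 = ‖y‖ ^ 2 := Complex.ofReal_injective (by push_cast; exact e)
  exact (pow_left_inj₀ (norm_nonneg _) (norm_nonneg _) two_ne_zero).1 e2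

/-- `swapMap X Z` as an isometry, for self-adjoint involutions `X` and `Z`. -/
def swapIsometry {X Z : H →L[ℂ] H} (hX : IsSelfAdjoint X) (hZ : IsSelfAdjoint Z)
    (hX2 : X * X = 1) (hZ2 : Z * Z = 1) : H →ₗᵢ[ℂ] HTensor Qubit H where
  toLinearMap := (swapMap X Z : H →ₗ[ℂ] HTensor Qubit H)
  norm_map' := norm_swapMap hX hZ hX2 hZ2

theorem swapIsometry_toContinuousLinearMap {X Z : H →L[ℂ] H} (hX : IsSelfAdjoint X)
    (hZ : IsSelfAdjoint Z) (hX2 : X * X = 1) (hZ2 : Z * Z = 1) :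
    (swapIsometry hX hZ hX2 hZ2).toContinuousLinearMap = swapMap X Z := rfl

theorem adjoint_comp_self_of_norm_eq {E F : Type*} [NormedAddCommGroup E] [InnerProductSpace ℂ E]
    [CompleteSpace E] [NormedAddCommGroup F] [InnerProductSpace ℂ F] [CompleteSpace F]
    {V : E →L[ℂ] F} (hV : ∀ y, ‖V y‖ = ‖y‖) : V.adjoint ∘L V = 1 :=
  (ContinuousLinearMap.norm_map_iff_adjoint_comp_self V).1 hV

end Isometry

/-! ### Attaching a two-qubit vector -/

section Attach

variable {KA : Type*} [NormedAddCommGroup KA] [InnerProductSpace ℂ KA]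
variable {KB : Type*} [NormedAddCommGroup KB] [InnerProductSpace ℂ KB]

theorem attach_add (w w' : HTensor Qubit Qubit) :
    (attach (w + w') : HTensor KA KB →L[ℂ] HTensor (HTensor Qubit KA) (HTensor Qubit KB)) = attach w + attach w' := by
  simp only [attach, inner_add_right, add_smul, Finset.sum_add_distrib]

theorem attach_smul (c : ℂ) (w : HTensor Qubit Qubit) :
    (attach (c • w) : HTensor KA KB →L[ℂ] HTensor (HTensor Qubit KA) (HTensor Qubit KB)) =
      c • (attach w : HTensor KA KB →L[ℂ] HTensor (HTensor Qubit KA) (HTensor Qubit KB)) := by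
  simp only [attach, inner_smul_right, mul_smul, Finset.smul_sum]

theorem sum_inner_ket_smul (v : Qubit) : v = ∑ i, ⟪ket i, v⟫_ℂ • ket i := by
  ext j
  fin_cases j <;> simp [ket, EuclideanSpace.inner_single_left]

theorem tmulLeft_eq_sum (v : Qubit) :
    (tmulLeft v : KA →L[ℂ] HTensor Qubit KA) = ∑ i, ⟪ket i, v⟫_ℂ • tmulLeft (ket i) := by
  ext y
  conv_lhs => rw [sum_inner_ket_smul v]
  simp [tmulLeft_apply, Fin.sum_univ_two, htmul_add_left, htmul_smul_left]

theorem attach_htmul (v w : Qubit) :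
    (attach (htmul v w) : HTensor KA KB →L[ℂ] HTensor (HTensor Qubit KA) (HTensor Qubit KB)) = opTensor (tmulLeft v) (tmulLeft w) := by
  rw [tmulLeft_eq_sum v, tmulLeft_eq_sum w]
  simp only [attach, inner_htmul, Fin.sum_univ_two, opTensor_add_left, opTensor_add_right,
    opTensor_smul_left, opTensor_smul_right]
  module

theorem attach_psi (θ : ℝ) :
    (attach (psi θ) : HTensor KA KB →L[ℂ] HTensor (HTensor Qubit KA) (HTensor Qubit KB)) =
    (Real.cos θ : ℂ) • opTensor (tmulLeft (ket 0) : KA →L[ℂ] HTensor Qubit KA)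
        (tmulLeft (ket 0) : KB →L[ℂ] HTensor Qubit KB) +
      (Real.sin θ : ℂ) • opTensor (tmulLeft (ket 1) : KA →L[ℂ] HTensor Qubit KA)
        (tmulLeft (ket 1) : KB →L[ℂ] HTensor Qubit KB) := by
  simp only [psi, attach_add, attach_smul, attach_htmul]

theorem opTensor_comp_attach_htmul (m n : Qubit →L[ℂ] Qubit) (v w : Qubit) :
    opTensor (opTensor m (1 : KA →L[ℂ] KA)) (opTensor n (1 : KB →L[ℂ] KB)) ∘L
        (attach (htmul v w) : HTensor KA KB →L[ℂ] HTensor (HTensor Qubit KA) (HTensor Qubit KB)) =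
      attach (htmul (m v) (n w)) := by
  rw [attach_htmul, attach_htmul, opTensor_comp, opTensor_comp_tmulLeft_one,
    opTensor_comp_tmulLeft_one]

theorem opTensor_comp_attach_psi (m n : Qubit →L[ℂ] Qubit) (θ : ℝ) :
    opTensor (opTensor m (1 : KA →L[ℂ] KA)) (opTensor n (1 : KB →L[ℂ] KB)) ∘L
        (attach (psi θ) : HTensor KA KB →L[ℂ] HTensor (HTensor Qubit KA) (HTensor Qubit KB)) =
      attach (opTensor m n (psi θ)) := by
  simp only [psi, map_add, map_smul, opTensor_htmul, attach_add, attach_smul,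
    ContinuousLinearMap.comp_add, ContinuousLinearMap.comp_smul, opTensor_comp_attach_htmul]

variable [CompleteSpace KA] [CompleteSpace KB]

theorem adjoint_attach_psi_comp_attach_psi (θ : ℝ) :
    (attach (psi θ) : HTensor KA KB →L[ℂ] HTensor (HTensor Qubit KA) (HTensor Qubit KB)).adjoint ∘L attach (psi θ) = 1 := by
  have h := Real.cos_sq_add_sin_sq θ
  have h1 : (Real.cos θ : ℂ) ^ 2 + (Real.sin θ : ℂ) ^ 2 = 1 := by exact_mod_cast h
  rw [attach_psi]
  simp only [map_add, map_smulₛₗ, adjoint_opTensor, ContinuousLinearMap.comp_add,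
    ContinuousLinearMap.add_comp, ContinuousLinearMap.comp_smul, ContinuousLinearMap.smul_comp,
    opTensor_comp, adjoint_tmulLeft_comp_tmulLeft, inner_ket, Complex.conj_ofReal,
    opTensor_smul_left, opTensor_smul_right, opTensor_one]
  generalize Real.cos θ = c at *
  generalize Real.sin θ = s at *
  simp only [if_true, zero_ne_one, one_ne_zero, if_false, zero_smul, smul_zero, one_smul,
    add_zero, zero_add, smul_smul, ← add_smul]
  rw [← sq, ← sq, h1, one_smul]

end Attach

/-! ### Local isometries extracting the reference strategy -/

section Extraction

variable {HA : Type u} [NormedAddCommGroup HA] [InnerProductSpace ℂ HA]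
variable {HB : Type v} [NormedAddCommGroup HB] [InnerProductSpace ℂ HB]
variable {R : HTensor HA HB →L[ℂ] HTensor HA HB}

section Intertwine

variable {E : Type*} [NormedAddCommGroup E] [InnerProductSpace ℂ E]
variable {F : Type*} [NormedAddCommGroup F] [InnerProductSpace ℂ F]

/-- Replacements valid on R for each party alone can be made together, because operators on
different tensor factors commute: f is replaced next to R, then moved past g so that g is next to R
in turn. -/
theorem opTensor_comp_congr {f f' : HA →L[ℂ] E} {g g' : HB →L[ℂ] F}
    (hf : opTensor f (1 : HB →L[ℂ] HB) ∘L R = opTensor f' (1 : HB →L[ℂ] HB) ∘L R)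
    (hg : opTensor (1 : HA →L[ℂ] HA) g ∘L R = opTensor (1 : HA →L[ℂ] HA) g' ∘L R) :
    opTensor f g ∘L R = opTensor f' g' ∘L R := by
  have e1 : opTensor f g = opTensor (1 : E →L[ℂ] E) g ∘L opTensor f (1 : HB →L[ℂ] HB) := by
    rw [opTensor_comp]
    rfl
  have e2 : opTensor (1 : E →L[ℂ] E) g ∘L opTensor f' (1 : HB →L[ℂ] HB) =
      opTensor f' (1 : F →L[ℂ] F) ∘L opTensor (1 : HA →L[ℂ] HA) g := by
    rw [opTensor_comp, opTensor_comp]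
    rfl
  have e3 : opTensor f' g' = opTensor f' (1 : F →L[ℂ] F) ∘L opTensor (1 : HA →L[ℂ] HA) g' := by
    rw [opTensor_comp]
    rfl
  rw [e1, ContinuousLinearMap.comp_assoc, hf, ← ContinuousLinearMap.comp_assoc, e2,
    ContinuousLinearMap.comp_assoc, hg, ← ContinuousLinearMap.comp_assoc, ← e3]

theorem opTensor_one_comp_congr (f : HB →L[ℂ] F) {g g' : HB →L[ℂ] HB}
    (hg : opTensor (1 : HA →L[ℂ] HA) g ∘L R = opTensor (1 : HA →L[ℂ] HA) g' ∘L R) :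
    opTensor (1 : HA →L[ℂ] HA) (f ∘L g) ∘L R = opTensor (1 : HA →L[ℂ] HA) (f ∘L g') ∘L R := by
  have e : ∀ k : HB →L[ℂ] HB, opTensor (1 : HA →L[ℂ] HA) (f ∘L k) =
      opTensor (1 : HA →L[ℂ] HA) f ∘L opTensor (1 : HA →L[ℂ] HA) k := fun k => by
    rw [opTensor_comp]
    rfl
  rw [e, e, ContinuousLinearMap.comp_assoc, hg, ContinuousLinearMap.comp_assoc]

theorem opTensor_comp_one_eq_zero (f : HA →L[ℂ] E) {g : HA →L[ℂ] HA}
    (hg : opTensor g (1 : HB →L[ℂ] HB) ∘L R = 0) :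
    opTensor (f ∘L g) (1 : HB →L[ℂ] HB) ∘L R = 0 := by
  have e : opTensor (f ∘L g) (1 : HB →L[ℂ] HB) =
      opTensor f (1 : HB →L[ℂ] HB) ∘L opTensor g (1 : HB →L[ℂ] HB) := by
    rw [opTensor_comp]
    rfl
  rw [e, ContinuousLinearMap.comp_assoc, hg, ContinuousLinearMap.comp_zero]

theorem opTensor_one_comp_eq_zero (f : HB →L[ℂ] F) {g : HB →L[ℂ] HB}
    (hg : opTensor (1 : HA →L[ℂ] HA) g ∘L R = 0) :
    opTensor (1 : HA →L[ℂ] HA) (f ∘L g) ∘L R = 0 := by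
  have e : opTensor (1 : HA →L[ℂ] HA) (f ∘L g) =
      opTensor (1 : HA →L[ℂ] HA) f ∘L opTensor (1 : HA →L[ℂ] HA) g := by
    rw [opTensor_comp]
    rfl
  rw [e, ContinuousLinearMap.comp_assoc, hg, ContinuousLinearMap.comp_zero]

end Intertwine

/-- An observable intertwined with `r` on the support of the state has intertwined effects. -/
theorem opTensor_effect_left (V : HA →L[ℂ] HTensor Qubit HA) {A : HA →L[ℂ] HA}
    {r : Qubit →L[ℂ] Qubit}
    (h : opTensor (V ∘L A) (1 : HB →L[ℂ] HB) ∘L R =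
      opTensor (opTensor r (1 : HA →L[ℂ] HA) ∘L V) (1 : HB →L[ℂ] HB) ∘L R) (a : Fin 2) :
    opTensor (V ∘L ((1 / 2 : ℂ) • (1 + ((-1 : ℂ) ^ (a : ℕ)) • A))) (1 : HB →L[ℂ] HB) ∘L R =
      opTensor (opTensor (effect r a) (1 : HA →L[ℂ] HA) ∘L V) (1 : HB →L[ℂ] HB) ∘L R := by
  have e1 : V ∘L ((1 / 2 : ℂ) • (1 + ((-1 : ℂ) ^ (a : ℕ)) • A)) =
      (1 / 2 : ℂ) • (V + ((-1 : ℂ) ^ (a : ℕ)) • (V ∘L A)) := by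
    rw [ContinuousLinearMap.comp_smul, ContinuousLinearMap.comp_add, ContinuousLinearMap.comp_smul]
    rfl
  have e2 : opTensor (effect r a) (1 : HA →L[ℂ] HA) ∘L V =
      (1 / 2 : ℂ) • (V + ((-1 : ℂ) ^ (a : ℕ)) • (opTensor r (1 : HA →L[ℂ] HA) ∘L V)) := by
    rw [effect, opTensor_smul_left, opTensor_add_left, opTensor_smul_left, opTensor_one,
      ContinuousLinearMap.smul_comp, ContinuousLinearMap.add_comp, ContinuousLinearMap.smul_comp]
    rfl
  rw [e1, e2]
  simp only [opTensor_smul_left, opTensor_add_left, ContinuousLinearMap.smul_comp,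
    ContinuousLinearMap.add_comp, h]

theorem opTensor_effect_right (V : HB →L[ℂ] HTensor Qubit HB) {B : HB →L[ℂ] HB}
    {r : Qubit →L[ℂ] Qubit}
    (h : opTensor (1 : HA →L[ℂ] HA) (V ∘L B) ∘L R =
      opTensor (1 : HA →L[ℂ] HA) (opTensor r (1 : HB →L[ℂ] HB) ∘L V) ∘L R) (b : Fin 2) :
    opTensor (1 : HA →L[ℂ] HA) (V ∘L ((1 / 2 : ℂ) • (1 + ((-1 : ℂ) ^ (b : ℕ)) • B))) ∘L R =
      opTensor (1 : HA →L[ℂ] HA) (opTensor (effect r b) (1 : HB →L[ℂ] HB) ∘L V) ∘L R := by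
  have e1 : V ∘L ((1 / 2 : ℂ) • (1 + ((-1 : ℂ) ^ (b : ℕ)) • B)) =
      (1 / 2 : ℂ) • (V + ((-1 : ℂ) ^ (b : ℕ)) • (V ∘L B)) := by
    rw [ContinuousLinearMap.comp_smul, ContinuousLinearMap.comp_add, ContinuousLinearMap.comp_smul]
    rfl
  have e2 : opTensor (effect r b) (1 : HB →L[ℂ] HB) ∘L V =
      (1 / 2 : ℂ) • (V + ((-1 : ℂ) ^ (b : ℕ)) • (opTensor r (1 : HB →L[ℂ] HB) ∘L V)) := by
    rw [effect, opTensor_smul_left, opTensor_add_left, opTensor_smul_left, opTensor_one,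
      ContinuousLinearMap.smul_comp, ContinuousLinearMap.add_comp, ContinuousLinearMap.smul_comp]
    rfl
  rw [e1, e2]
  simp only [opTensor_smul_right, opTensor_add_right, ContinuousLinearMap.smul_comp,
    ContinuousLinearMap.add_comp, h]

theorem opTensor_tmulLeft_comp (v w : Qubit) (f : HA →L[ℂ] HA) (g : HB →L[ℂ] HB) :
    opTensor (tmulLeft v ∘L f) (tmulLeft w ∘L g) ∘L R =
      opTensor (tmulLeft v : HA →L[ℂ] HTensor Qubit HA)
        (tmulLeft w : HB →L[ℂ] HTensor Qubit HB) ∘L (opTensor f g ∘L R) := by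
  rw [← opTensor_comp, ContinuousLinearMap.comp_assoc]

/-- Expansion of a product of swap maps. -/
theorem opTensor_swapMap_comp (f₀ f₁ : HA →L[ℂ] HA) (g₀ g₁ : HB →L[ℂ] HB) :
    opTensor (tmulLeft (ket 0) ∘L f₀ + tmulLeft (ket 1) ∘L f₁)
        (tmulLeft (ket 0) ∘L g₀ + tmulLeft (ket 1) ∘L g₁) ∘L R =
      (opTensor (tmulLeft (ket 0) : HA →L[ℂ] HTensor Qubit HA)
          (tmulLeft (ket 0) : HB →L[ℂ] HTensor Qubit HB) ∘L (opTensor f₀ g₀ ∘L R) +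
        opTensor (tmulLeft (ket 1) : HA →L[ℂ] HTensor Qubit HA)
          (tmulLeft (ket 0) : HB →L[ℂ] HTensor Qubit HB) ∘L (opTensor f₁ g₀ ∘L R)) +
      (opTensor (tmulLeft (ket 0) : HA →L[ℂ] HTensor Qubit HA)
          (tmulLeft (ket 1) : HB →L[ℂ] HTensor Qubit HB) ∘L (opTensor f₀ g₁ ∘L R) +
        opTensor (tmulLeft (ket 1) : HA →L[ℂ] HTensor Qubit HA)
          (tmulLeft (ket 1) : HB →L[ℂ] HTensor Qubit HB) ∘L (opTensor f₁ g₁ ∘L R)) := by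
  simp only [opTensor_add_left, opTensor_add_right, ContinuousLinearMap.add_comp,
    opTensor_tmulLeft_comp]

end Extraction

/-- The half-angle formula (1 - cos 2θ)/sin 2θ = tan θ. -/
theorem eq_tan_smul {M : Type*} [AddCommGroup M] [Module ℂ M] {x y : M} {θ : ℝ}
    (hθ : Real.cos θ ≠ 0) (hθ' : Real.sin θ ≠ 0)
    (h : (Real.sin (2 * θ) : ℂ) • x = (1 - (Real.cos (2 * θ) : ℂ)) • y) :
    x = ((Real.sin θ / Real.cos θ : ℝ) : ℂ) • y := by
  have hs : (Real.sin (2 * θ) : ℂ) ≠ 0 := by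
    rw [Real.sin_two_mul]
    exact Complex.ofReal_ne_zero.2 (mul_ne_zero (mul_ne_zero two_ne_zero hθ') hθ)
  have hsc : (1 - (Real.cos (2 * θ) : ℂ)) =
      (Real.sin (2 * θ) : ℂ) * ((Real.sin θ / Real.cos θ : ℝ) : ℂ) := by
    have h1 : 1 - Real.cos (2 * θ) = Real.sin (2 * θ) * (Real.sin θ / Real.cos θ) := by
      have h2 := Real.sin_sq_add_cos_sq θ
      rw [Real.sin_two_mul, Real.cos_two_mul]
      field_simp
      linarith
    rw [← Complex.ofReal_mul, ← h1, Complex.ofReal_sub, Complex.ofReal_one]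
  rw [hsc, ← smul_smul] at h
  exact (smul_right_inj hs).1 h

theorem add_smul_comp_eq {E F : Type*} [NormedAddCommGroup E] [NormedSpace ℂ E]
    [NormedAddCommGroup F] [NormedSpace ℂ F] (T₀ T₁ : E →L[ℂ] F) (P : E →L[ℂ] E) {c s k t : ℂ}
    (h : c * k = 1) (h' : s * k = t) :
    T₀ ∘L P + T₁ ∘L (t • P) = (c • T₀ + s • T₁) ∘L (k • P) := by
  rw [ContinuousLinearMap.comp_smul, ContinuousLinearMap.comp_smul, ContinuousLinearMap.add_comp,
    ContinuousLinearMap.smul_comp, ContinuousLinearMap.smul_comp, smul_add, smul_smul, smul_smul,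
    mul_comm k, mul_comm k, h, h', one_smul]

theorem add_comp_eq {E F : Type*} [NormedAddCommGroup E] [NormedSpace ℂ E]
    [NormedAddCommGroup F] [NormedSpace ℂ F] (T₀₀ T₁₀ T₀₁ T₁₁ : E →L[ℂ] F)
    {E₀₀ E₁₀ E₀₁ E₁₁ P : E →L[ℂ] E} {t : ℂ} (h₀₀ : E₀₀ = P) (h₁₀ : E₁₀ = 0) (h₀₁ : E₀₁ = 0)
    (h₁₁ : E₁₁ = t • P) :
    (T₀₀ ∘L E₀₀ + T₁₀ ∘L E₁₀) + (T₀₁ ∘L E₀₁ + T₁₁ ∘L E₁₁) = T₀₀ ∘L P + T₁₁ ∘L (t • P) := by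
  rw [h₀₀, h₁₀, h₀₁, h₁₁, ContinuousLinearMap.comp_zero, ContinuousLinearMap.comp_zero, add_zero,
    zero_add]

section Extraction

variable {HA : Type u} [NormedAddCommGroup HA] [InnerProductSpace ℂ HA]
variable {HB : Type v} [NormedAddCommGroup HB] [InnerProductSpace ℂ HB]
variable {R : HTensor HA HB →L[ℂ] HTensor HA HB}

/-- The product of two swap maps when the cross terms vanish. -/
theorem opTensor_swapMap_comp_of_eq {f₀ f₁ : HA →L[ℂ] HA} {g₀ g₁ : HB →L[ℂ] HB}
    {P : HTensor HA HB →L[ℂ] HTensor HA HB} {t : ℂ} (h00 : opTensor f₀ g₀ ∘L R = P)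
    (h10 : opTensor f₁ g₀ ∘L R = 0) (h01 : opTensor f₀ g₁ ∘L R = 0)
    (h11 : opTensor f₁ g₁ ∘L R = t • P) :
    opTensor (tmulLeft (ket 0) ∘L f₀ + tmulLeft (ket 1) ∘L f₁)
        (tmulLeft (ket 0) ∘L g₀ + tmulLeft (ket 1) ∘L g₁) ∘L R =
      opTensor (tmulLeft (ket 0) : HA →L[ℂ] HTensor Qubit HA)
          (tmulLeft (ket 0) : HB →L[ℂ] HTensor Qubit HB) ∘L P +
        opTensor (tmulLeft (ket 1) : HA →L[ℂ] HTensor Qubit HA)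
          (tmulLeft (ket 1) : HB →L[ℂ] HTensor Qubit HB) ∘L (t • P) := by
  exact (opTensor_swapMap_comp f₀ f₁ g₀ g₁).trans (add_comp_eq _ _ _ _ h00 h10 h01 h11)

set_option maxHeartbeats 1000000 in
/-- The swap maps extract a multiple of the reference state on the support of the state. -/
theorem opTensor_swapMap_comp_eq_attach {A₀ A₁ : HA →L[ℂ] HA} {X Z : HB →L[ℂ] HB}
    (hA₀ : A₀ * A₀ = 1) (hA₁ : A₁ * A₁ = 1) {θ : ℝ} (hθ : Real.cos θ ≠ 0) (hθ' : Real.sin θ ≠ 0)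
    (h₁ : opTensor A₁ (1 : HB →L[ℂ] HB) * R = opTensor (1 : HA →L[ℂ] HA) Z * R)
    (h₀ : opTensor A₀ (1 : HB →L[ℂ] HB) * R =
      (Real.sin (2 * θ) : ℂ) • (opTensor (1 : HA →L[ℂ] HA) X * R) +
        (Real.cos (2 * θ) : ℂ) • (opTensor A₀ (1 : HB →L[ℂ] HB) *
          (opTensor (1 : HA →L[ℂ] HA) Z * R)))
    (ha : opTensor (A₀ * A₁ + A₁ * A₀) (1 : HB →L[ℂ] HB) * R = 0) :
    opTensor (swapMap A₀ A₁) (swapMap X Z) ∘L R = attach (psi θ) ∘L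
      (((1 / Real.cos θ : ℝ) : ℂ) • (opTensor ((1 / 2 : ℂ) • (1 + A₁)) (1 : HB →L[ℂ] HB) ∘L R)) := by
  have hc : ∀ (A : HA →L[ℂ] HA) (B : HB →L[ℂ] HB), opTensor (1 : HA →L[ℂ] HA) B *
      opTensor A (1 : HB →L[ℂ] HB) = opTensor A (1 : HB →L[ℂ] HB) * opTensor (1 : HA →L[ℂ] HA) B :=
    fun A B => opTensor_one_mul_opTensor_one A B
  have hsq : ∀ A : HA →L[ℂ] HA, A * A = 1 →
      opTensor A (1 : HB →L[ℂ] HB) * opTensor A (1 : HB →L[ℂ] HB) = 1 := fun A hA => by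
    rw [opTensor_mul, hA, one_mul, opTensor_one]
  have ha' : (opTensor A₀ (1 : HB →L[ℂ] HB) * opTensor A₁ (1 : HB →L[ℂ] HB) +
      opTensor A₁ (1 : HB →L[ℂ] HB) * opTensor A₀ (1 : HB →L[ℂ] HB)) * R = 0 := by
    rw [opTensor_mul, opTensor_mul, one_mul, ← opTensor_add_left, ha]
  obtain ⟨k1, k2, k3, k4⟩ := isometry_components (hsq A₀ hA₀) (hsq A₁ hA₁) (hc A₀ X) (hc A₁ X) h₁ h₀
    ha'
  have eP : opTensor ((1 / 2 : ℂ) • (1 + A₁)) (1 : HB →L[ℂ] HB) =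
      (1 / 2 : ℂ) • (1 + opTensor A₁ (1 : HB →L[ℂ] HB)) := by
    rw [opTensor_smul_left, opTensor_add_left, opTensor_one]
  have eP' : opTensor (A₀ * ((1 / 2 : ℂ) • (1 - A₁))) (1 : HB →L[ℂ] HB) =
      opTensor A₀ (1 : HB →L[ℂ] HB) * ((1 / 2 : ℂ) • (1 - opTensor A₁ (1 : HB →L[ℂ] HB))) := by
    rw [← opTensor_one, ← opTensor_sub_left, ← opTensor_smul_left, opTensor_mul, one_mul]
  have eQ : opTensor (1 : HA →L[ℂ] HA) ((1 / 2 : ℂ) • (1 + Z)) =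
      (1 / 2 : ℂ) • (1 + opTensor (1 : HA →L[ℂ] HA) Z) := by
    rw [opTensor_smul_right, opTensor_add_right, opTensor_one]
  have eQ' : opTensor (1 : HA →L[ℂ] HA) (X * ((1 / 2 : ℂ) • (1 - Z))) =
      opTensor (1 : HA →L[ℂ] HA) X * ((1 / 2 : ℂ) • (1 - opTensor (1 : HA →L[ℂ] HA) Z)) := by
    rw [← opTensor_one, ← opTensor_sub_right, ← opTensor_smul_right, opTensor_mul, one_mul]
  have hsplit : ∀ (f : HA →L[ℂ] HA) (g : HB →L[ℂ] HB), opTensor f g ∘L R =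
      opTensor f (1 : HB →L[ℂ] HB) * (opTensor (1 : HA →L[ℂ] HA) g * R) := fun f g => by
    rw [← mul_assoc, opTensor_mul, mul_one, one_mul]
    rfl
  rw [← eP, ← eQ, ← hsplit] at k1
  rw [← eP, ← eQ', ← hsplit] at k2
  rw [← eP', ← eQ, ← hsplit] at k3
  rw [← eP', ← eQ', ← eP, ← hsplit] at k4
  -- The |11⟩ component is tan θ times the |00⟩ component and the cross components vanish. Factoring
  -- out 1/cos θ therefore leaves cos θ |00⟩ + sin θ |11⟩.
  have k4' : opTensor (A₀ * ((1 / 2 : ℂ) • (1 - A₁))) (X * ((1 / 2 : ℂ) • (1 - Z))) ∘L R =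
      ((Real.sin θ / Real.cos θ : ℝ) : ℂ) •
        (opTensor ((1 / 2 : ℂ) • (1 + A₁)) (1 : HB →L[ℂ] HB) * R) :=
    eq_tan_smul hθ hθ' k4
  have hθc : (Real.cos θ : ℂ) * ((1 / Real.cos θ : ℝ) : ℂ) = 1 := by
    rw [← Complex.ofReal_mul, mul_one_div_cancel hθ, Complex.ofReal_one]
  have hθs : (Real.sin θ : ℂ) * ((1 / Real.cos θ : ℝ) : ℂ) =
      ((Real.sin θ / Real.cos θ : ℝ) : ℂ) := by
    rw [← Complex.ofReal_mul, mul_one_div]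
  obtain ⟨P, hP⟩ : ∃ P : HTensor HA HB →L[ℂ] HTensor HA HB,
      opTensor ((1 / 2 : ℂ) • (1 + A₁)) (1 : HB →L[ℂ] HB) ∘L R = P := ⟨_, rfl⟩
  have hG := congrArg (fun T : HTensor HA HB →L[ℂ] HTensor (HTensor Qubit HA) (HTensor Qubit HB) =>
    T ∘L (((1 / Real.cos θ : ℝ) : ℂ) • P)) (attach_psi θ)
  have h2 := add_smul_comp_eq
    (opTensor (tmulLeft (ket 0) : HA →L[ℂ] HTensor Qubit HA)
      (tmulLeft (ket 0) : HB →L[ℂ] HTensor Qubit HB))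
    (opTensor (tmulLeft (ket 1) : HA →L[ℂ] HTensor Qubit HA)
      (tmulLeft (ket 1) : HB →L[ℂ] HTensor Qubit HB)) P hθc hθs
  have h3 := opTensor_swapMap_comp_of_eq (P := P) (k1.trans hP) k3 k2
    (k4'.trans (congrArg (((Real.sin θ / Real.cos θ : ℝ) : ℂ) • ·) hP))
  have hP' := congrArg (fun T => attach (psi θ) ∘L (((1 / Real.cos θ : ℝ) : ℂ) • T)) hP
  exact h3.trans (h2.trans (hG.symm.trans hP'.symm))

variable [CompleteSpace HA] [CompleteSpace HB]

/-- Operator relations on the support of a state which yield local isometries extracting the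
reference state and observables. -/
theorem exists_local_isometries {A : Fin 2 → HA →L[ℂ] HA} {X Z : HB →L[ℂ] HB}
    (hA : ∀ x, IsSelfAdjoint (A x)) (hA2 : ∀ x, A x * A x = 1)
    (hX : IsSelfAdjoint X) (hZ : IsSelfAdjoint Z) (hXZ : X * Z = -(Z * X)) {α β : ℂ} (hβ : β ≠ 0)
    (hαβ : α + β = 1) (hsum : α • (Z * Z) + β • (X * X) = 1)
    {θ : ℝ} (hθ : Real.cos θ ≠ 0) (hθ' : Real.sin θ ≠ 0)
    (h₁ : opTensor (A 1) (1 : HB →L[ℂ] HB) * R = opTensor (1 : HA →L[ℂ] HA) Z * R)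
    (h₀ : opTensor (A 0) (1 : HB →L[ℂ] HB) * R =
      (Real.sin (2 * θ) : ℂ) • (opTensor (1 : HA →L[ℂ] HA) X * R) +
        (Real.cos (2 * θ) : ℂ) • (opTensor (A 0) (1 : HB →L[ℂ] HB) *
          (opTensor (1 : HA →L[ℂ] HA) Z * R))) :
    ∃ (VA : HA →ₗᵢ[ℂ] HTensor Qubit HA) (VB : HB →ₗᵢ[ℂ] HTensor Qubit HB)
      (G : HTensor HA HB →L[ℂ] HTensor HA HB),
      opTensor VA.toContinuousLinearMap VB.toContinuousLinearMap ∘L R = attach (psi θ) ∘L G ∧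
      (∀ x, opTensor (VA.toContinuousLinearMap ∘L A x) (1 : HB →L[ℂ] HB) ∘L R =
        opTensor (opTensor (refA x) (1 : HA →L[ℂ] HA) ∘L VA.toContinuousLinearMap)
          (1 : HB →L[ℂ] HB) ∘L R) ∧
      opTensor (1 : HA →L[ℂ] HA) (VB.toContinuousLinearMap ∘L Z) ∘L R =
        opTensor (1 : HA →L[ℂ] HA)
          (opTensor pauliZ (1 : HB →L[ℂ] HB) ∘L VB.toContinuousLinearMap) ∘L R ∧
      opTensor (1 : HA →L[ℂ] HA) (VB.toContinuousLinearMap ∘L X) ∘L R =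
        opTensor (1 : HA →L[ℂ] HA)
          (opTensor pauliX (1 : HB →L[ℂ] HB) ∘L VB.toContinuousLinearMap) ∘L R := by
  obtain ⟨q, z', x', hq, hz', hx', hz2, hx2, ez, ex, exz⟩ := exists_regularization hZ hX hXZ hβ hαβ
    hsum
  have hc : ∀ (A : HA →L[ℂ] HA) (B : HB →L[ℂ] HB), opTensor (1 : HA →L[ℂ] HA) B *
      opTensor A (1 : HB →L[ℂ] HB) = opTensor A (1 : HB →L[ℂ] HB) * opTensor (1 : HA →L[ℂ] HA) B :=
    fun A B => opTensor_one_mul_opTensor_one A B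
  have hsq : opTensor (A 1) (1 : HB →L[ℂ] HB) * opTensor (A 1) (1 : HB →L[ℂ] HB) = 1 := by
    rw [opTensor_mul, hA2, one_mul, opTensor_one]
  -- Z²R = Z A₁R = A₁ZR = A₁²R = R, as Alice's and Bob's operators commute. Hence ρ lives on ker(Z²
  -- - 1), where the regularization changes nothing.
  have hzz : opTensor (1 : HA →L[ℂ] HA) (Z * Z - 1) * R = 0 := by
    have e : opTensor (1 : HA →L[ℂ] HA) (Z * Z) * R = R := by
      have e0 : opTensor (1 : HA →L[ℂ] HA) (Z * Z) =
          opTensor (1 : HA →L[ℂ] HA) Z * opTensor (1 : HA →L[ℂ] HA) Z := by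
        rw [opTensor_mul, one_mul]
      rw [e0, mul_assoc, ← h₁, ← mul_assoc, hc, mul_assoc, ← h₁, ← mul_assoc, hsq, one_mul]
    rw [opTensor_sub_right, sub_mul, e, opTensor_one, one_mul, sub_self]
  have hqR : opTensor (1 : HA →L[ℂ] HA) q ∘L R = 0 := by
    ext y
    exact opTensor_one_apply_eq_zero hq (congrArg (fun f => f y) hzz)
  have hreg : ∀ T T' : HB →L[ℂ] HB, T' = T + (1 - T) * q →
      opTensor (1 : HA →L[ℂ] HA) T ∘L R = opTensor (1 : HA →L[ℂ] HA) T' ∘L R := by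
    rintro T _ rfl
    have e : opTensor (1 : HA →L[ℂ] HA) ((1 - T) * q) ∘L R = 0 :=
      opTensor_one_comp_eq_zero (1 - T) hqR
    rw [opTensor_add_right, ContinuousLinearMap.add_comp, e, add_zero]
  have hZR := hreg Z z' ez
  have hXR := hreg X x' ex
  have hanti : opTensor (A 0 * A 1 + A 1 * A 0) (1 : HB →L[ℂ] HB) * R = 0 := by
    have hc2 : 1 - (Real.cos (2 * θ) : ℂ) ^ 2 ≠ 0 := by
      have h2 : (1 : ℝ) - Real.cos (2 * θ) ^ 2 ≠ 0 := by
        rw [← Real.sin_sq, Real.sin_two_mul]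
        exact pow_ne_zero _ (mul_ne_zero (mul_ne_zero two_ne_zero hθ') hθ)
      rwa [← Complex.ofReal_pow, ← Complex.ofReal_one, ← Complex.ofReal_sub,
        Complex.ofReal_ne_zero]
    have hxz : opTensor (1 : HA →L[ℂ] HA) X * opTensor (1 : HA →L[ℂ] HA) Z =
        -(opTensor (1 : HA →L[ℂ] HA) Z * opTensor (1 : HA →L[ℂ] HA) X) := by
      rw [opTensor_mul, opTensor_mul, hXZ, opTensor_neg_right]
    have h := anticommute_on_support hsq (hc (A 1) X) (hc (A 1) Z) (hc (A 0) Z) hxz hc2 h₁ h₀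
    rw [opTensor_mul, opTensor_mul, one_mul, ← opTensor_add_left] at h
    exact h
  refine ⟨swapIsometry (hA 0) (hA 1) (hA2 0) (hA2 1), swapIsometry hx' hz' hx2 hz2, _,
    opTensor_swapMap_comp_eq_attach (hA2 0) (hA2 1) hθ hθ' (h₁.trans hZR) ?_ hanti, ?_, ?_, ?_⟩
  · have e1 : opTensor (1 : HA →L[ℂ] HA) Z * R = opTensor (1 : HA →L[ℂ] HA) z' * R := hZR
    have e2 : opTensor (1 : HA →L[ℂ] HA) X * R = opTensor (1 : HA →L[ℂ] HA) x' * R := hXR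
    rw [← e1, ← e2]
    exact h₀
  · simp only [swapIsometry_toContinuousLinearMap]
    intro x
    fin_cases x
    · obtain ⟨L, hL⟩ := exists_swapMap_comp_sub (Z := A 1) (hA2 0)
      have e : swapMap (A 0) (A 1) ∘L A 0 = opTensor (refA 0) (1 : HA →L[ℂ] HA) ∘L
        swapMap (A 0) (A 1) + L ∘L (A 0 * A 1 + A 1 * A 0) := hL
      have e' : opTensor (L ∘L (A 0 * A 1 + A 1 * A 0)) (1 : HB →L[ℂ] HB) ∘L R = 0 :=
        opTensor_comp_one_eq_zero L hanti
      change opTensor (swapMap (A 0) (A 1) ∘L A 0) (1 : HB →L[ℂ] HB) ∘L R =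
        opTensor (opTensor (refA 0) (1 : HA →L[ℂ] HA) ∘L swapMap (A 0) (A 1))
          (1 : HB →L[ℂ] HB) ∘L R
      rw [e, opTensor_add_left, ContinuousLinearMap.add_comp, e', add_zero]
    · have e : swapMap (A 0) (A 1) ∘L A 1 = opTensor (refA 1) (1 : HA →L[ℂ] HA) ∘L
        swapMap (A 0) (A 1) := opTensor_pauliZ_comp_swapMap (A 0) (hA2 1)
      change opTensor (swapMap (A 0) (A 1) ∘L A 1) (1 : HB →L[ℂ] HB) ∘L R =
        opTensor (opTensor (refA 1) (1 : HA →L[ℂ] HA) ∘L swapMap (A 0) (A 1))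
          (1 : HB →L[ℂ] HB) ∘L R
      rw [e]
  · simp only [swapIsometry_toContinuousLinearMap]
    have e := opTensor_one_comp_congr (swapMap x' z') hZR
    rwa [opTensor_pauliZ_comp_swapMap x' hz2] at e
  · simp only [swapIsometry_toContinuousLinearMap]
    obtain ⟨L, hL⟩ := exists_swapMap_comp_sub (Z := z') hx2
    have e' : opTensor (1 : HA →L[ℂ] HA) (L ∘L (x' * z' + z' * x')) ∘L R = 0 := by
      -- The regularized pair has anticommutator 2q, which kills R.
      refine opTensor_one_comp_eq_zero L ?_
      rw [exz, opTensor_smul_right, ContinuousLinearMap.smul_comp, hqR, smul_zero]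
    have e := opTensor_one_comp_congr (swapMap x' z') hXR
    rw [e, hL, opTensor_add_right, ContinuousLinearMap.add_comp]
    exact add_eq_left.2 e'

end Extraction

/-! ### Self-testing of the reference strategy -/

/-- For involutions, (b₀+b₁)(b₀-b₁) = b₁b₀ - b₀b₁ = -(b₀-b₁)(b₀+b₁). The squares of the sum and the
difference add up to 4, which the scalings k and l turn into the weighted relation. -/
theorem involution_sum_sub {R : Type*} [Ring R] [Algebra ℂ R] {b₀ b₁ : R} (h₀ : b₀ * b₀ = 1)
    (h₁ : b₁ * b₁ = 1) {c s k l : ℂ} (hk : 2 * c * k = 1) (hl : 2 * s * l = 1) :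
    (l • (b₀ + b₁)) * (k • (b₀ - b₁)) = -((k • (b₀ - b₁)) * (l • (b₀ + b₁))) ∧
    (c ^ 2) • ((k • (b₀ - b₁)) * (k • (b₀ - b₁))) +
      (s ^ 2) • ((l • (b₀ + b₁)) * (l • (b₀ + b₁))) = 1 ∧
    b₀ = c • (k • (b₀ - b₁)) + s • (l • (b₀ + b₁)) ∧
    b₁ = (-c) • (k • (b₀ - b₁)) + s • (l • (b₀ + b₁)) := by
  have hk2 : c * k = 1 / 2 := by linear_combination hk / 2
  have hl2 : s * l = 1 / 2 := by linear_combination hl / 2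
  have hk4 : c ^ 2 * (k * k) = 1 / 4 := by linear_combination (c * k + 1 / 2) * hk2
  have hl4 : s ^ 2 * (l * l) = 1 / 4 := by linear_combination (s * l + 1 / 2) * hl2
  refine ⟨?_, ?_, ?_, ?_⟩
  · simp only [smul_mul_assoc, mul_smul_comm, mul_add, mul_sub, add_mul, sub_mul, h₀, h₁]
    module
  · rw [smul_mul_smul_comm, smul_mul_smul_comm, smul_smul, smul_smul, hk4, hl4]
    simp only [mul_add, mul_sub, add_mul, sub_mul, h₀, h₁]
    module
  · rw [smul_smul, smul_smul, hk2, hl2]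
    module
  · rw [smul_smul, smul_smul, neg_mul, hk2, hl2]
    module

section Isometry

variable {E F : Type*} [NormedAddCommGroup E] [InnerProductSpace ℂ E] [CompleteSpace E]
variable [NormedAddCommGroup F] [InnerProductSpace ℂ F] [CompleteSpace F]
variable {V W W' : E →L[ℂ] F} {R G : E →L[ℂ] E}

theorem adjoint_comp_self_eq_of_isometry (hR : IsSelfAdjoint R) (hV : V.adjoint ∘L V = 1)
    (hW : W.adjoint ∘L W = 1) (h : V ∘L R = W ∘L G) : G.adjoint ∘L G = R ∘L R := by
  have e : (V ∘L R).adjoint ∘L (V ∘L R) = (W ∘L G).adjoint ∘L (W ∘L G) := by rw [h]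
  rw [ContinuousLinearMap.adjoint_comp, ContinuousLinearMap.adjoint_comp,
    ContinuousLinearMap.comp_assoc, ContinuousLinearMap.comp_assoc,
    ← ContinuousLinearMap.comp_assoc _ V R, hV, ← ContinuousLinearMap.comp_assoc _ W G, hW,
    ContinuousLinearMap.isSelfAdjoint_iff'.1 hR] at e
  exact e.symm

/-- Split ρ = R R†: one copy of R carries T, the other carries V†. -/
theorem comp_adjoint_eq (hR : IsSelfAdjoint R) (h : V ∘L R = W ∘L G) {T : E →L[ℂ] E}
    (hT : V ∘L T ∘L R = W' ∘L G) :
    V ∘L T ∘L (R ∘L R) ∘L V.adjoint = W' ∘L (G ∘L G.adjoint) ∘L W.adjoint := by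
  have e : (V ∘L T ∘L R) ∘L (V ∘L R).adjoint = (W' ∘L G) ∘L (W ∘L G).adjoint := by rw [h, hT]
  rw [ContinuousLinearMap.adjoint_comp, ContinuousLinearMap.adjoint_comp,
    ContinuousLinearMap.isSelfAdjoint_iff'.1 hR] at e
  exact e

/-- Tr GG† = Tr G†G, by cyclicity for the Hilbert–Schmidt operator G. -/
theorem IsDensity.comp_adjoint {ρ : E →L[ℂ] E} (hρ : IsDensity ρ) (h : G.adjoint ∘L G = ρ) :
    IsDensity (G ∘L G.adjoint) := by
  subst h
  refine ⟨ContinuousLinearMap.isPositive_self_comp_adjoint G, ?_⟩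
  have hs : Summable fun i => ‖G (traceBasis E i)‖ ^ 2 := by
    refine (hρ.2.mapL Complex.reCLM).summable.congr fun j => ?_
    rw [ContinuousLinearMap.comp_apply, ContinuousLinearMap.adjoint_inner_right]
    simp [inner_self_eq_norm_sq_to_K, ← Complex.ofReal_pow]
  obtain ⟨s, h1, h2⟩ := hasSum_inner_adjoint (traceBasis E) hs hs
  have h1' : HasSum (fun i => ⟪G (traceBasis E i), G (traceBasis E i)⟫_ℂ) 1 := by
    refine (congrArg (HasSum · _) (funext fun i => ?_)).mp hρ.2
    rw [ContinuousLinearMap.comp_apply, ContinuousLinearMap.adjoint_inner_right]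
  rw [h1.unique h1'] at h2
  refine (congrArg (HasSum · _) (funext fun i => ?_)).mp h2
  rw [ContinuousLinearMap.comp_apply, ContinuousLinearMap.adjoint_inner_left]

end Isometry

namespace Strategy.IsQuantum

variable {HA : Type u} [NormedAddCommGroup HA] [InnerProductSpace ℂ HA] [CompleteSpace HA]
variable {HB : Type v} [NormedAddCommGroup HB] [InnerProductSpace ℂ HB] [CompleteSpace HB]
variable {S : Strategy HA HB} (hS : S.IsQuantum)
include hS

/-- At maximal violation the squares in the decomposition annihilate the state. -/
theorem sosN_comp_sqrt_eq_zero {p : ℝ} (hp : p ∈ Set.Ioo (2 / 5 : ℝ) 1) (hP : S.IsProjective)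
    (h : tiltedCHSH p S.behavior = quantumBound p) {R : HTensor HA HB →L[ℂ] HTensor HA HB}
    (hR : IsSelfAdjoint R) (hRρ : R ∘L R = S.ρ) :
    sosN₀ p S ∘L R = 0 ∧ sosN₁ p S ∘L R = 0 := by
  have hρ : IsDensity (R ∘L R) := by
    rw [hRρ]
    exact hS.2.2
  have e : ∀ T, hρ.traceFunctional T = hS.2.2.traceFunctional T := fun T => by
    change trace (T ∘L (R ∘L R)) = trace (T ∘L S.ρ)
    rw [hRρ]
  have h0 : (hS.2.2.traceFunctional ((quantumBound p : ℂ) •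
      (1 : HTensor HA HB →L[ℂ] HTensor HA HB) - bellOperator p S)).re = 0 := by
    rw [map_sub, map_smul, IsDensity.traceFunctional_one, Complex.sub_re, smul_eq_mul, mul_one,
      Complex.ofReal_re, ← hS.tiltedCHSH_behavior (by linarith [hp.1]), h, sub_self]
  rw [hS.sos_decomposition hp hP, map_smul, map_add, map_smul, smul_eq_mul, smul_eq_mul,
    Complex.re_ofReal_mul, Complex.add_re, Complex.re_ofReal_mul, ← e, ← e] at h0
  have k0 := hρ.re_traceFunctional_nonneg
    (ContinuousLinearMap.isPositive_adjoint_comp_self (sosN₀ p S))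
  have k1 := hρ.re_traceFunctional_nonneg
    (ContinuousLinearMap.isPositive_adjoint_comp_self (sosN₁ p S))
  have hL := sosWeight_pos hp
  have h1 := (mul_eq_zero.1 h0).resolve_left (sosFactor_pos hp).ne'
  have hk1 := mul_nonneg hL.le k1
  refine ⟨hρ.comp_sqrt_eq_zero hR (by linarith), hρ.comp_sqrt_eq_zero hR ?_⟩
  exact (mul_eq_zero.1 (show sosWeight p * _ = 0 by linarith)).resolve_left hL.ne'

end Strategy.IsQuantum

section Strategy

variable {HA : Type u} [NormedAddCommGroup HA] [InnerProductSpace ℂ HA]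
variable {HB : Type v} [NormedAddCommGroup HB] [InnerProductSpace ℂ HB]
variable {R : HTensor HA HB →L[ℂ] HTensor HA HB}

/-- An observable of Bob in the span of `Z` and `X` is intertwined if `Z` and `X` are. -/
theorem opTensor_refB_right (V : HB →L[ℂ] HTensor Qubit HB) {X Z B : HB →L[ℂ] HB}
    (hZ : opTensor (1 : HA →L[ℂ] HA) (V ∘L Z) ∘L R =
      opTensor (1 : HA →L[ℂ] HA) (opTensor pauliZ (1 : HB →L[ℂ] HB) ∘L V) ∘L R)
    (hX : opTensor (1 : HA →L[ℂ] HA) (V ∘L X) ∘L R =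
      opTensor (1 : HA →L[ℂ] HA) (opTensor pauliX (1 : HB →L[ℂ] HB) ∘L V) ∘L R)
    {c s : ℂ} (hB : B = c • Z + s • X) :
    opTensor (1 : HA →L[ℂ] HA) (V ∘L B) ∘L R =
      opTensor (1 : HA →L[ℂ] HA)
        (opTensor (c • pauliZ + s • pauliX) (1 : HB →L[ℂ] HB) ∘L V) ∘L R := by
  subst hB
  simp only [opTensor_smul_right, opTensor_add_right, opTensor_smul_left, opTensor_add_left,
    ContinuousLinearMap.comp_add, ContinuousLinearMap.comp_smul, ContinuousLinearMap.smul_comp,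
    ContinuousLinearMap.add_comp, hZ, hX]

theorem sub_smul_opTensor_comp {A₁ : HA →L[ℂ] HA} {D : HB →L[ℂ] HB} {k : ℂ}
    (h : (opTensor A₁ (1 : HB →L[ℂ] HB) - k • opTensor (1 : HA →L[ℂ] HA) D) ∘L R = 0) :
    opTensor A₁ (1 : HB →L[ℂ] HB) * R = opTensor (1 : HA →L[ℂ] HA) (k • D) * R := by
  rw [ContinuousLinearMap.sub_comp, sub_eq_zero] at h
  rw [opTensor_smul_right]
  exact h

theorem sub_smul_sub_smul_opTensor_comp {A₀ : HA →L[ℂ] HA} {D Q : HB →L[ℂ] HB}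
    {k l s c k' l' : ℂ} (hk : k' = c * k) (hl : l' = s * l)
    (h : (opTensor A₀ (1 : HB →L[ℂ] HB) - l' • opTensor (1 : HA →L[ℂ] HA) Q -
      k' • opTensor A₀ D) ∘L R = 0) :
    opTensor A₀ (1 : HB →L[ℂ] HB) * R = s • (opTensor (1 : HA →L[ℂ] HA) (l • Q) * R) +
      c • (opTensor A₀ (1 : HB →L[ℂ] HB) * (opTensor (1 : HA →L[ℂ] HA) (k • D) * R)) := by
  have e : opTensor A₀ (1 : HB →L[ℂ] HB) * (opTensor (1 : HA →L[ℂ] HA) (k • D) * R) =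
      k • (opTensor A₀ D * R) := by
    rw [← mul_assoc, opTensor_mul, mul_one, one_mul, opTensor_smul_right, smul_mul_assoc]
  rw [ContinuousLinearMap.sub_comp, ContinuousLinearMap.sub_comp, sub_sub, sub_eq_zero,
    ContinuousLinearMap.smul_comp, ContinuousLinearMap.smul_comp, hk, hl] at h
  rw [e, opTensor_smul_right, smul_mul_assoc, smul_smul, smul_smul]
  exact h

variable [CompleteSpace HA] [CompleteSpace HB] {S : Strategy HA HB}

theorem Strategy.IsQuantum.exists_local_isometries (hS : S.IsQuantum) (hP : S.IsProjective) {p : ℝ}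
    (hp : p ∈ Set.Ioo (2 / 5 : ℝ) 1) (h : tiltedCHSH p S.behavior = quantumBound p)
    (hR : IsSelfAdjoint R) (hRρ : R ∘L R = S.ρ) :
    ∃ (VA : HA →ₗᵢ[ℂ] HTensor Qubit HA) (VB : HB →ₗᵢ[ℂ] HTensor Qubit HB)
      (G : HTensor HA HB →L[ℂ] HTensor HA HB),
      opTensor VA.toContinuousLinearMap VB.toContinuousLinearMap ∘L R =
        attach (psi (theta p)) ∘L G ∧
      (∀ x, opTensor (VA.toContinuousLinearMap ∘L S.obsA x) (1 : HB →L[ℂ] HB) ∘L R =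
        opTensor (opTensor (refA x) (1 : HA →L[ℂ] HA) ∘L VA.toContinuousLinearMap)
          (1 : HB →L[ℂ] HB) ∘L R) ∧
      ∀ y, opTensor (1 : HA →L[ℂ] HA) (VB.toContinuousLinearMap ∘L S.obsB y) ∘L R =
        opTensor (1 : HA →L[ℂ] HA)
          (opTensor (refB (phi p) y) (1 : HB →L[ℂ] HB) ∘L VB.toContinuousLinearMap) ∘L R := by
  obtain ⟨h0, h1⟩ := hS.sosN_comp_sqrt_eq_zero hp hP h hR hRρ
  have hC := (cos_phi_pos hp).ne'
  have hs := (sin_phi_neg hp).ne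
  have hθs : Real.sin (theta p) ≠ 0 := fun h0 => by
    have := sin_two_theta_neg hp
    rw [Real.sin_two_mul, h0] at this
    simp at this
  have hk : 2 * (Real.cos (phi p) : ℂ) * ((1 / (2 * Real.cos (phi p)) : ℝ) : ℂ) = 1 := by
    have : 2 * Real.cos (phi p) * (1 / (2 * Real.cos (phi p))) = 1 := by field_simp
    exact_mod_cast this
  have hl : 2 * (Real.sin (phi p) : ℂ) * ((1 / (2 * Real.sin (phi p)) : ℝ) : ℂ) = 1 := by
    have : 2 * Real.sin (phi p) * (1 / (2 * Real.sin (phi p))) = 1 := by field_simp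
    exact_mod_cast this
  have hcs : (Real.cos (phi p) : ℂ) ^ 2 + (Real.sin (phi p) : ℂ) ^ 2 = 1 := by
    exact_mod_cast Real.cos_sq_add_sin_sq (phi p)
  obtain ⟨hXZ, hsum, hB0, hB1⟩ := involution_sum_sub (hS.obsB_mul_self hP 0)
    (hS.obsB_mul_self hP 1) hk hl
  have hk' : ((Real.cos (2 * theta p) / (2 * Real.cos (phi p)) : ℝ) : ℂ) =
      (Real.cos (2 * theta p) : ℂ) * ((1 / (2 * Real.cos (phi p)) : ℝ) : ℂ) := by
    rw [← Complex.ofReal_mul, mul_one_div]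
  have hl' : ((Real.sin (2 * theta p) / (2 * Real.sin (phi p)) : ℝ) : ℂ) =
      (Real.sin (2 * theta p) : ℂ) * ((1 / (2 * Real.sin (phi p)) : ℝ) : ℂ) := by
    rw [← Complex.ofReal_mul, mul_one_div]
  -- Here Z and X are the rescaled difference and sum of Bob's observables, with α = cos²φ and β =
  -- sin²φ.
  obtain ⟨VA, VB, G, k1, k2, k3, k4⟩ := BellTilted.exists_local_isometries (A := S.obsA)
    hS.isSelfAdjoint_obsA (hS.obsA_mul_self hP)
    (isSelfAdjoint_ofReal_smul ((hS.isSelfAdjoint_obsB 0).add (hS.isSelfAdjoint_obsB 1)) _)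
    (isSelfAdjoint_ofReal_smul ((hS.isSelfAdjoint_obsB 0).sub (hS.isSelfAdjoint_obsB 1)) _)
    hXZ (pow_ne_zero 2 (Complex.ofReal_ne_zero.2 hs)) hcs hsum (cos_theta_ne_zero hp) hθs
    (sub_smul_opTensor_comp h0) (sub_smul_sub_smul_opTensor_comp hk' hl' h1)
  refine ⟨VA, VB, G, k1, k2, fun y => ?_⟩
  fin_cases y
  · exact opTensor_refB_right _ k3 k4 hB0
  · have e := opTensor_refB_right VB.toContinuousLinearMap k3 k4 hB1
    have er : refB (phi p) 1 =
        (-(Real.cos (phi p) : ℂ)) • pauliZ + (Real.sin (phi p) : ℂ) • pauliX :=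
      (congrArg (· + (Real.sin (phi p) : ℂ) • pauliX)
        (neg_smul (Real.cos (phi p) : ℂ) pauliZ)).symm
    rw [← er] at e
    exact e

end Strategy

section SelfTest

variable {HA : Type u} [NormedAddCommGroup HA] [InnerProductSpace ℂ HA]
variable {HB : Type v} [NormedAddCommGroup HB] [InnerProductSpace ℂ HB]

theorem opTensor_comp_of_intertwined {R G : HTensor HA HB →L[ℂ] HTensor HA HB}
    {VA : HA →L[ℂ] HTensor Qubit HA} {VB : HB →L[ℂ] HTensor Qubit HB} {M : HA →L[ℂ] HA}
    {N : HB →L[ℂ] HB} {m n : Qubit →L[ℂ] Qubit} {θ : ℝ}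
    (hG : opTensor VA VB ∘L R = attach (psi θ) ∘L G)
    (hM : opTensor (VA ∘L M) (1 : HB →L[ℂ] HB) ∘L R =
      opTensor (opTensor m (1 : HA →L[ℂ] HA) ∘L VA) (1 : HB →L[ℂ] HB) ∘L R)
    (hN : opTensor (1 : HA →L[ℂ] HA) (VB ∘L N) ∘L R =
      opTensor (1 : HA →L[ℂ] HA) (opTensor n (1 : HB →L[ℂ] HB) ∘L VB) ∘L R) :
    opTensor VA VB ∘L opTensor M N ∘L R = attach (opTensor m n (psi θ)) ∘L G := by
  have e1 : opTensor VA VB ∘L opTensor M N ∘L R = opTensor (VA ∘L M) (VB ∘L N) ∘L R := by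
    rw [← ContinuousLinearMap.comp_assoc, opTensor_comp]
  have e2 : opTensor (opTensor m (1 : HA →L[ℂ] HA) ∘L VA) (opTensor n (1 : HB →L[ℂ] HB) ∘L VB) ∘L R
      = opTensor (opTensor m (1 : HA →L[ℂ] HA)) (opTensor n (1 : HB →L[ℂ] HB)) ∘L
        (opTensor VA VB ∘L R) := by
    rw [← ContinuousLinearMap.comp_assoc, opTensor_comp]
  have e3 : opTensor (opTensor m (1 : HA →L[ℂ] HA)) (opTensor n (1 : HB →L[ℂ] HB)) ∘L
        (attach (psi θ) ∘L G) = attach (opTensor m n (psi θ)) ∘L G := by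
    rw [← ContinuousLinearMap.comp_assoc, opTensor_comp_attach_psi]
  exact e1.trans ((opTensor_comp_congr hM hN).trans (e2.trans
    ((congrArg (fun T => opTensor (opTensor m (1 : HA →L[ℂ] HA)) (opTensor n (1 : HB →L[ℂ] HB)) ∘L T)
      hG).trans e3)))

variable [CompleteSpace HA] [CompleteSpace HB] {S : Strategy HA HB}

theorem adjoint_opTensor_comp_self {VA : HA →L[ℂ] HTensor Qubit HA}
    {VB : HB →L[ℂ] HTensor Qubit HB} (hA : ∀ y, ‖VA y‖ = ‖y‖) (hB : ∀ y, ‖VB y‖ = ‖y‖) :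
    (opTensor VA VB).adjoint ∘L opTensor VA VB = 1 := by
  rw [adjoint_opTensor, opTensor_comp, adjoint_comp_self_of_norm_eq hA,
    adjoint_comp_self_of_norm_eq hB, opTensor_one]

theorem Strategy.IsQuantum.equivUpToLocalIsometries (hS : S.IsQuantum) (hP : S.IsProjective) {p : ℝ}
    (hp : p ∈ Set.Ioo (2 / 5 : ℝ) 1) (h : tiltedCHSH p S.behavior = quantumBound p) :
    EquivUpToLocalIsometries S (refStrategy p).M (refStrategy p).N (psi (theta p)) := by
  obtain ⟨R, hR, hRρ, -⟩ := hS.2.2.exists_sqrt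
  obtain ⟨VA, VB, G, hG, hA, hB⟩ := hS.exists_local_isometries hP hp h hR hRρ
  have hV := adjoint_opTensor_comp_self (VA := VA.toContinuousLinearMap)
    (VB := VB.toContinuousLinearMap) VA.norm_map VB.norm_map
  have hGρ : G.adjoint ∘L G = S.ρ := (adjoint_comp_self_eq_of_isometry hR hV
    (adjoint_attach_psi_comp_attach_psi (theta p)) hG).trans hRρ
  have hM : ∀ x a, opTensor (VA.toContinuousLinearMap ∘L S.M x a) (1 : HB →L[ℂ] HB) ∘L R =
      opTensor (opTensor ((refStrategy p).M x a) (1 : HA →L[ℂ] HA) ∘L VA.toContinuousLinearMap)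
        (1 : HB →L[ℂ] HB) ∘L R := fun x a => by
    rw [hS.M_eq]
    exact opTensor_effect_left VA.toContinuousLinearMap (hA x) a
  have hN : ∀ y b, opTensor (1 : HA →L[ℂ] HA) (VB.toContinuousLinearMap ∘L S.N y b) ∘L R =
      opTensor (1 : HA →L[ℂ] HA) (opTensor ((refStrategy p).N y b) (1 : HB →L[ℂ] HB) ∘L
        VB.toContinuousLinearMap) ∘L R := fun y b => by
    rw [hS.N_eq]
    exact opTensor_effect_right VB.toContinuousLinearMap (hB y) b
  -- The auxiliary spaces are the original ones, and the auxiliary state is σ = GG†.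
  refine ⟨HA, _, _, inferInstance, HB, _, _, inferInstance, VA, VB, G ∘L G.adjoint,
    hS.2.2.comp_adjoint hGρ, fun a b x y => ?_⟩
  rw [← hRρ]
  exact comp_adjoint_eq hR hG (opTensor_comp_of_intertwined hG (hM x a) (hN y b))

end SelfTest

end BellTilted

end

open BellTilted in
theorem mainTheorem1 (p : ℝ) (hp : p ∈ Set.Ioo (2 / 5 : ℝ) 1) :
    -- the local bound, over non-signaling local behaviors
    IsGreatest (tiltedCHSH p '' localNS) (localBound p) ∧
    -- the local bound, over the one-way signaling polytope
    IsGreatest (tiltedCHSH p '' localSignaling p p (1 / 2) (1 / 2)) (signalingBound p) ∧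
    (1 / 2 ≤ p → localBound p = 2 ∧ signalingBound p = 2) ∧
    -- the quantum bound, for arbitrary Hilbert spaces and POVMs
    (∀ (HA : Type u) [NormedAddCommGroup HA] [InnerProductSpace ℂ HA] [CompleteSpace HA]
      (HB : Type v) [NormedAddCommGroup HB] [InnerProductSpace ℂ HB] [CompleteSpace HB]
      (S : Strategy HA HB), S.IsQuantum → tiltedCHSH p S.behavior ≤ quantumBound p) ∧
    -- the sum-of-squares decomposition of the shifted Bell operator
    0 < sosWeight p ∧ 0 < sosFactor p ∧
    (∀ (HA : Type u) [NormedAddCommGroup HA] [InnerProductSpace ℂ HA] [CompleteSpace HA]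
      (HB : Type v) [NormedAddCommGroup HB] [InnerProductSpace ℂ HB] [CompleteSpace HB]
      (S : Strategy HA HB), S.IsQuantum → S.IsProjective →
        tiltedCHSH p S.behavior = (trace (bellOperator p S ∘L S.ρ)).re ∧
        (quantumBound p : ℂ) • (1 : HTensor HA HB →L[ℂ] HTensor HA HB) - bellOperator p S =
          (sosFactor p : ℂ) • ((sosN₀ p S).adjoint ∘L sosN₀ p S +
            (sosWeight p : ℂ) • ((sosN₁ p S).adjoint ∘L sosN₁ p S))) ∧
    -- the reference strategy is a projective quantum strategy attaining the quantum bound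
    ((refStrategy p).IsQuantum ∧ (refStrategy p).IsProjective ∧
      tiltedCHSH p (refStrategy p).behavior = quantumBound p) ∧
    -- it is the only one up to local isometries
    (∀ (HA : Type u) [NormedAddCommGroup HA] [InnerProductSpace ℂ HA] [CompleteSpace HA]
      (HB : Type v) [NormedAddCommGroup HB] [InnerProductSpace ℂ HB] [CompleteSpace HB]
      (S : Strategy HA HB), S.IsQuantum → S.IsProjective →
        tiltedCHSH p S.behavior = quantumBound p →
        EquivUpToLocalIsometries S (refStrategy p).M (refStrategy p).N (psi (theta p))) := by
  exact ⟨isGreatest_localNS hp, isGreatest_localSignaling hp,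
    fun h => ⟨localBound_eq_two h, (localBound_eq_signalingBound hp).symm.trans
      (localBound_eq_two h)⟩,
    fun _ _ _ _ _ _ _ _ _ hS => hS.tiltedCHSH_le hp, sosWeight_pos hp, sosFactor_pos hp,
    fun _ _ _ _ _ _ _ _ _ hS hP => ⟨hS.tiltedCHSH_behavior (by linarith [hp.1]),
      hS.sos_decomposition hp hP⟩,
    ⟨refStrategy_isQuantum p, refStrategy_isProjective p, tiltedCHSH_refStrategy hp⟩,
    fun _ _ _ _ _ _ _ _ _ hS hP h => hS.equivUpToLocalIsometries hP hp h⟩
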